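/- **Setting.** For $\varpi,\alpha>0$ consider the reduced Hamiltonian of the spatial isosceles three-body problem on $\{(p_r,p_z,r,z): r>0\}$, with symplectic form $dp_r\wedge dr+dp_z\wedge dz$, $$H=\frac{p_r^2+p_z^2}{2}+V(r,z),\qquad V(r,z)=\frac{\varpi^2}{2r^2}-\frac1r-\frac{4\alpha^{-1}}{(r^2+(1+2\alpha)z^2)^{1/2}},$$ and put $\beta=(1+4\alpha^{-1})^{-1}$, $\epsilon=(1-2\varpi^2\beta^2)^{1/2}$; this is a bijection between the pairs $\alpha,\varpi>0$ with $2\varpi^2\beta^2\le 1$ and the pairs $(\beta,\epsilon)\in(0,1)\times[0,1)$. Let $\mathcal D=\{(\beta,\epsilon):\beta,\epsilon>0,\ \beta^2+\epsilon^2<1\}$, the parameters for which $H^{-1}(-1)$ is a regular sphere-like hypersurface. The Euler orbit $\zeta_e$ is the periodic orbit in $H^{-1}(-1)\cap\{z=0\}$, with its least period $T$. For $\epsilon>0$, the linearized flow along $\zeta_e$ on the tangent spaces of $H^{-1}(-1)$ modulo the Hamiltonian vector field is expressed in the frame $$X_1=\partial_zV\,\partial_{p_r}-\partial_rV\,\partial_{p_z}+p_z\partial_r-p_r\partial_z,\qquad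 X_2=-p_z\partial_{p_r}+p_r\partial_{p_z}+\partial_zV\,\partial_r-\partial_rV\,\partial_z$$ as a path $\Psi(t)$ of $2\times2$ matrices with $\Psi(0)=I$, and the rotation number is $\rho_e=T\lim_{t\to\infty}\eta(t)/(2\pi t)$, where $\eta$ is a continuous argument of $\Psi(t)v$, $v\ne0$. For $\epsilon=0$, where $\zeta_e$ is a rest point of the reduced system (circular motion of the equal masses), $T=2\pi r^2/\varpi$ is the time of one revolution, $\Psi$ is the linearized flow on the plane spanned by $\partial_{p_z},\partial_z$, and $\rho_e$ is $1$ plus the rotation number of $\Psi$. The orbit $\zeta_e$ is called hyperbolic if the eigenvalues of $\Psi(T)$ are real numbers $\lambda,\lambda^{-1}$ with $|\lambda|\neq1$; positive hyperbolic if moreover $\lambda>0$, negative hyperbolic if $\lambda<0$. **Theorem 2.9.** The rotation number $\rho_e$ is well defined for every $(\beta,\epsilon)\in(0,1)\times[0,1)$, and the following statements hold. (i) For each integer $k\ge1$, the set $\{(\beta,\epsilon)\in(0,1)\times[0,1):\rho_e=k\text{ and }\zeta_e\text{ is hyperbolic}\}$ is empty. The Euler orbit is never positive hyperbolic, for any $(\beta,\epsilon)\in(0,1)\times[0,1)$.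 (ii) For each integer $k\ge2$, the set $\mathcal D_{k+1/2}=\{(\beta,\epsilon)\in(0,1)\times[0,1):\rho_e=k+\tfrac12\text{ and }\zeta_e\text{ is hyperbolic}\}$ contains a non-empty open subset of the plane, and $\zeta_e$ is negative hyperbolic at each of its points. Moreover, both $\mathcal D_{5/2}\cap\mathcal D$ and $\mathcal D_{7/2}\cap\mathcal D$ contain non-empty open subsets. (iii) The set of $(\beta,\epsilon)\in\mathcal D$ with $\rho_e\in\mathbb Q$ is dense in $\mathcal D$ and contains a non-empty open set. Moreover, the set of $(\beta,\epsilon)\in\mathcal D$ for which $\rho_e=p/q$ with $p>0$ odd and $q>0$ even is dense in $\mathcal D$ and contains a non-empty open set. -/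

import Mathlib

open Filter Topology

namespace Isosceles

/-! ### The Hamiltonian -/

/-- Phase space, with coordinates `(p_r, p_z, r, z)`; the physical region is `r > 0`. The symplectic
form is `dp_r ∧ dr + dp_z ∧ dz`. -/
abbrev Phase := Fin 4 → ℝ

/-- The potential of the reduced spatial isosceles three-body problem, with angular momentum `w` and
mass ratio `a`. -/
noncomputable def V (w a r z : ℝ) : ℝ :=
  w ^ 2 / (2 * r ^ 2) - 1 / r - 4 * a⁻¹ / √(r ^ 2 + (1 + 2 * a) * z ^ 2)

/-- The Hamiltonian `(p_r² + p_z²) / 2 + V(r, z)`. -/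
noncomputable def H (w a : ℝ) (x : Phase) : ℝ :=
  (x 0 ^ 2 + x 1 ^ 2) / 2 + V w a (x 2) (x 3)

/-- The partial derivative `∂V/∂r` (see `hasDerivAt_V_r`). -/
noncomputable def Vr (w a r z : ℝ) : ℝ :=
  -(w ^ 2 / r ^ 3) + 1 / r ^ 2 + 4 * a⁻¹ * r / √(r ^ 2 + (1 + 2 * a) * z ^ 2) ^ 3

/-- The partial derivative `∂V/∂z` (see `hasDerivAt_V_z`). -/
noncomputable def Vz (a r z : ℝ) : ℝ :=
  4 * a⁻¹ * (1 + 2 * a) * z / √(r ^ 2 + (1 + 2 * a) * z ^ 2) ^ 3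

theorem hasDerivAt_V_r {w a r z : ℝ} (ha : 0 < a) (hr : 0 < r) :
    HasDerivAt (fun s => V w a s z) (Vr w a r z) r := by
  have hpos : 0 < r ^ 2 + (1 + 2 * a) * z ^ 2 := by positivity
  have hs : 0 < √(r ^ 2 + (1 + 2 * a) * z ^ 2) := Real.sqrt_pos.2 hpos
  have h2 : HasDerivAt (fun s : ℝ => s ^ 2) (2 * r) r := by simpa using hasDerivAt_pow 2 r
  have h3 := (h2.add_const ((1 + 2 * a) * z ^ 2)).sqrt hpos.ne'
  have h4 := (hasDerivAt_const r (w ^ 2)).div (h2.const_mul 2) (by positivity)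
  have h5 := (hasDerivAt_const r (1 : ℝ)).div (hasDerivAt_id r) hr.ne'
  have h6 := (hasDerivAt_const r (4 * a⁻¹)).div h3 hs.ne'
  refine ((h4.sub h5).sub h6).congr_deriv ?_
  simp only [Vr, id]
  field_simp
  ring

theorem hasDerivAt_V_z {w a r z : ℝ} (ha : 0 < a) (hr : 0 < r) :
    HasDerivAt (fun s => V w a r s) (Vz a r z) z := by
  have hpos : 0 < r ^ 2 + (1 + 2 * a) * z ^ 2 := by positivity
  have hs : 0 < √(r ^ 2 + (1 + 2 * a) * z ^ 2) := Real.sqrt_pos.2 hpos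
  have h2 : HasDerivAt (fun s : ℝ => s ^ 2) (2 * z) z := by simpa using hasDerivAt_pow 2 z
  have h3 := ((h2.const_mul (1 + 2 * a)).const_add (r ^ 2)).sqrt hpos.ne'
  have h6 := (hasDerivAt_const z (4 * a⁻¹)).div h3 hs.ne'
  refine (h6.const_sub (w ^ 2 / (2 * r ^ 2) - 1 / r)).congr_deriv ?_
  simp only [Vz]
  field_simp
  ring

/-- The Hamiltonian vector field `X_H = -∂_r V ∂_{p_r} - ∂_z V ∂_{p_z} + p_r ∂_r + p_z ∂_z`. -/
noncomputable def XH (w a : ℝ) (x : Phase) : Phase :=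
  ![-Vr w a (x 2) (x 3), -Vz a (x 2) (x 3), x 0, x 1]

/-- First vector of the global frame of the tangent bundle of the energy surface modulo `X_H`:
`∂_z V ∂_{p_r} - ∂_r V ∂_{p_z} + p_z ∂_r - p_r ∂_z`. -/
noncomputable def X₁ (w a : ℝ) (x : Phase) : Phase :=
  ![Vz a (x 2) (x 3), -Vr w a (x 2) (x 3), x 1, -x 0]

/-- Second vector of that frame: `-p_z ∂_{p_r} + p_r ∂_{p_z} + ∂_z V ∂_r - ∂_r V ∂_z`. -/
noncomputable def X₂ (w a : ℝ) (x : Phase) : Phase :=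
  ![-x 1, x 0, Vz a (x 2) (x 3), -Vr w a (x 2) (x 3)]

/-! ### Linearized flow, rotation number, hyperbolicity -/

/-- `Ψ` is the path of `2 × 2` matrices, starting at the identity, that represents the linearized
Hamiltonian flow along the trajectory `γ`, modulo the flow direction `X_H`, in the moving frame
`(E₁, E₂)`. The linearized flow is given by the solutions `ξ` of the variational equation. -/
def IsLinearizedPath (w a : ℝ) (γ E₁ E₂ : ℝ → Phase) (Ψ : ℝ → Matrix (Fin 2) (Fin 2) ℝ) : Prop :=
  Ψ 0 = 1 ∧ ∀ v : Fin 2 → ℝ, ∃ (ξ : ℝ → Phase) (c : ℝ → ℝ),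
    (∀ t, HasDerivAt ξ (fderiv ℝ (XH w a) (γ t) (ξ t)) t) ∧
    ∀ t, ξ t = (Ψ t).mulVec v 0 • E₁ t + (Ψ t).mulVec v 1 • E₂ t + c t • XH w a (γ t)

/-- The matrix path `Ψ` with period `T` has rotation number `ρ = T lim η(t) / (2 π t)`, where `η` is
any continuous argument of `Ψ(t) v`, `v ≠ 0`. -/
def HasRotationNumber (Ψ : ℝ → Matrix (Fin 2) (Fin 2) ℝ) (T ρ : ℝ) : Prop :=
  ∀ v : Fin 2 → ℝ, v ≠ 0 → ∃ η : ℝ → ℝ, Continuous η ∧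
    (∀ t, ∃ R : ℝ, 0 < R ∧ (Ψ t).mulVec v = ![R * Real.cos (η t), R * Real.sin (η t)]) ∧
    Tendsto (fun t => T * (η t / (2 * Real.pi * t))) atTop (𝓝 ρ)

/-- The eigenvalues of `M`, with multiplicity, are the real numbers `l` and `l⁻¹`. -/
def HasEigenvaluePair (M : Matrix (Fin 2) (Fin 2) ℝ) (l : ℝ) : Prop :=
  l ≠ 0 ∧ M.charpoly = (Polynomial.X - Polynomial.C l) * (Polynomial.X - Polynomial.C l⁻¹)

def IsHyperbolic (M : Matrix (Fin 2) (Fin 2) ℝ) : Prop :=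
  ∃ l : ℝ, |l| ≠ 1 ∧ HasEigenvaluePair M l

def IsPositiveHyperbolic (M : Matrix (Fin 2) (Fin 2) ℝ) : Prop :=
  ∃ l : ℝ, 0 < l ∧ |l| ≠ 1 ∧ HasEigenvaluePair M l

def IsNegativeHyperbolic (M : Matrix (Fin 2) (Fin 2) ℝ) : Prop :=
  ∃ l : ℝ, l < 0 ∧ |l| ≠ 1 ∧ HasEigenvaluePair M l

/-! ### Parameters -/

/-- The mass ratio `a` with `β = (1 + 4 / a)⁻¹`. -/
noncomputable def massRatio (β : ℝ) : ℝ := 4 * β / (1 - β)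

/-- The angular momentum `w` with `e = (1 - 2 w² β²) ^ (1/2)`. -/
noncomputable def angMom (β e : ℝ) : ℝ := √((1 - e ^ 2) / 2) / β

/-- On `(0,1) × [0,1)`, `(massRatio β, angMom β e)` is the only pair of positive parameters `(a, w)`
with `β = (1 + 4 / a)⁻¹` and `e = √(1 - 2 w² β²)` (a square root of a nonnegative number). -/
theorem param_iff {β e a w : ℝ} (hβ : β ∈ Set.Ioo (0 : ℝ) 1) (he : e ∈ Set.Ico (0 : ℝ) 1) :
    (a = massRatio β ∧ w = angMom β e) ↔
      (0 < a ∧ 0 < w ∧ β = (1 + 4 * a⁻¹)⁻¹ ∧ 2 * w ^ 2 * β ^ 2 ≤ 1 ∧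
        e = √(1 - 2 * w ^ 2 * β ^ 2)) := by
  obtain ⟨hβ0, hβ1⟩ := hβ
  obtain ⟨he0, he1⟩ := he
  have hb : 0 < 1 - β := by linarith
  have hq : 0 < (1 - e ^ 2) / 2 := by nlinarith
  constructor
  · rintro ⟨rfl, rfl⟩
    have key : 2 * angMom β e ^ 2 * β ^ 2 = 1 - e ^ 2 := by
      unfold angMom
      rw [div_pow, Real.sq_sqrt hq.le]
      field_simp
    refine ⟨by unfold massRatio; positivity,
      div_pos (Real.sqrt_pos.2 hq) hβ0, ?_, ?_, ?_⟩
    · unfold massRatio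
      field_simp
      ring
    · rw [key]; nlinarith
    · rw [key, sub_sub_cancel, Real.sqrt_sq he0]
  · rintro ⟨ha, hw, h1, h2, h3⟩
    constructor
    · have h4 : β * (a + 4) = a := by
        rw [h1]; field_simp
      unfold massRatio
      rw [eq_div_iff hb.ne']
      linarith
    · have h5 : e ^ 2 = 1 - 2 * w ^ 2 * β ^ 2 := by
        rw [h3, Real.sq_sqrt (by linarith)]
      unfold angMom
      have h6 : (1 - e ^ 2) / 2 = (w * β) ^ 2 := by rw [h5]; ring
      rw [h6, Real.sqrt_sq (by positivity)]
      field_simp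

/-- The parameters `(β, e)` for which the energy surface `H = -1` is a regular sphere. -/
def 𝒟 : Set (ℝ × ℝ) := {x | 0 < x.1 ∧ 0 < x.2 ∧ x.1 ^ 2 + x.2 ^ 2 < 1}

/-! ### The Euler orbit -/

/-- `γ` is a parametrization by time of the Euler orbit: a solution of Hamilton's equations on the
energy surface `H = -1` that projects into `{z = 0}`. -/
structure IsEulerOrbit (w a : ℝ) (γ : ℝ → Phase) : Prop where
  solution : ∀ t, HasDerivAt γ (XH w a (γ t)) t
  r_pos : ∀ t, 0 < γ t 2
  energy : ∀ t, H w a (γ t) = -1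
  planar : ∀ t, γ t 3 = 0

/-- `T` is the least positive period of `γ`. -/
def IsLeastPeriod (γ : ℝ → Phase) (T : ℝ) : Prop :=
  IsLeast {S : ℝ | 0 < S ∧ Function.Periodic γ S} T

/-- `Ψ` is the transverse linearized flow of the Euler orbit `ζ_e` with parameters `(β, e)`, and `T`
is the period. The number `m` is to be added to the rotation number of `Ψ` to obtain that of `ζ_e`.

* If `e > 0`, then `ζ_e` is a nonconstant periodic orbit, `T` is its least period, and the global
  frame `(X₁, X₂)` is used, so `m = 0`.
* If `e = 0`, then `ζ_e` degenerates to a rest point of the reduced system (the two equal masses are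
  in circular motion), where `X₁`, `X₂` and `X_H` vanish. Then `T = 2 π r² / w` is the time of one
  revolution of the circular motion (the limit of the periods as `e → 0`), the linearized flow is
  taken on the plane spanned by `∂_{p_z}`, `∂_z`, and the contribution `m = 1` of the
  `(p_r, r)`-plane is added. -/
def IsEulerTransverseFlow (β e T : ℝ) (Ψ : ℝ → Matrix (Fin 2) (Fin 2) ℝ) (m : ℝ) : Prop :=
  ∃ γ : ℝ → Phase, IsEulerOrbit (angMom β e) (massRatio β) γ ∧
    ((0 < e ∧ IsLeastPeriod γ T ∧ m = 0 ∧
        IsLinearizedPath (angMom β e) (massRatio β) γ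
          (fun t => X₁ (angMom β e) (massRatio β) (γ t))
          (fun t => X₂ (angMom β e) (massRatio β) (γ t)) Ψ) ∨
      (e = 0 ∧ T = 2 * Real.pi * γ 0 2 ^ 2 / angMom β e ∧ m = 1 ∧
        IsLinearizedPath (angMom β e) (massRatio β) γ
          (fun _ => ![0, 1, 0, 0]) (fun _ => ![0, 0, 0, 1]) Ψ))

/-- The Euler orbit with parameters `(β, e)` has rotation number `ρ`. -/
def HasEulerRotationNumber (β e ρ : ℝ) : Prop :=
  ∃ T Ψ m, IsEulerTransverseFlow β e T Ψ m ∧ HasRotationNumber Ψ T (ρ - m)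

/-- The transverse linearized first return map of the Euler orbit is hyperbolic. -/
def EulerHyperbolic (β e : ℝ) : Prop :=
  ∃ T Ψ m, IsEulerTransverseFlow β e T Ψ m ∧ IsHyperbolic (Ψ T)

def EulerPositiveHyperbolic (β e : ℝ) : Prop :=
  ∃ T Ψ m, IsEulerTransverseFlow β e T Ψ m ∧ IsPositiveHyperbolic (Ψ T)

def EulerNegativeHyperbolic (β e : ℝ) : Prop :=
  ∃ T Ψ m, IsEulerTransverseFlow β e T Ψ m ∧ IsNegativeHyperbolic (Ψ T)

/-! ### The sets of parameters -/

/-- The full range `(0,1) × [0,1)` of the parameters `(β, e)`. -/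
def params : Set (ℝ × ℝ) := Set.Ioo 0 1 ×ˢ Set.Ico 0 1

/-- The parameters for which the Euler orbit is hyperbolic with rotation number `s`. -/
def hyperbolicSet (s : ℝ) : Set (ℝ × ℝ) :=
  {x ∈ params | HasEulerRotationNumber x.1 x.2 s ∧ EulerHyperbolic x.1 x.2}

/-- The parameters in `𝒟` for which the rotation number is rational. -/
def rationalSet : Set (ℝ × ℝ) :=
  {x ∈ 𝒟 | ∃ s : ℚ, HasEulerRotationNumber x.1 x.2 s}

/-- The parameters in `𝒟` for which the rotation number is `p / q`, `p` odd and `q` even. -/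
def oddEvenSet : Set (ℝ × ℝ) :=
  {x ∈ 𝒟 | ∃ p q : ℕ, 0 < p ∧ 0 < q ∧ Odd p ∧ Even q ∧
    HasEulerRotationNumber x.1 x.2 ((p : ℝ) / (q : ℝ))}

/-- `S` contains a non-empty open subset of the plane. -/
def ContainsNonemptyOpen (S : Set (ℝ × ℝ)) : Prop :=
  ∃ U : Set (ℝ × ℝ), IsOpen U ∧ U.Nonempty ∧ U ⊆ S

end Isosceles

namespace Isosceles

open Real Set
open scoped NNReal

/-! ### Scalar equations and the Prüfer equation -/

/-! The Euler orbit is a Kepler orbit in the plane `z = 0`. With the true anomaly `θ` as independent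
variable and `z = r u`, the transverse variational equation becomes Hill's equation `u'' + (1 + b /
(1 + e cos θ)) u = 0` with `b = 7β` (`IsAdmissible.hasDerivAt_trans`). The trace of the linearized
return map is that of the monodromy matrix `Potential.mono`. The frame `(X₁, X₂)` turns by `-θ` up
to a bounded error, so `ρ_e = 1 + rot / 2`, where `rot` counts the half turns of `(u', u)` per
period (`hasEulerRotationNumber_iff`). At `e = 0` the fixed frame and the added `m = 1` lead to the
same formula.

For Hill's equation, let `ret` be the map of angles over one period. It is monotone, commutes with
`x ↦ x + π`, and increases strictly with `b`. A matrix with real eigenvectors has `ret x = x + πj`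
for some `x` and some integer `j`, and then `rot = j` and the trace has the sign `(-1)^j`. The
matrix is hyperbolic as soon as `ret x - x - πj` takes both signs (`Potential.four_lt_trace_sq`).

The special feature of this potential is that multiplication by `1 + e cos θ` gives a three-term
recurrence for the Fourier coefficients of solutions. For integer frequencies the factors `1 - n²`
at `n = ±1` vanish and separate positive from negative frequencies, so one `2π`-periodic solution
forces all solutions to be periodic (`hill_mono_eq_one`). For half-integer frequencies nothing
vanishes, and for `e ≠ 0` a discrete Wronskian excludes two independent antiperiodic solutions
(`hill_mono_ne_neg_one`).

Now increase `b` from `0`, where `ret x = x + 2π`, until `ret x - x` first touches `πj`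
(`exists_first_touch`). At the touch the monodromy matrix has the eigenvalue `(-1)^j`. For even `j`
it is therefore the identity, `ret x - x` is constant, and strict monotonicity leaves no other
parameter at which `πj` is attained. This excludes positive hyperbolicity and integer rotation
numbers (`hill_mono_eq_one_of_even`). For odd `j` and `e ≠ 0` the displacement is not constant at
the touch, so slightly later it takes both signs, which is an open condition
(`exists_displacement_both_signs`). That every odd `j ≥ 3` is reached follows from blow-up of the
displacement as `e → 1` (`log_le_hill_ret_sub`). That `3` and `5` are reached inside `𝒟` follows
from an explicit estimate (`five_lt_hill_rot`).

For the density, vary `b` with `e` fixed. If `rot` is constant on an interval, its value is an odd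
integer (`exists_odd_of_rot_eq`), because elliptic and identity matrices have strictly increasing
rotation. Otherwise `rot` takes all the rational values between two distinct ones. Both cases yield
`ρ_e = odd / even` (`exists_odd_div_even`). -/

theorem exists_solution_of_bounded_lipschitz {f : ℝ → ℝ → ℝ} {C K : ℝ≥0}
    (hC : ∀ t x, |f t x| ≤ C) (hK : ∀ t, LipschitzWith K (f t)) (hf : ∀ x, Continuous (f · x))
    (x₀ : ℝ) : ∃ φ : ℝ → ℝ, φ 0 = x₀ ∧ ∀ t, HasDerivAt φ (f t (φ t)) t := by
  -- Since `f` is bounded by `C` everywhere, Picard–Lindelöf holds on the whole interval of radius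
  -- `n + 1`, in the ball of radius `C (n + 1)`. The local solutions agree by uniqueness and are
  -- glued with the index `⌈|t|⌉₊`.
  have loc : ∀ n : ℕ, ∃ α : ℝ → ℝ, α 0 = x₀ ∧
      ∀ t ∈ Ioo (-(n + 1 : ℝ)) (n + 1), HasDerivAt α (f t (α t)) t := by
    intro n
    have h0 : (0 : ℝ) ∈ Icc (-(n + 1 : ℝ)) (n + 1) := by constructor <;> linarith [(Nat.cast_nonneg n : (0 : ℝ) ≤ n)]
    have hpl : IsPicardLindelof f (⟨0, h0⟩ : Icc (-(n + 1 : ℝ)) (n + 1)) x₀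
        (C * (n + 1 : ℝ≥0)) 0 C K := by
      refine ⟨fun t _ => (hK t).lipschitzOnWith, fun x _ => (hf x).continuousOn,
        fun t _ x _ => by simpa using hC t x, ?_⟩
      simp
    obtain ⟨α, h1, h2⟩ := hpl.exists_eq_forall_mem_Icc_hasDerivWithinAt₀
    exact ⟨α, h1, fun t ht => (h2 t (Ioo_subset_Icc_self ht)).hasDerivAt (Icc_mem_nhds ht.1 ht.2)⟩
  choose α hα0 hα using loc
  have agree : ∀ m n : ℕ, m ≤ n → ∀ t ∈ Ioo (-(m + 1 : ℝ)) (m + 1), α m t = α n t := by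
    intro m n hmn t ht
    have hmn' : (m : ℝ) ≤ n := by exact_mod_cast hmn
    refine ODE_solution_unique_of_mem_Ioo (v := f) (s := fun _ => univ) (K := K) (t₀ := 0)
      (a := -(m + 1 : ℝ)) (b := m + 1) (fun t _ => (hK t).lipschitzOnWith)
      ⟨by linarith [(Nat.cast_nonneg m : (0 : ℝ) ≤ m)], by positivity⟩
      (fun s hs => ⟨hα m s hs, mem_univ _⟩)
      (fun s hs => ⟨hα n s ⟨by linarith [hs.1], by linarith [hs.2]⟩, mem_univ _⟩)
      (by rw [hα0, hα0]) ht
  have key : ∀ (N : ℕ) (t : ℝ), |t| < N + 1 → α ⌈|t|⌉₊ t = α N t := by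
    intro N t ht
    have h2 : |t| < ⌈|t|⌉₊ + 1 := lt_of_le_of_lt (Nat.le_ceil _) (by linarith)
    rcases le_total ⌈|t|⌉₊ N with h | h
    · exact agree _ _ h t (abs_lt.1 h2)
    · exact (agree _ _ h t (abs_lt.1 ht)).symm
  refine ⟨fun t => α ⌈|t|⌉₊ t, by simp [hα0], fun t => ?_⟩
  obtain ⟨N, hN⟩ := exists_nat_gt |t|
  have hN' : |t| < N + 1 := by linarith
  have hev : (fun t => α ⌈|t|⌉₊ t) =ᶠ[𝓝 t] α N := by
    filter_upwards [continuous_abs.continuousAt.eventually_lt_const hN'] with s hs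
    exact key N s hs
  change HasDerivAt _ (f t (α ⌈|t|⌉₊ t)) t
  rw [show α ⌈|t|⌉₊ t = α N t from key N t hN']
  exact (hα N t (abs_lt.1 hN')).congr_of_eventuallyEq hev

/-- `φ` is a Prüfer angle of `u'' + q u = 0`: a continuous argument of `(u', u)`. -/
def IsPrufer (q φ : ℝ → ℝ) : Prop :=
  ∀ θ, HasDerivAt φ (cos (φ θ) ^ 2 + q θ * sin (φ θ) ^ 2) θ

theorem exists_isPrufer {q : ℝ → ℝ} (hq : Continuous q) {C : ℝ} (hC : ∀ θ, |q θ| ≤ C) (x₀ : ℝ) :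
    ∃ φ, φ 0 = x₀ ∧ IsPrufer q φ := by
  have hC0 : 0 ≤ C := (abs_nonneg _).trans (hC 0)
  have hd : ∀ t x, HasDerivAt (fun x => cos x ^ 2 + q t * sin x ^ 2)
      (2 * (q t - 1) * sin x * cos x) x := by
    intro t x
    have h1 := ((hasDerivAt_cos x).pow 2).add (((hasDerivAt_sin x).pow 2).const_mul (q t))
    refine h1.congr_deriv ?_
    push_cast; ring
  refine exists_solution_of_bounded_lipschitz (f := fun t x => cos x ^ 2 + q t * sin x ^ 2)
    (C := (1 + C).toNNReal) (K := (2 * (C + 1)).toNNReal) ?_ ?_ ?_ x₀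
  · intro t x
    have h1 := hC t
    rw [abs_le] at h1
    have h2 := sin_sq_add_cos_sq x
    rw [Real.coe_toNNReal _ (by positivity), abs_le]
    constructor <;> nlinarith [sq_nonneg (sin x), sq_nonneg (cos x)]
  · intro t
    refine lipschitzWith_of_nnnorm_deriv_le (fun x => (hd t x).differentiableAt) fun x => ?_
    rw [← NNReal.coe_le_coe, coe_nnnorm, (hd t x).deriv, norm_eq_abs]
    rw [Real.coe_toNNReal _ (by positivity)]
    have h1 : |q t - 1| ≤ C + 1 := (abs_sub _ _).trans (by simpa using hC t)
    have h2 : |sin x| ≤ 1 := abs_sin_le_one x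
    have h3 : |cos x| ≤ 1 := abs_cos_le_one x
    rw [abs_mul, abs_mul, abs_mul, abs_two]
    have h4 : |sin x| * |cos x| ≤ 1 := by nlinarith [abs_nonneg (sin x), abs_nonneg (cos x)]
    nlinarith [abs_nonneg (q t - 1), mul_nonneg (abs_nonneg (sin x)) (abs_nonneg (cos x))]
  · intro x
    fun_prop

theorem IsPrufer.continuous {q φ : ℝ → ℝ} (h : IsPrufer q φ) : Continuous φ :=
  continuous_iff_continuousAt.2 fun θ => (h θ).continuousAt

theorem sin_eq_mul_sinc (x : ℝ) : sin x = x * sinc x := by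
  rcases eq_or_ne x 0 with rfl | h
  · simp
  · rw [sinc_of_ne_zero h]; field_simp

/-- The growth coefficient of the difference of two Prüfer angles. -/
noncomputable def pruferGrowth (q₁ φ₀ φ₁ : ℝ → ℝ) (θ : ℝ) : ℝ :=
  (q₁ θ - 1) * sin (φ₁ θ + φ₀ θ) * sinc (φ₁ θ - φ₀ θ)

/-- By `sin² x - sin² y = sin (x + y) sin (x - y)`, the difference of two Prüfer angles satisfies a
linear scalar equation whose source term is `q₁ - q₀`. Writing `sin (x - y)` through `sinc` keeps
the coefficient continuous where the angles coincide. -/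
theorem IsPrufer.hasDerivAt_sub {q₀ q₁ φ₀ φ₁ : ℝ → ℝ} (h₀ : IsPrufer q₀ φ₀) (h₁ : IsPrufer q₁ φ₁)
    (θ : ℝ) : HasDerivAt (fun θ => φ₁ θ - φ₀ θ)
      (pruferGrowth q₁ φ₀ φ₁ θ * (φ₁ θ - φ₀ θ) + (q₁ θ - q₀ θ) * sin (φ₀ θ) ^ 2) θ := by
  refine ((h₁ θ).sub (h₀ θ)).congr_deriv ?_
  have e1 : pruferGrowth q₁ φ₀ φ₁ θ * (φ₁ θ - φ₀ θ)
      = (q₁ θ - 1) * (sin (φ₁ θ + φ₀ θ) * sin (φ₁ θ - φ₀ θ)) := by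
    rw [sin_eq_mul_sinc (φ₁ θ - φ₀ θ), pruferGrowth]; ring
  rw [e1, sin_add, sin_sub]
  have h2 := sin_sq_add_cos_sq (φ₁ θ)
  have h3 := sin_sq_add_cos_sq (φ₀ θ)
  have c1 : cos (φ₁ θ) ^ 2 = 1 - sin (φ₁ θ) ^ 2 := by linarith
  have c0 : cos (φ₀ θ) ^ 2 = 1 - sin (φ₀ θ) ^ 2 := by linarith
  have : (sin (φ₁ θ) * cos (φ₀ θ) + cos (φ₁ θ) * sin (φ₀ θ)) *
      (sin (φ₁ θ) * cos (φ₀ θ) - cos (φ₁ θ) * sin (φ₀ θ)) = sin (φ₁ θ) ^ 2 - sin (φ₀ θ) ^ 2 := by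
    ring_nf; rw [c1, c0]; ring
  rw [this, c1, c0]; ring

theorem continuous_pruferGrowth {q₁ φ₀ φ₁ : ℝ → ℝ} (hq : Continuous q₁) (h₀ : Continuous φ₀)
    (h₁ : Continuous φ₁) : Continuous (pruferGrowth q₁ φ₀ φ₁) := by
  unfold pruferGrowth
  have := continuous_sinc
  fun_prop

/-- The difference of two Prüfer angles, multiplied by an integrating factor. -/
noncomputable def pruferGap (q₁ φ₀ φ₁ : ℝ → ℝ) (θ : ℝ) : ℝ :=
  (φ₁ θ - φ₀ θ) * exp (-∫ t in (0 : ℝ)..θ, pruferGrowth q₁ φ₀ φ₁ t)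

/-- The integrating factor removes the growth term, so the derivative has the sign of `q₁ - q₀`. All
the Sturm comparisons below rest on this. -/
theorem IsPrufer.hasDerivAt_gap {q₀ q₁ φ₀ φ₁ : ℝ → ℝ} (hq : Continuous q₁) (h₀ : IsPrufer q₀ φ₀)
    (h₁ : IsPrufer q₁ φ₁) (θ : ℝ) : HasDerivAt (pruferGap q₁ φ₀ φ₁)
      ((q₁ θ - q₀ θ) * sin (φ₀ θ) ^ 2 * exp (-∫ t in (0 : ℝ)..θ, pruferGrowth q₁ φ₀ φ₁ t)) θ := by
  have hc := continuous_pruferGrowth hq h₀.continuous h₁.continuous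
  have hi : HasDerivAt (fun θ => ∫ t in (0 : ℝ)..θ, pruferGrowth q₁ φ₀ φ₁ t)
      (pruferGrowth q₁ φ₀ φ₁ θ) θ := hc.integral_hasStrictDerivAt 0 θ |>.hasDerivAt
  refine ((h₀.hasDerivAt_sub h₁ θ).mul hi.fun_neg.exp).congr_deriv ?_
  ring

theorem IsPrufer.monotone_gap {q₀ q₁ φ₀ φ₁ : ℝ → ℝ} (hq : Continuous q₁) (h₀ : IsPrufer q₀ φ₀)
    (h₁ : IsPrufer q₁ φ₁) (hle : ∀ θ, q₀ θ ≤ q₁ θ) : Monotone (pruferGap q₁ φ₀ φ₁) := by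
  refine monotone_of_deriv_nonneg (fun θ => (h₀.hasDerivAt_gap hq h₁ θ).differentiableAt)
    fun θ => ?_
  rw [(h₀.hasDerivAt_gap hq h₁ θ).deriv]
  have := sub_nonneg.2 (hle θ)
  positivity

theorem pruferGap_nonneg_iff {q₁ φ₀ φ₁ : ℝ → ℝ} {θ : ℝ} :
    0 ≤ pruferGap q₁ φ₀ φ₁ θ ↔ φ₀ θ ≤ φ₁ θ := by
  unfold pruferGap
  rw [mul_nonneg_iff_of_pos_right (exp_pos _), sub_nonneg]

theorem pruferGap_pos_iff {q₁ φ₀ φ₁ : ℝ → ℝ} {θ : ℝ} :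
    0 < pruferGap q₁ φ₀ φ₁ θ ↔ φ₀ θ < φ₁ θ := by
  unfold pruferGap
  rw [mul_pos_iff_of_pos_right (exp_pos _), sub_pos]

theorem IsPrufer.lt_of_lt {q₀ q₁ φ₀ φ₁ : ℝ → ℝ} (hq : Continuous q₁) (h₀ : IsPrufer q₀ φ₀)
    (h₁ : IsPrufer q₁ φ₁) (hle : ∀ θ, q₀ θ ≤ q₁ θ) {a b : ℝ} (hab : a ≤ b) (ha : φ₀ a < φ₁ a) :
    φ₀ b < φ₁ b :=
  pruferGap_pos_iff.1
    ((pruferGap_pos_iff.2 ha).trans_le (h₀.monotone_gap hq h₁ hle hab))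

theorem IsPrufer.eq_of_eq {q φ₀ φ₁ : ℝ → ℝ} (hq : Continuous q) (h₀ : IsPrufer q φ₀)
    (h₁ : IsPrufer q φ₁) {a : ℝ} (ha : φ₀ a = φ₁ a) : φ₀ = φ₁ := by
  have hd : ∀ x y, pruferGap q φ₀ φ₁ x = pruferGap q φ₀ φ₁ y := by
    refine is_const_of_deriv_eq_zero
      (fun θ => (h₀.hasDerivAt_gap hq h₁ θ).differentiableAt) fun θ => ?_
    rw [(h₀.hasDerivAt_gap hq h₁ θ).deriv]; simp
  funext x
  have := hd x a
  unfold pruferGap at this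
  rw [ha, sub_self, zero_mul, mul_eq_zero, or_iff_left (exp_pos _).ne'] at this
  linarith

/-- If the gap has not become positive at `b`, it vanishes on all of `(a, b)`. Then `sin φ₀ = 0`
there, although `φ₀' = 1` wherever `sin φ₀ = 0`. -/
theorem IsPrufer.lt_of_potential_lt {q₀ q₁ φ₀ φ₁ : ℝ → ℝ} (hq : Continuous q₁)
    (h₀ : IsPrufer q₀ φ₀) (h₁ : IsPrufer q₁ φ₁) (hlt : ∀ θ, q₀ θ < q₁ θ) {a b : ℝ} (hab : a < b)
    (ha : φ₀ a ≤ φ₁ a) : φ₀ b < φ₁ b := by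
  have hm := h₀.monotone_gap hq h₁ fun θ => (hlt θ).le
  have h1 : 0 ≤ pruferGap q₁ φ₀ φ₁ a := pruferGap_nonneg_iff.2 ha
  by_contra hcon
  have h2 : pruferGap q₁ φ₀ φ₁ b ≤ 0 := not_lt.1 (mt pruferGap_pos_iff.1 hcon)
  have hz : ∀ θ ∈ Ioo a b, sin (φ₀ θ) = 0 := by
    intro θ hθ
    have hev : pruferGap q₁ φ₀ φ₁ =ᶠ[𝓝 θ] fun _ => 0 := by
      filter_upwards [Ioo_mem_nhds hθ.1 hθ.2] with s hs
      exact le_antisymm ((hm hs.2.le).trans h2) (h1.trans (hm hs.1.le))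
    have h3 := (h₀.hasDerivAt_gap hq h₁ θ).unique
      ((hasDerivAt_const θ (0 : ℝ)).congr_of_eventuallyEq hev)
    have h4 := hlt θ
    rw [mul_eq_zero, or_iff_left (exp_pos _).ne', mul_eq_zero, or_iff_right (by linarith)] at h3
    simpa using h3
  have hθ : (a + b) / 2 ∈ Ioo a b := ⟨by linarith, by linarith⟩
  have hev : (fun θ => sin (φ₀ θ)) =ᶠ[𝓝 ((a + b) / 2)] fun _ => 0 := by
    filter_upwards [Ioo_mem_nhds hθ.1 hθ.2] with s hs using hz s hs
  have h3 := ((h₀ ((a + b) / 2)).sin).unique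
    ((hasDerivAt_const _ (0 : ℝ)).congr_of_eventuallyEq hev)
  have h4 := hz _ hθ
  have h5 := sin_sq_add_cos_sq (φ₀ ((a + b) / 2))
  rw [h4] at h3 h5
  have h6 : cos (φ₀ ((a + b) / 2)) ^ 2 = 1 := by linarith
  rw [h6] at h3
  simp at h3
  rw [h3] at h6; norm_num at h6

/-- Continuous dependence of the Prüfer angle on the initial value and on the potential. -/
theorem IsPrufer.abs_sub_le {q₀ q₁ φ₀ φ₁ : ℝ → ℝ} (h₀ : IsPrufer q₀ φ₀) (h₁ : IsPrufer q₁ φ₁)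
    {C ε : ℝ} (hC : ∀ θ, |q₁ θ| ≤ C) (hε : ∀ θ, |q₁ θ - q₀ θ| ≤ ε) {θ : ℝ} (hθ : 0 ≤ θ) :
    |φ₁ θ - φ₀ θ| ≤ gronwallBound |φ₁ 0 - φ₀ 0| (C + 1) ε θ := by
  have hd : ∀ θ, HasDerivAt (fun θ => φ₁ θ - φ₀ θ) _ θ := fun θ => h₀.hasDerivAt_sub h₁ θ
  have := norm_le_gronwallBound_of_norm_deriv_right_le (f := fun θ => φ₁ θ - φ₀ θ)
    (a := 0) (b := θ) (δ := |φ₁ 0 - φ₀ 0|) (K := C + 1) (ε := ε)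
    (fun t _ => (hd t).continuousAt.continuousWithinAt)
    (fun t _ => (hd t).hasDerivWithinAt) le_rfl ?_ θ ⟨hθ, le_rfl⟩
  · simpa using this
  · intro t _
    rw [norm_eq_abs, norm_eq_abs]
    refine (abs_add_le _ _).trans (add_le_add ?_ ?_)
    · rw [abs_mul]
      refine mul_le_mul_of_nonneg_right ?_ (abs_nonneg _)
      rw [pruferGrowth, abs_mul, abs_mul]
      have h1 : |q₁ t - 1| ≤ C + 1 := (abs_sub _ _).trans (by simpa using hC t)
      have h2 := abs_sin_le_one (φ₁ t + φ₀ t)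
      have h3 : |sinc (φ₁ t - φ₀ t)| ≤ 1 := abs_le.2 ⟨neg_one_le_sinc _, sinc_le_one _⟩
      have hC1 : 0 ≤ C + 1 := (abs_nonneg _).trans h1
      calc _ ≤ (C + 1) * 1 * 1 :=
            mul_le_mul (mul_le_mul h1 h2 (abs_nonneg _) hC1) h3 (abs_nonneg _) (by simpa)
        _ = C + 1 := by ring
    · rw [abs_mul]
      have h1 : |sin (φ₀ t) ^ 2| ≤ 1 := by
        rw [abs_of_nonneg (sq_nonneg _)]; exact sin_sq_le_one _
      calc _ ≤ ε * 1 := by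
            gcongr
            · exact (abs_nonneg _).trans (hε t)
            · exact hε t
        _ = ε := mul_one _

theorem IsPrufer.add_pi {q φ : ℝ → ℝ} (h : IsPrufer q φ) : IsPrufer q (fun θ => φ θ + π) := by
  intro θ
  simpa using (h θ).add_const π

theorem IsPrufer.shift {q φ : ℝ → ℝ} (h : IsPrufer q φ) {S : ℝ} (hq : Function.Periodic q S) :
    IsPrufer q (fun θ => φ (θ + S)) := by
  intro θ
  have := (h (θ + S)).comp_add_const θ S
  rwa [hq θ] at this

/-! ### Hill's equation -/

/-- A continuous potential of period `2π`. -/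
structure Potential where
  q : ℝ → ℝ
  continuous : Continuous q
  periodic : Function.Periodic q (2 * π)

/-- `(u, v)` solves `u' = v`, `v' = -q u`. -/
def IsHillSol (q u v : ℝ → ℝ) : Prop :=
  (∀ θ, HasDerivAt u (v θ) θ) ∧ ∀ θ, HasDerivAt v (-(q θ * u θ)) θ

theorem IsHillSol.wronskian {q u₁ v₁ u₂ v₂ : ℝ → ℝ} (h₁ : IsHillSol q u₁ v₁)
    (h₂ : IsHillSol q u₂ v₂) (a b : ℝ) :
    u₁ a * v₂ a - v₁ a * u₂ a = u₁ b * v₂ b - v₁ b * u₂ b := by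
  have hd : ∀ θ, HasDerivAt (fun θ => u₁ θ * v₂ θ - v₁ θ * u₂ θ) 0 θ := by
    intro θ
    refine (((h₁.1 θ).mul (h₂.2 θ)).sub ((h₁.2 θ).mul (h₂.1 θ))).congr_deriv ?_
    ring
  exact is_const_of_deriv_eq_zero (fun θ => (hd θ).differentiableAt) (fun θ => (hd θ).deriv) a b

theorem IsHillSol.shift {q u v : ℝ → ℝ} (h : IsHillSol q u v) {S : ℝ}
    (hq : Function.Periodic q S) : IsHillSol q (fun θ => u (θ + S)) (fun θ => v (θ + S)) := by
  refine ⟨fun θ => (h.1 (θ + S)).comp_add_const θ S, fun θ => ?_⟩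
  have := (h.2 (θ + S)).comp_add_const θ S
  rwa [hq θ] at this

/-! ### Displacement of Prüfer angles over one period and its rotation number. -/

namespace Potential

variable (Q : Potential)

theorem exists_bound : ∃ C, ∀ θ, |Q.q θ| ≤ C := by
  obtain ⟨C, hC⟩ := isCompact_Icc.exists_bound_of_continuousOn (s := Icc 0 (2 * π))
    Q.continuous.continuousOn
  refine ⟨C, fun θ => ?_⟩
  obtain ⟨y, hy, h⟩ := Q.periodic.exists_mem_Ico₀ two_pi_pos θ
  rw [h]
  exact hC y (Ico_subset_Icc_self hy)

/-- The Prüfer angle with value `x` at `0`. -/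
noncomputable def angle (x : ℝ) : ℝ → ℝ :=
  (exists_isPrufer Q.continuous Q.exists_bound.choose_spec x).choose

@[simp] theorem angle_zero (x : ℝ) : Q.angle x 0 = x :=
  (exists_isPrufer Q.continuous Q.exists_bound.choose_spec x).choose_spec.1

theorem isPrufer_angle (x : ℝ) : IsPrufer Q.q (Q.angle x) :=
  (exists_isPrufer Q.continuous Q.exists_bound.choose_spec x).choose_spec.2

theorem _root_.Isosceles.IsPrufer.eq_angle {Q : Potential} {φ : ℝ → ℝ} (h : IsPrufer Q.q φ) :
    φ = Q.angle (φ 0) :=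
  h.eq_of_eq Q.continuous (Q.isPrufer_angle _) (a := 0) (by simp)

theorem angle_add_pi (x : ℝ) : Q.angle (x + π) = fun θ => Q.angle x θ + π := by
  have := (Q.isPrufer_angle x).add_pi.eq_angle
  simp only [angle_zero] at this
  exact this.symm

/-- The displacement of angles over one period. -/
noncomputable def ret (x : ℝ) : ℝ := Q.angle x (2 * π)

theorem angle_add_period (x θ : ℝ) : Q.angle x (θ + 2 * π) = Q.angle (Q.ret x) θ := by
  have := ((Q.isPrufer_angle x).shift Q.periodic).eq_angle
  simp only [zero_add] at this
  exact congrFun this θ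

theorem ret_add_pi (x : ℝ) : Q.ret (x + π) = Q.ret x + π := by
  simp [ret, angle_add_pi]

theorem ret_strictMono : StrictMono Q.ret := fun x y hxy =>
  (Q.isPrufer_angle x).lt_of_lt Q.continuous (Q.isPrufer_angle y) (fun _ => le_rfl) two_pi_pos.le
    (by simpa using hxy)

theorem ret_add_int_mul_pi (x : ℝ) (n : ℤ) : Q.ret (x + n * π) = Q.ret x + n * π := by
  have h : Function.Periodic (fun x => Q.ret x - x) π := fun x => by
    simp only [ret_add_pi]; ring
  have : Q.ret (x + n * π) - (x + n * π) = Q.ret x - x := h.int_mul n x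
  linarith

theorem ret_continuous : Continuous Q.ret := by
  obtain ⟨C, hC⟩ := Q.exists_bound
  refine continuous_iff_continuousAt.2 fun x => ?_
  have key : ∀ y, |Q.ret y - Q.ret x| ≤ |y - x| * exp ((C + 1) * (2 * π)) := by
    intro y
    have := (Q.isPrufer_angle x).abs_sub_le (Q.isPrufer_angle y) hC (ε := 0) (by simp)
      two_pi_pos.le
    simpa [gronwallBound_ε0, ret] using this
  refine tendsto_iff_dist_tendsto_zero.2 (squeeze_zero (fun _ => dist_nonneg) key ?_)
  have : Continuous fun y => |y - x| * exp ((C + 1) * (2 * π)) := by fun_prop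
  simpa using this.tendsto x

/-- The displacement of angles over one period, in units of `π`, as a lift of a circle map. -/
noncomputable def lift : CircleDeg1Lift where
  toFun x := Q.ret (π * x) / π
  monotone' x y hxy := by
    have := Q.ret_strictMono.monotone (mul_le_mul_of_nonneg_left hxy pi_pos.le)
    exact div_le_div_of_nonneg_right this pi_pos.le
  map_add_one' x := by
    have h : π * (x + 1) = π * x + π := by ring
    simp only [h, ret_add_pi]
    field_simp

theorem lift_apply (x : ℝ) : Q.lift x = Q.ret (π * x) / π := rfl

theorem ret_eq_lift (x : ℝ) : Q.ret x = π * Q.lift (x / π) := by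
  have := pi_ne_zero
  rw [lift_apply, mul_div_cancel₀ _ this, mul_div_cancel₀ _ this]

theorem lift_continuous : Continuous Q.lift := by
  have := Q.ret_continuous
  exact (this.comp (continuous_const.mul continuous_id)).div_const π

theorem ret_iterate (n : ℕ) (x : ℝ) : Q.ret^[n] x = π * (Q.lift ^ n) (x / π) := by
  induction n generalizing x with
  | zero => simp [mul_div_cancel₀ _ pi_ne_zero]
  | succ n ih =>
    rw [Function.iterate_succ_apply, ih, Q.ret_eq_lift, pow_succ, CircleDeg1Lift.mul_apply,
      mul_div_cancel_left₀ _ pi_ne_zero]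

theorem angle_nat_mul_period (x : ℝ) (n : ℕ) (θ : ℝ) :
    Q.angle x (θ + n * (2 * π)) = Q.angle (Q.ret^[n] x) θ := by
  induction n generalizing x with
  | zero => simp
  | succ n ih =>
    rw [Function.iterate_succ_apply, ← ih, ← Q.angle_add_period]
    congr 1; push_cast; ring

/-- The number of half turns per period. -/
noncomputable def rot : ℝ := Q.lift.translationNumber

theorem ret_eq_iff {x : ℝ} {j : ℝ} : Q.ret x = x + π * j ↔ Q.lift (x / π) = x / π + j := by
  rw [ret_eq_lift, ← mul_right_inj' pi_ne_zero (b := Q.lift _), mul_add,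
    mul_div_cancel₀ _ pi_ne_zero]

theorem lt_ret_iff {x : ℝ} {j : ℝ} : x + π * j < Q.ret x ↔ x / π + j < Q.lift (x / π) := by
  rw [ret_eq_lift, ← mul_lt_mul_iff_right₀ pi_pos (c := Q.lift _), mul_add,
    mul_div_cancel₀ _ pi_ne_zero]

theorem rot_eq_of_ret_eq {x : ℝ} {j : ℤ} (h : Q.ret x = x + π * j) : Q.rot = j :=
  Q.lift.translationNumber_of_eq_add_int (Q.ret_eq_iff.1 h)

theorem lt_ret_of_lt_rot {j : ℤ} (h : j < Q.rot) (x : ℝ) : x + π * j < Q.ret x :=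
  Q.lt_ret_iff.2 (Q.lift.lt_map_of_int_lt_translationNumber h _)

/-- Iterates of a lift of degree one stay within bounded distance of `n` times the translation
number, and the angle is Lipschitz in `θ`. So `rot / 2` is the mean angular speed with a bounded
error. -/
theorem abs_angle_sub_le (x : ℝ) : ∃ B, ∀ θ, 0 ≤ θ → |Q.angle x θ - Q.rot / 2 * θ| ≤ B := by
  obtain ⟨C, hC⟩ := Q.exists_bound
  have hC0 : 0 ≤ C := (abs_nonneg _).trans (hC 0)
  have hL : ∀ y θ, 0 ≤ θ → |Q.angle y θ - y| ≤ (1 + C) * θ := by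
    intro y θ hθ
    have := Convex.norm_image_sub_le_of_norm_hasDerivWithin_le (f := Q.angle y) (C := 1 + C)
      (s := Icc 0 θ) (fun t _ => ((Q.isPrufer_angle y) t).hasDerivWithinAt) ?_ (convex_Icc 0 θ)
      (left_mem_Icc.2 hθ) (right_mem_Icc.2 hθ)
    · simpa [abs_of_nonneg hθ] using this
    · intro t _
      have h1 := hC t
      rw [abs_le] at h1
      have h2 := sin_sq_add_cos_sq (Q.angle y t)
      rw [norm_eq_abs, abs_le]
      constructor <;> nlinarith [sq_nonneg (sin (Q.angle y t)), sq_nonneg (cos (Q.angle y t))]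
  -- The three summands bound the motion during the incomplete period, the error of the iterates of
  -- `ret`, and the replacement of `θ` by a whole number of periods.
  refine ⟨(1 + C) * (2 * π) + π * (1 + (|x| / π + 1)) + |Q.rot / 2| * (2 * π), fun θ hθ => ?_⟩
  set n := ⌊θ / (2 * π)⌋₊ with hn
  set s := θ - n * (2 * π) with hs
  have h1 : n * (2 * π) ≤ θ := by
    rw [← le_div_iff₀ two_pi_pos]; exact Nat.floor_le (by positivity)
  have h2 : θ < (n + 1) * (2 * π) := by
    rw [← div_lt_iff₀ two_pi_pos]; exact Nat.lt_floor_add_one _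
  have hs0 : 0 ≤ s := by linarith
  have hs1 : s ≤ 2 * π := by linarith
  have h3 : Q.angle x θ = Q.angle (Q.ret^[n] x) s := by
    rw [← angle_nat_mul_period]; congr 1; rw [hs]; ring
  have h4 := hL (Q.ret^[n] x) s hs0
  rw [← h3] at h4
  have h5 : |Q.ret^[n] x - π * (n * Q.rot)| ≤ π * (1 + (|x| / π + 1)) := by
    rw [ret_iterate, ← mul_sub, abs_mul, abs_of_pos pi_pos]
    gcongr
    have h6 := Q.lift.dist_pow_map_zero_mul_translationNumber_le n
    rw [dist_eq] at h6
    have h7 : |(Q.lift ^ n) (x / π) - (Q.lift ^ n) 0| ≤ |x| / π + 1 := by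
      have a1 := (Q.lift ^ n).map_le_of_map_zero (x / π)
      have a2 := (Q.lift ^ n).le_map_of_map_zero (x / π)
      have a3 := Int.ceil_lt_add_one (x / π)
      have a4 := Int.lt_floor_add_one (x / π)
      have a5 := le_abs_self (x / π)
      have a6 := neg_abs_le (x / π)
      have a7 : |x / π| = |x| / π := by rw [abs_div, abs_of_pos pi_pos]
      rw [a7] at a5 a6
      rw [abs_le]; constructor <;> linarith
    rw [← rot] at h6
    calc |(Q.lift ^ n) (x / π) - n * Q.rot|
        ≤ |(Q.lift ^ n) (x / π) - (Q.lift ^ n) 0| + |(Q.lift ^ n) 0 - n * Q.rot| :=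
          abs_sub_le _ _ _
      _ ≤ _ := by linarith
  have h8 : |Q.rot / 2 * s| ≤ |Q.rot / 2| * (2 * π) := by
    rw [abs_mul, abs_of_nonneg hs0]; gcongr
  have h9 : Q.angle x θ - Q.rot / 2 * θ = (Q.angle x θ - Q.ret^[n] x) +
      (Q.ret^[n] x - π * (n * Q.rot)) - Q.rot / 2 * s := by rw [hs]; ring
  rw [h9]
  have h10 : (1 + C) * s ≤ (1 + C) * (2 * π) := by gcongr
  exact (abs_sub _ _).trans (add_le_add ((abs_add_le _ _).trans
    (add_le_add (h4.trans h10) h5)) h8)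

end Potential

/-! ### Moduli of solutions and the monodromy matrix. -/

namespace Potential

variable (Q : Potential)

/-- The modulus of the solution `(u', u)` with angle `Q.angle x` and modulus `1` at `0`. -/
noncomputable def amp (x θ : ℝ) : ℝ :=
  exp (∫ t in (0 : ℝ)..θ, (1 - Q.q t) * sin (Q.angle x t) * cos (Q.angle x t))

theorem amp_pos (x θ : ℝ) : 0 < Q.amp x θ := exp_pos _

@[simp] theorem amp_zero (x : ℝ) : Q.amp x 0 = 1 := by simp [amp]

theorem hasDerivAt_amp (x θ : ℝ) : HasDerivAt (Q.amp x)
    (Q.amp x θ * ((1 - Q.q θ) * sin (Q.angle x θ) * cos (Q.angle x θ))) θ := by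
  have h1 := (Q.isPrufer_angle x).continuous
  have h2 := Q.continuous
  have hc : Continuous fun t => (1 - Q.q t) * sin (Q.angle x t) * cos (Q.angle x t) := by fun_prop
  exact (hc.integral_hasStrictDerivAt 0 θ).hasDerivAt.exp

theorem isHillSol (x : ℝ) : IsHillSol Q.q (fun θ => Q.amp x θ * sin (Q.angle x θ))
    (fun θ => Q.amp x θ * cos (Q.angle x θ)) := by
  constructor <;> intro θ
  · refine ((Q.hasDerivAt_amp x θ).mul (Q.isPrufer_angle x θ).sin).congr_deriv ?_
    have h := cos_sq' (Q.angle x θ)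
    linear_combination (Q.amp x θ * cos (Q.angle x θ)) * h
  · refine ((Q.hasDerivAt_amp x θ).mul (Q.isPrufer_angle x θ).cos).congr_deriv ?_
    have h := sin_sq (Q.angle x θ)
    linear_combination (- Q.amp x θ * Q.q θ * sin (Q.angle x θ)) * h

/-- The monodromy matrix, acting on `(u', u)`. -/
noncomputable def mono : Matrix (Fin 2) (Fin 2) ℝ :=
  !![Q.amp 0 (2 * π) * cos (Q.ret 0), Q.amp (π / 2) (2 * π) * cos (Q.ret (π / 2));
     Q.amp 0 (2 * π) * sin (Q.ret 0), Q.amp (π / 2) (2 * π) * sin (Q.ret (π / 2))]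

theorem det_mono : Q.mono.det = 1 := by
  have := (Q.isHillSol (π / 2)).wronskian (Q.isHillSol 0) 0 (2 * π)
  simp only [angle_zero, amp_zero] at this
  simp at this
  rw [mono, Matrix.det_fin_two_of]
  unfold ret
  linarith

/-- The monodromy matrix maps the values `(u', u)` at `0` to those at `2π`. -/
theorem mono_mulVec {u v : ℝ → ℝ} (h : IsHillSol Q.q u v) :
    Q.mono.mulVec ![v 0, u 0] = ![v (2 * π), u (2 * π)] := by
  have h1 := h.wronskian (Q.isHillSol 0) 0 (2 * π)
  have h2 := h.wronskian (Q.isHillSol (π / 2)) 0 (2 * π)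
  have h3 := Q.det_mono
  rw [mono, Matrix.det_fin_two_of] at h3
  simp only [angle_zero, amp_zero] at h1 h2
  simp at h1 h2
  rw [mono]
  unfold ret at *
  ext i
  fin_cases i
  · simp
    linear_combination (Q.amp (π / 2) (2 * π) * cos (Q.angle (π / 2) (2 * π))) * h1
      - (Q.amp 0 (2 * π) * cos (Q.angle 0 (2 * π))) * h2 + v (2 * π) * h3
  · simp
    linear_combination (Q.amp (π / 2) (2 * π) * sin (Q.angle (π / 2) (2 * π))) * h1
      - (Q.amp 0 (2 * π) * sin (Q.angle 0 (2 * π))) * h2 + u (2 * π) * h3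

theorem mono_mulVec_angle (x : ℝ) : Q.mono.mulVec ![cos x, sin x] =
    ![Q.amp x (2 * π) * cos (Q.ret x), Q.amp x (2 * π) * sin (Q.ret x)] := by
  have := Q.mono_mulVec (Q.isHillSol x)
  simpa [ret] using this

theorem exists_isHillSol (p u₀ : ℝ) : ∃ u v, IsHillSol Q.q u v ∧ u 0 = u₀ ∧ v 0 = p := by
  have h1 := Q.isHillSol 0
  have h2 := Q.isHillSol (π / 2)
  refine ⟨_, _, ⟨fun θ => ((h1.1 θ).const_mul p).add ((h2.1 θ).const_mul u₀), fun θ =>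
    (((h1.2 θ).const_mul p).add ((h2.2 θ).const_mul u₀)).congr_deriv ?_⟩, ?_, ?_⟩
  · simp; ring
  · simp
  · simp

theorem _root_.Isosceles.IsHillSol.eq_zero {Q : Potential} {u v : ℝ → ℝ} (h : IsHillSol Q.q u v)
    (hu : u 0 = 0) (hv : v 0 = 0) : u = 0 ∧ v = 0 := by
  have key : ∀ θ, u θ = 0 ∧ v θ = 0 := by
    intro θ
    have h1 := h.wronskian (Q.isHillSol 0) 0 θ
    have h2 := h.wronskian (Q.isHillSol (π / 2)) 0 θ
    have h3 := (Q.isHillSol (π / 2)).wronskian (Q.isHillSol 0) 0 θ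
    simp only [angle_zero, amp_zero, hu, hv] at h1 h2 h3
    simp at h1 h2 h3
    constructor
    · linear_combination (-u θ) * (-h3) - (Q.amp 0 θ * sin (Q.angle 0 θ)) * h2 * (-1) +
        (Q.amp (π / 2) θ * sin (Q.angle (π / 2) θ)) * h1 * (-1)
    · linear_combination (-v θ) * (-h3) - (Q.amp 0 θ * cos (Q.angle 0 θ)) * h2 * (-1) +
        (Q.amp (π / 2) θ * cos (Q.angle (π / 2) θ)) * h1 * (-1)
  exact ⟨funext fun θ => (key θ).1, funext fun θ => (key θ).2⟩

/-! ### Displacement of angles and trace of the monodromy matrix -/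

/-- The area spanned by a vector and its image under the monodromy matrix. -/
theorem amp_mul_sin_ret_sub (x : ℝ) : Q.amp x (2 * π) * sin (Q.ret x - x) =
    Q.mono 1 0 * cos x ^ 2 + (Q.mono 1 1 - Q.mono 0 0) * (cos x * sin x)
      - Q.mono 0 1 * sin x ^ 2 := by
  have h := Q.mono_mulVec_angle x
  have h0 := congrFun h 0
  have h1 := congrFun h 1
  simp [Matrix.mulVec, dotProduct, Fin.sum_univ_two] at h0 h1
  rw [sin_sub]
  linear_combination (-cos x) * h1 + sin x * h0

/-- The area of `amp_mul_sin_ret_sub` is a quadratic form in `(cos x, sin x)`. Its discriminant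
links the sign changes of the displacement, modulo `π`, to the trace. -/
theorem discrim_mono : discrim (-Q.mono 0 1) (Q.mono 1 1 - Q.mono 0 0) (Q.mono 1 0) =
    Q.mono.trace ^ 2 - 4 := by
  have h := Q.det_mono
  rw [Matrix.det_fin_two] at h
  rw [discrim, Matrix.trace_fin_two]
  linear_combination (-4) * h

/-- Putting `x = arctan t` turns the form into a quadratic polynomial in `t`, to which the criteria
for real roots and for constant sign apply. -/
theorem area_arctan (t : ℝ) :
    Q.amp (arctan t) (2 * π) * sin (Q.ret (arctan t) - arctan t) * (1 + t ^ 2) =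
    -Q.mono 0 1 * (t * t) + (Q.mono 1 1 - Q.mono 0 0) * t + Q.mono 1 0 := by
  have h : (0 : ℝ) < 1 + t ^ 2 := by positivity
  have hs : √(1 + t ^ 2) ^ 2 = 1 + t ^ 2 := sq_sqrt h.le
  have hs0 : √(1 + t ^ 2) ≠ 0 := (sqrt_pos.2 h).ne'
  rw [amp_mul_sin_ret_sub, cos_arctan, sin_arctan]
  field_simp
  rw [hs]
  field_simp
  ring

/-- The vector `(cos x, sin x)` is an eigenvector with eigenvalue `(-1)^j` times its amplification,
and determinant `1` makes the other eigenvalue the inverse. -/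
theorem trace_of_ret_eq {x : ℝ} {j : ℤ} (h : Q.ret x = x + π * j) :
    Q.mono.trace = (-1) ^ j * (Q.amp x (2 * π) + (Q.amp x (2 * π))⁻¹) := by
  have hA := Q.mono_mulVec_angle x
  have h0 := congrFun hA 0
  have h1 := congrFun hA 1
  have hd := Q.det_mono
  have hp := Q.amp_pos x (2 * π)
  have hsq : ((-1 : ℝ) ^ j) * (-1) ^ j = 1 := by
    rw [← mul_zpow]; simp
  rw [h, mul_comm π, cos_add_int_mul_pi] at h0
  rw [h, mul_comm π, sin_add_int_mul_pi] at h1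
  simp [Matrix.mulVec, dotProduct, Fin.sum_univ_two] at h0 h1
  rw [Matrix.det_fin_two] at hd
  rw [Matrix.trace_fin_two]
  set r := Q.amp x (2 * π)
  set e := (-1 : ℝ) ^ j
  set a := Q.mono 0 0
  set b := Q.mono 0 1
  set c := Q.mono 1 0
  set d := Q.mono 1 1
  have hc := cos_sq_add_sin_sq x
  -- The eigenvalue `r e` is a root of the characteristic polynomial. Each coordinate gives this
  -- times `cos x` or `sin x`, and `cos² + sin² = 1` removes the factors.
  have key : (r * e) ^ 2 - (a + d) * (r * e) + 1 = 0 := by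
    have k1 : ((r * e) ^ 2 - (a + d) * (r * e) + 1) * cos x = 0 := by
      linear_combination (d - r * e) * h0 - b * h1 - cos x * hd
    have k2 : ((r * e) ^ 2 - (a + d) * (r * e) + 1) * sin x = 0 := by
      linear_combination (a - r * e) * h1 - c * h0 - sin x * hd
    linear_combination cos x * k1 + sin x * k2 - ((r * e) ^ 2 - (a + d) * (r * e) + 1) * hc
  field_simp
  have hre : r * e * e = r := by rw [mul_assoc, hsq, mul_one]
  linear_combination (-e) * key + (r ^ 2 * e - (a + d) * r) * hsq

/-- A monotone map commuting with `x ↦ x + π` traps every point between consecutive translates of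
`x₀`. Hence the sine of `ret x - x - πj` determines its sign. -/
theorem abs_ret_sub_lt {x₀ : ℝ} {j : ℤ} (h : Q.ret x₀ = x₀ + π * j) (x : ℝ) :
    |Q.ret x - x - π * j| < π := by
  set n := ⌊(x - x₀) / π⌋
  set y := x - x₀ - n * π with hy
  have h1 : n * π ≤ x - x₀ := by rw [← le_div_iff₀ pi_pos]; exact Int.floor_le _
  have h2 : x - x₀ < (n + 1) * π := by rw [← div_lt_iff₀ pi_pos]; exact Int.lt_floor_add_one _
  have h3 : Q.ret x = Q.ret (x₀ + y) + n * π := by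
    rw [← ret_add_int_mul_pi]; congr 1; rw [hy]; ring
  have h4 : Q.ret x₀ ≤ Q.ret (x₀ + y) := Q.ret_strictMono.monotone (by linarith)
  have h5 : Q.ret (x₀ + y) < Q.ret (x₀ + π) := Q.ret_strictMono (by linarith)
  rw [ret_add_pi] at h5
  rw [h3, abs_lt]
  constructor <;> linarith

/-- Up to the factor `(-1)^j`, the area form has the sign of `ret x - x - πj`. A form that takes
both signs has positive discriminant, which is `trace² - 4`. -/
theorem four_lt_trace_sq {x y : ℝ} {j : ℤ} (hx : Q.ret x < x + π * j) (hy : y + π * j < Q.ret y) :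
    4 < Q.mono.trace ^ 2 := by
  have hcont : Continuous fun x => Q.ret x - x - π * j :=
    (Q.ret_continuous.sub continuous_id).sub continuous_const
  obtain ⟨x₀, hx₀⟩ := mem_range_of_exists_le_of_exists_ge hcont (c := 0) ⟨x, by simp; linarith⟩
    ⟨y, by simp; linarith⟩
  have hb := Q.abs_ret_sub_lt (x₀ := x₀) (j := j) (by simp at hx₀; linarith)
  have area : ∀ z, Q.amp z (2 * π) * sin (Q.ret z - z) =
      (-1) ^ j * (Q.amp z (2 * π) * sin (Q.ret z - z - π * j)) := by
    intro z
    have : Q.ret z - z = (Q.ret z - z - π * j) + j * π := by ring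
    conv_lhs => rw [this, sin_add_int_mul_pi]
    ring
  have sx : sin (Q.ret x - x - π * j) < 0 :=
    sin_neg_of_neg_of_neg_pi_lt (by linarith) (by linarith [(abs_lt.1 (hb x)).1])
  have sy : 0 < sin (Q.ret y - y - π * j) :=
    sin_pos_of_pos_of_lt_pi (by linarith) (by linarith [(abs_lt.1 (hb y)).2])
  have ax := Q.amp_mul_sin_ret_sub x
  have ay := Q.amp_mul_sin_ret_sub y
  have hneg : (Q.amp x (2 * π) * sin (Q.ret x - x)) * (Q.amp y (2 * π) * sin (Q.ret y - y)) < 0 := by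
    rw [area, area y]
    have hsq : ((-1 : ℝ) ^ j) * (-1) ^ j = 1 := by rw [← mul_zpow]; simp
    have := mul_neg_of_neg_of_pos (mul_neg_of_pos_of_neg (Q.amp_pos x (2 * π)) sx)
      (mul_pos (Q.amp_pos y (2 * π)) sy)
    calc _ = ((-1 : ℝ) ^ j * (-1) ^ j) * ((Q.amp x (2 * π) * sin (Q.ret x - x - π * j)) *
          (Q.amp y (2 * π) * sin (Q.ret y - y - π * j))) := by ring
      _ < 0 := by rwa [hsq, one_mul]
  rw [ax, ay] at hneg
  by_contra hcon
  have hD := Q.discrim_mono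
  rw [discrim] at hD
  set A := Q.mono 1 0
  set B := Q.mono 1 1 - Q.mono 0 0
  set C := -Q.mono 0 1 with hC
  -- Completing the square: with a nonpositive discriminant, `4A` times the form would be
  -- nonnegative everywhere.
  have e1 : ∀ z, 4 * A * (A * cos z ^ 2 + B * (cos z * sin z) - Q.mono 0 1 * sin z ^ 2) =
      (2 * A * cos z + B * sin z) ^ 2 - (B ^ 2 - 4 * C * A) * sin z ^ 2 := by
    intro z; rw [hC]; ring
  have hD0 : B ^ 2 - 4 * C * A ≤ 0 := by linarith
  have n1 : ∀ z, 0 ≤ 4 * A * (A * cos z ^ 2 + B * (cos z * sin z) - Q.mono 0 1 * sin z ^ 2) := by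
    intro z
    rw [e1]; nlinarith [sq_nonneg (2 * A * cos z + B * sin z), sq_nonneg (sin z)]
  rcases eq_or_ne A 0 with hA | hA
  · have hB : B = 0 := by rw [hA] at hD0; nlinarith
    rw [hA, hB] at hneg
    nlinarith [mul_nonneg (mul_nonneg (sq_nonneg (sin x)) (sq_nonneg (sin y)))
      (sq_nonneg (Q.mono 0 1))]
  · have := mul_nonneg (n1 x) (n1 y)
    have h2 : 0 < A ^ 2 := by positivity
    nlinarith

/-- A nonnegative discriminant gives the area form a real zero, that is, a real eigenvector. If the
leading coefficient vanishes, the zero is at `x = π / 2`. -/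
theorem exists_ret_eq (h : 4 ≤ Q.mono.trace ^ 2) : ∃ (x : ℝ) (j : ℤ), Q.ret x = x + π * j := by
  suffices ∃ x, sin (Q.ret x - x) = 0 by
    obtain ⟨x, hx⟩ := this
    obtain ⟨j, hj⟩ := sin_eq_zero_iff.1 hx
    exact ⟨x, j, by linarith⟩
  have hz : ∀ x, Q.amp x (2 * π) * sin (Q.ret x - x) = 0 → sin (Q.ret x - x) = 0 := fun x hx =>
    (mul_eq_zero.1 hx).resolve_left (Q.amp_pos _ _).ne'
  rcases eq_or_ne (-Q.mono 0 1) 0 with hC | hC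
  · refine ⟨π / 2, hz _ ?_⟩
    rw [amp_mul_sin_ret_sub]
    simpa using hC
  · have hD := Q.discrim_mono
    obtain ⟨t, ht⟩ := exists_quadratic_eq_zero hC
      (b := Q.mono 1 1 - Q.mono 0 0) (c := Q.mono 1 0)
      ⟨√(Q.mono.trace ^ 2 - 4), by rw [hD, mul_self_sqrt (by linarith)]⟩
    have := Q.area_arctan t
    rw [ht, mul_eq_zero, or_iff_left (by positivity)] at this
    exact ⟨arctan t, hz _ this⟩

/-- Here the area form, multiplied by `(-1)^j`, is nonpositive, so its discriminant is nonpositive.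
-/
theorem trace_sq_le_four {x₀ : ℝ} {j : ℤ} (h₀ : Q.ret x₀ = x₀ + π * j)
    (h : ∀ x, Q.ret x ≤ x + π * j) : Q.mono.trace ^ 2 ≤ 4 := by
  have hb := Q.abs_ret_sub_lt h₀
  have area : ∀ z, (-1 : ℝ) ^ j * (Q.amp z (2 * π) * sin (Q.ret z - z)) ≤ 0 := by
    intro z
    have hsq : ((-1 : ℝ) ^ j) * (-1) ^ j = 1 := by rw [← mul_zpow]; simp
    have e1 : Q.ret z - z = (Q.ret z - z - π * j) + j * π := by ring
    have e2 : sin (Q.ret z - z) = (-1) ^ j * sin (Q.ret z - z - π * j) := by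
      conv_lhs => rw [e1, sin_add_int_mul_pi]
    have s1 : sin (Q.ret z - z - π * j) ≤ 0 :=
      sin_nonpos_of_nonpos_of_neg_pi_le (by linarith [h z]) (abs_lt.1 (hb z)).1.le
    rw [e2]
    have := mul_nonpos_of_nonneg_of_nonpos (Q.amp_pos z (2 * π)).le s1
    calc _ = ((-1 : ℝ) ^ j * (-1) ^ j) * (Q.amp z (2 * π) * sin (Q.ret z - z - π * j)) := by ring
      _ ≤ 0 := by rwa [hsq, one_mul]
  have hD := Q.discrim_mono
  have hneg1 : (-1 : ℝ) ^ j = 1 ∨ (-1 : ℝ) ^ j = -1 := by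
    rcases Int.even_or_odd j with hj | hj
    · exact Or.inl hj.neg_one_zpow
    · exact Or.inr hj.neg_one_zpow
  have hpoly : ∀ t, (-1 : ℝ) ^ j *
      (-Q.mono 0 1 * (t * t) + (Q.mono 1 1 - Q.mono 0 0) * t + Q.mono 1 0) ≤ 0 := by
    intro t
    rw [← area_arctan, ← mul_assoc]
    exact mul_nonpos_of_nonpos_of_nonneg (area _) (by positivity)
  rcases hneg1 with hj | hj
  · have := discrim_le_zero (K := ℝ) (a := -(-Q.mono 0 1)) (b := -(Q.mono 1 1 - Q.mono 0 0))
      (c := -Q.mono 1 0) (fun t => by have := hpoly t; rw [hj] at this; linarith)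
    rw [discrim] at this hD
    linarith
  · have := discrim_le_zero (K := ℝ) (a := -Q.mono 0 1) (b := Q.mono 1 1 - Q.mono 0 0)
      (c := Q.mono 1 0) (fun t => by have := hpoly t; rw [hj] at this; linarith)
    linarith

/-- If the displacement of angles attains its upper bound `πj`, then the monodromy matrix has the
eigenvalue `(-1)^j`. -/
theorem exists_mono_mulVec_eq {x₀ : ℝ} {j : ℤ} (h₀ : Q.ret x₀ = x₀ + π * j)
    (h : ∀ x, Q.ret x ≤ x + π * j) :
    Q.mono.mulVec ![cos x₀, sin x₀] = (-1 : ℝ) ^ j • ![cos x₀, sin x₀] := by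
  have h1 := Q.trace_sq_le_four h₀ h
  rw [Q.trace_of_ret_eq h₀, mul_pow] at h1
  have hsq : ((-1 : ℝ) ^ j) ^ 2 = 1 := by rw [sq, ← mul_zpow]; simp
  rw [hsq, one_mul] at h1
  have hp := Q.amp_pos x₀ (2 * π)
  have h2 : Q.amp x₀ (2 * π) = 1 := by
    set r := Q.amp x₀ (2 * π)
    have h3 : r * r⁻¹ = 1 := mul_inv_cancel₀ hp.ne'
    have h4 : (r - r⁻¹) ^ 2 ≤ 0 := by nlinarith
    have h5 : r = r⁻¹ := by nlinarith [sq_nonneg (r - r⁻¹)]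
    rw [← h5] at h3
    nlinarith
  rw [mono_mulVec_angle, h2, h₀, mul_comm π, cos_add_int_mul_pi, sin_add_int_mul_pi]
  simp

/-- A scalar matrix fixes every line, so each displacement is a multiple of `π`. By `abs_ret_sub_lt`
the multiple is the one at `x₀`. -/
theorem ret_eq_of_mono_eq {x₀ : ℝ} {j : ℤ} (h₀ : Q.ret x₀ = x₀ + π * j) {l : ℝ}
    (h : Q.mono = l • 1) (x : ℝ) : Q.ret x = x + π * j := by
  have h1 := Q.amp_mul_sin_ret_sub x
  rw [h] at h1
  simp at h1
  have h2 := h1.resolve_left (Q.amp_pos _ _).ne'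
  have e1 : Q.ret x - x = (Q.ret x - x - π * j) + j * π := by ring
  rw [e1, sin_add_int_mul_pi] at h2
  have h3 : sin (Q.ret x - x - π * j) = 0 :=
    (mul_eq_zero.1 h2).resolve_left (zpow_ne_zero _ (by norm_num))
  have hb := abs_lt.1 (Q.abs_ret_sub_lt h₀ x)
  have := (sin_eq_zero_iff_of_lt_of_lt hb.1 hb.2).1 h3
  linarith

end Potential

/-! ### Fourier coefficients on `[0, 2π]` -/

/-- The coefficient of `f` of frequency `s`, on the interval `[0, 2π]`. -/
noncomputable def fcoeff (s : ℝ) (f : ℝ → ℂ) : ℂ :=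
  ∫ θ in (0 : ℝ)..2 * π, f θ * Complex.exp (-(Complex.I * s * θ))

theorem hasDerivAt_cexp_mul (c : ℂ) (θ : ℝ) :
    HasDerivAt (fun θ : ℝ => Complex.exp (c * θ)) (Complex.exp (c * θ) * c) θ := by
  have h : HasDerivAt (fun θ : ℝ => c * (θ : ℂ)) c θ := by
    simpa using (Complex.ofRealCLM.hasDerivAt (x := θ)).const_mul c
  exact h.cexp

theorem fcoeff_intervalIntegrable {f : ℝ → ℂ} (hf : Continuous f) (s : ℝ) (a b : ℝ) :
    IntervalIntegrable (fun θ => f θ * Complex.exp (-(Complex.I * s * θ))) MeasureTheory.volume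
      a b :=
  Continuous.intervalIntegrable (by fun_prop) _ _

theorem fcoeff_add {f g : ℝ → ℂ} (hf : Continuous f) (hg : Continuous g) (s : ℝ) :
    fcoeff s (fun θ => f θ + g θ) = fcoeff s f + fcoeff s g := by
  unfold fcoeff
  rw [← intervalIntegral.integral_add (fcoeff_intervalIntegrable hf s _ _)
    (fcoeff_intervalIntegrable hg s _ _)]
  congr 1; ext θ; ring

theorem fcoeff_const_mul (c : ℂ) (f : ℝ → ℂ) (s : ℝ) :
    fcoeff s (fun θ => c * f θ) = c * fcoeff s f := by
  unfold fcoeff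
  rw [← intervalIntegral.integral_const_mul]
  congr 1; ext θ; ring

theorem fcoeff_cos_mul {f : ℝ → ℂ} (hf : Continuous f) (s : ℝ) :
    fcoeff s (fun θ => (cos θ : ℂ) * f θ) = (fcoeff (s - 1) f + fcoeff (s + 1) f) / 2 := by
  unfold fcoeff
  rw [← intervalIntegral.integral_add (fcoeff_intervalIntegrable hf _ _ _)
    (fcoeff_intervalIntegrable hf _ _ _), ← intervalIntegral.integral_div]
  congr 1; ext θ
  have h1 : Complex.exp (-(Complex.I * ((s - 1 : ℝ) : ℂ) * θ)) =
      Complex.exp (-(Complex.I * s * θ)) * Complex.exp (θ * Complex.I) := by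
    rw [← Complex.exp_add]; congr 1; push_cast; ring
  have h2 : Complex.exp (-(Complex.I * ((s + 1 : ℝ) : ℂ) * θ)) =
      Complex.exp (-(Complex.I * s * θ)) * Complex.exp (-θ * Complex.I) := by
    rw [← Complex.exp_add]; congr 1; push_cast; ring
  rw [h1, h2]
  simp only [Complex.ofReal_cos, Complex.cos]
  ring

/-- Integration by parts. The multiplier `exp (2πis)` in the boundary condition cancels the boundary
terms, so the rule serves periodic and antiperiodic functions alike. -/
theorem fcoeff_deriv {f g : ℝ → ℂ} (h : ∀ θ, HasDerivAt f (g θ) θ) (hg : Continuous g) {s : ℝ}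
    (hb : f (2 * π) = Complex.exp (Complex.I * s * (2 * π)) * f 0) :
    fcoeff s g = Complex.I * s * fcoeff s f := by
  have key := intervalIntegral.integral_mul_deriv_eq_deriv_mul (a := 0) (b := 2 * π)
    (u := fun θ : ℝ => Complex.exp (-(Complex.I * s) * θ)) (v := f)
    (fun θ _ => hasDerivAt_cexp_mul (-(Complex.I * s)) θ) (fun θ _ => h θ)
    (Continuous.intervalIntegrable (by fun_prop) _ _) (hg.intervalIntegrable _ _)
  have e : ∀ θ : ℝ, -(Complex.I * s) * θ = -(Complex.I * s * θ) := fun θ => by ring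
  simp only [e] at key
  have hbd : Complex.exp (-(Complex.I * s * ((2 * π : ℝ) : ℂ))) * f (2 * π) = f 0 := by
    rw [hb, ← mul_assoc, ← Complex.exp_add]
    simp
  rw [hbd] at key
  simp at key
  unfold fcoeff
  rw [← intervalIntegral.integral_const_mul]
  rw [show (fun θ : ℝ => g θ * Complex.exp (-(Complex.I * s * θ))) =
    fun θ : ℝ => Complex.exp (-(Complex.I * s * θ)) * g θ from funext fun θ => mul_comm _ _, key]
  congr 1; ext θ; ring

theorem norm_cexp_neg_I_mul (s θ : ℝ) : ‖Complex.exp (-(Complex.I * s * θ))‖ = 1 := by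
  have : -(Complex.I * s * θ) = ((-(s * θ) : ℝ) : ℂ) * Complex.I := by push_cast; ring
  rw [this, Complex.norm_exp_ofReal_mul_I]

theorem exists_fcoeff_bound {f : ℝ → ℂ} (hf : Continuous f) : ∃ C, ∀ s, ‖fcoeff s f‖ ≤ C := by
  obtain ⟨C, hC⟩ := isCompact_Icc.exists_bound_of_continuousOn (s := Icc 0 (2 * π))
    hf.continuousOn
  refine ⟨C * |2 * π - 0|, fun s => intervalIntegral.norm_integral_le_of_norm_le_const
    fun θ hθ => ?_⟩
  rw [uIoc_of_le two_pi_pos.le] at hθ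
  rw [norm_mul, norm_cexp_neg_I_mul, mul_one]
  exact hC θ (Ioc_subset_Icc_self hθ)

/-- Multiplication by `exp (-isθ)` produces a continuous function on the circle. Its Fourier series
is zero, hence summable, hence converges pointwise to the function. -/
theorem eq_zero_of_fcoeff_eq_zero {f : ℝ → ℂ} (hf : Continuous f) {s : ℝ}
    (hb : f (2 * π) = Complex.exp (Complex.I * s * (2 * π)) * f 0)
    (h : ∀ n : ℤ, fcoeff (n + s) f = 0) : ∀ θ ∈ Ico 0 (2 * π), f θ = 0 := by
  have : Fact (0 < 2 * π) := ⟨two_pi_pos⟩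
  set g : ℝ → ℂ := fun θ => f θ * Complex.exp (-(Complex.I * s * θ)) with hg
  have hgc : Continuous g := by fun_prop
  have hg0 : g 0 = g (0 + 2 * π) := by
    simp only [hg, zero_add, hb]
    rw [mul_right_comm (Complex.exp (Complex.I * s * (2 * π))), ← Complex.exp_add]
    simp [mul_assoc]
  have hcont : Continuous (AddCircle.liftIco (2 * π) 0 g) :=
    AddCircle.liftIco_continuous hg0 hgc.continuousOn
  have hco : fourierCoeff (AddCircle.liftIco (2 * π) 0 g) = 0 := by
    funext n
    rw [fourierCoeff_liftIco_eq, fourierCoeffOn_eq_integral]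
    have e : ∀ θ : ℝ, (fourier (-n) (θ : AddCircle (0 + 2 * π - 0)) : ℂ) • g θ =
        f θ * Complex.exp (-(Complex.I * ((n + s : ℝ) : ℂ) * θ)) := by
      intro θ
      rw [fourier_coe_apply, smul_eq_mul, hg, mul_comm, mul_assoc, ← Complex.exp_add]
      congr 2
      have : (π : ℂ) ≠ 0 := by exact_mod_cast pi_ne_zero
      push_cast
      field_simp
      ring
    simp only [e]
    have := h n
    unfold fcoeff at this
    rw [zero_add, this, smul_zero, Pi.zero_apply]
  intro θ hθ
  have hs := has_pointwise_sum_fourier_series_of_summable (T := 2 * π)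
    (f := ⟨_, hcont⟩) (by simp only [ContinuousMap.coe_mk, hco]; exact summable_zero) (θ : AddCircle (2 * π))
  simp only [ContinuousMap.coe_mk, hco] at hs
  simp only [Pi.zero_apply, zero_smul] at hs
  have h0 := hs.unique hasSum_zero
  rw [AddCircle.liftIco_coe_apply (by simpa using hθ)] at h0
  exact (mul_eq_zero.1 h0).resolve_right (Complex.exp_ne_zero _)

theorem fcoeff_cexp (m n : ℤ) : fcoeff m (fun θ => Complex.exp (Complex.I * n * θ)) =
    if n = m then 2 * π else 0 := by
  have e : ∀ θ : ℝ, Complex.exp (Complex.I * n * θ) * Complex.exp (-(Complex.I * ((m : ℝ) : ℂ) * θ))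
      = Complex.exp ((Complex.I * (n - m)) * θ) := by
    intro θ
    rw [← Complex.exp_add]; congr 1; push_cast; ring
  unfold fcoeff
  simp only [e]
  split_ifs with h
  · subst h; simp
  · have hc : Complex.I * (n - m) ≠ 0 :=
      mul_ne_zero Complex.I_ne_zero (sub_ne_zero.2 (by exact_mod_cast h))
    rw [integral_exp_mul_complex hc]
    have : Complex.exp (Complex.I * (n - m) * ((2 * π : ℝ) : ℂ)) = 1 := by
      rw [Complex.exp_eq_one_iff]
      exact ⟨n - m, by push_cast; ring⟩
    rw [this]; simp

theorem fcoeff_tsum {B : ℤ → ℂ} (hB : Summable fun n => ‖B n‖) (m : ℤ) :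
    fcoeff m (fun θ => ∑' n : ℤ, B n * Complex.exp (Complex.I * n * θ)) = 2 * π * B m := by
  have hn : ∀ (n : ℤ) (θ : ℝ), ‖Complex.exp (Complex.I * n * θ)‖ = 1 := by
    intro n θ
    have := norm_cexp_neg_I_mul (-n) θ
    rw [← this]; congr 2; push_cast; ring
  have key : HasSum (fun n : ℤ => fcoeff m (fun θ => B n * Complex.exp (Complex.I * n * θ)))
      (fcoeff m (fun θ => ∑' n : ℤ, B n * Complex.exp (Complex.I * n * θ))) := by
    unfold fcoeff
    refine intervalIntegral.hasSum_integral_of_dominated_convergence (fun n _ => ‖B n‖)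
      (fun n => Continuous.aestronglyMeasurable (by fun_prop)) ?_ ?_ ?_ ?_
    · intro n
      filter_upwards with θ _
      rw [norm_mul, norm_mul, hn, norm_cexp_neg_I_mul]; simp
    · filter_upwards with θ _ using hB
    · exact intervalIntegrable_const
    · filter_upwards with θ _
      refine HasSum.mul_right _ (Summable.hasSum (Summable.of_norm ?_))
      simpa [hn] using hB
  have h2 : HasSum (fun n : ℤ => fcoeff m (fun θ => B n * Complex.exp (Complex.I * n * θ)))
      (2 * π * B m) := by
    have : (fun n : ℤ => fcoeff m (fun θ => B n * Complex.exp (Complex.I * n * θ))) =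
        fun n => if n = m then 2 * π * B m else 0 := by
      funext n
      rw [fcoeff_const_mul, fcoeff_cexp]
      split_ifs with h
      · subst h; push_cast; ring
      · simp
    rw [this]
    exact hasSum_ite_eq m _
  exact key.unique h2

theorem fcoeff_neg_of_real {f : ℝ → ℝ} (s : ℝ) : fcoeff (-s) (fun θ => (f θ : ℂ)) =
    (starRingEnd ℂ) (fcoeff s (fun θ => (f θ : ℂ))) := by
  unfold fcoeff
  rw [← intervalIntegral.intervalIntegral_conj]
  congr 1; ext θ
  rw [map_mul, Complex.conj_ofReal, ← Complex.exp_conj]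
  simp

/-! ### Fourier coefficients of the solutions of the transverse equation -/

/-- The potential `1 + b / (1 + e cos θ)` of the equation of the transverse variations, in terms of
the true anomaly `θ`. -/
noncomputable def hillq (b e θ : ℝ) : ℝ := 1 + b / (1 + e * cos θ)

theorem one_add_mul_cos_pos {e : ℝ} (he : |e| < 1) (θ : ℝ) : 0 < 1 + e * cos θ := by
  have h1 : |e * cos θ| < 1 := by
    rw [abs_mul]
    nlinarith [abs_cos_le_one θ, abs_nonneg e, abs_nonneg (cos θ)]
  linarith [(abs_lt.1 h1).1]

theorem continuous_div_one_add_mul_cos (b : ℝ) {e : ℝ} (he : |e| < 1) :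
    Continuous fun θ => b / (1 + e * cos θ) := by
  have := fun θ => (one_add_mul_cos_pos he θ).ne'
  fun_prop (disch := exact this _)

/-- `(f, g)` is a complex solution of `f' = g`, `g' = -q f`. -/
def IsComplexHillSol (q : ℝ → ℝ) (f g : ℝ → ℂ) : Prop :=
  (∀ θ, HasDerivAt f (g θ) θ) ∧ ∀ θ, HasDerivAt g (-(q θ * f θ)) θ

theorem IsHillSol.toComplex {q u v : ℝ → ℝ} (h : IsHillSol q u v) :
    IsComplexHillSol q (fun θ => u θ) (fun θ => v θ) := by
  refine ⟨fun θ => (h.1 θ).ofReal_comp, fun θ => ?_⟩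
  have := (h.2 θ).ofReal_comp
  push_cast at this
  exact this

theorem IsComplexHillSol.re {q : ℝ → ℝ} {f g : ℝ → ℂ} (h : IsComplexHillSol q f g) :
    IsHillSol q (fun θ => (f θ).re) (fun θ => (g θ).re) := by
  refine ⟨fun θ => ?_, fun θ => ?_⟩
  · exact Complex.reCLM.hasFDerivAt.comp_hasDerivAt θ (h.1 θ)
  · have := Complex.reCLM.hasFDerivAt.comp_hasDerivAt θ (h.2 θ)
    refine this.congr_deriv ?_
    simp

theorem IsComplexHillSol.im {q : ℝ → ℝ} {f g : ℝ → ℂ} (h : IsComplexHillSol q f g) :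
    IsHillSol q (fun θ => (f θ).im) (fun θ => (g θ).im) := by
  refine ⟨fun θ => ?_, fun θ => ?_⟩
  · exact Complex.imCLM.hasFDerivAt.comp_hasDerivAt θ (h.1 θ)
  · have := Complex.imCLM.hasFDerivAt.comp_hasDerivAt θ (h.2 θ)
    refine this.congr_deriv ?_
    simp

theorem IsComplexHillSol.combine {q : ℝ → ℝ} {f₁ g₁ f₂ g₂ : ℝ → ℂ} (h₁ : IsComplexHillSol q f₁ g₁)
    (h₂ : IsComplexHillSol q f₂ g₂) (c d : ℂ) :
    IsComplexHillSol q (fun θ => c * f₁ θ + d * f₂ θ) (fun θ => c * g₁ θ + d * g₂ θ) := by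
  refine ⟨fun θ => ((h₁.1 θ).const_mul c).add ((h₂.1 θ).const_mul d), fun θ =>
    (((h₁.2 θ).const_mul c).add ((h₂.2 θ).const_mul d)).congr_deriv ?_⟩
  ring

theorem IsComplexHillSol.continuous {q : ℝ → ℝ} {f g : ℝ → ℂ} (h : IsComplexHillSol q f g) :
    Continuous f ∧ Continuous g :=
  ⟨continuous_iff_continuousAt.2 fun θ => (h.1 θ).continuousAt,
    continuous_iff_continuousAt.2 fun θ => (h.2 θ).continuousAt⟩

/-- The Floquet multiplier of solutions with frequencies in `s + ℤ`. -/
noncomputable def mult (s : ℝ) : ℂ := Complex.exp (Complex.I * s * (2 * π))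

theorem mult_add_int (s : ℝ) (n : ℤ) : mult (s + n) = mult s := by
  unfold mult
  rw [Complex.exp_eq_exp_iff_exists_int]
  exact ⟨n, by push_cast; ring⟩

section recurrence

variable {b e s : ℝ} {f g : ℝ → ℂ}

/-- The differential equation says that `-b f / (1 + e cos θ)` equals `f + f''`, and two derivatives
contribute the factor `-s²`. -/
theorem fcoeff_add_neg_mul (h : IsComplexHillSol (hillq b e) f g) (he : |e| < 1)
    (hf : f (2 * π) = mult s * f 0) (hg : g (2 * π) = mult s * g 0) :
    fcoeff s (fun θ => -(b / (1 + e * cos θ) : ℝ) * f θ) = (1 - s ^ 2) * fcoeff s f := by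
  obtain ⟨cf, cg⟩ := h.continuous
  have ck := continuous_div_one_add_mul_cos b he
  have c2 : Continuous fun θ => -((hillq b e θ : ℂ) * f θ) := by
    have : Continuous (hillq b e) := continuous_const.add ck
    fun_prop
  have e1 := fcoeff_deriv h.1 cg hf
  have e2 := fcoeff_deriv h.2 c2 hg
  have e3 : (fun θ => -(b / (1 + e * cos θ) : ℝ) * f θ) =
      fun θ => f θ + -((hillq b e θ : ℂ) * f θ) := by
    funext θ
    unfold hillq
    push_cast; ring
  rw [e3, fcoeff_add cf c2, e2, e1]
  linear_combination (s ^ 2 * fcoeff s f) * Complex.I_sq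

/-- With `w = f + f''` the equation reads `(1 + e cos θ) w = -b f`, and `cos θ` shifts frequencies
by `±1`. The coefficients of `w` carry the factor `1 - s²`; whether this factor can vanish decides
between the periodic and the antiperiodic case. -/
theorem fcoeff_recurrence (h : IsComplexHillSol (hillq b e) f g) (he : |e| < 1)
    (hf : f (2 * π) = mult s * f 0) (hg : g (2 * π) = mult s * g 0) :
    (1 - s ^ 2) * fcoeff s f + e / 2 * ((1 - (s - 1) ^ 2) * fcoeff (s - 1) f +
      (1 - (s + 1) ^ 2) * fcoeff (s + 1) f) + b * fcoeff s f = 0 := by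
  obtain ⟨cf, cg⟩ := h.continuous
  have ck := continuous_div_one_add_mul_cos b he
  have m1 : mult (s - 1) = mult s := by
    have := mult_add_int s (-1)
    push_cast at this
    rwa [← sub_eq_add_neg] at this
  have m2 : mult (s + 1) = mult s := by simpa using mult_add_int s 1
  have w0 := fcoeff_add_neg_mul h he hf hg
  have w1 := fcoeff_add_neg_mul (s := s - 1) h he (by rw [m1, hf]) (by rw [m1, hg])
  have w2 := fcoeff_add_neg_mul (s := s + 1) h he (by rw [m2, hf]) (by rw [m2, hg])
  set w : ℝ → ℂ := fun θ => -(b / (1 + e * cos θ) : ℝ) * f θ with hw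
  have cw : Continuous w := by fun_prop
  have e1 : fcoeff s (fun θ => w θ + e * ((cos θ : ℂ) * w θ)) = fcoeff s (fun θ => -b * f θ) := by
    congr 1; funext θ
    have hD : ((1 + e * cos θ : ℝ) : ℂ) ≠ 0 := by
      exact_mod_cast (one_add_mul_cos_pos he θ).ne'
    rw [hw]
    push_cast at hD ⊢
    field_simp
    ring
  rw [fcoeff_add cw (by fun_prop), fcoeff_const_mul, fcoeff_const_mul, fcoeff_cos_mul cw, w0, w1,
    w2] at e1
  push_cast at e1
  linear_combination e1

/-- Besides the decay that `f''` gives, `w = f + f''` equals a smooth periodic function times `f`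
and can be differentiated twice more. The resulting quartic decay permits termwise differentiation
of the series and makes the coefficients of `w` tend to zero. -/
theorem exists_fcoeff_decay (h : IsComplexHillSol (hillq b e) f g) (he : |e| < 1)
    (hf : f (2 * π) = mult s * f 0) (hg : g (2 * π) = mult s * g 0) :
    ∃ C, ∀ n : ℤ, ‖((s + n : ℝ) : ℂ) ^ 2 * fcoeff (s + n) f‖ ≤ C ∧
      ‖((s + n : ℝ) : ℂ) ^ 2 * ((1 - ((s + n : ℝ) : ℂ) ^ 2) * fcoeff (s + n) f)‖ ≤ C := by
  obtain ⟨cf, cg⟩ := h.continuous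
  have hD := fun θ => (one_add_mul_cos_pos he θ).ne'
  have ck := continuous_div_one_add_mul_cos b he
  have cq : Continuous (hillq b e) := continuous_const.add ck
  set k : ℝ → ℝ := fun θ => b / (1 + e * cos θ) with hk
  set k₁ : ℝ → ℝ := fun θ => b * e * sin θ / (1 + e * cos θ) ^ 2 with hk₁
  set k₂ : ℝ → ℝ := fun θ => (b * e * cos θ * (1 + e * cos θ) ^ 2 +
    b * e * sin θ * (2 * (1 + e * cos θ) * (e * sin θ))) / ((1 + e * cos θ) ^ 2) ^ 2 with hk₂
  have dD : ∀ θ, HasDerivAt (fun θ => 1 + e * cos θ) (-(e * sin θ)) θ := fun θ =>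
    (((hasDerivAt_cos θ).const_mul e).const_add 1).congr_deriv (by ring)
  have dk : ∀ θ, HasDerivAt k (k₁ θ) θ := fun θ => by
    refine ((hasDerivAt_const θ b).div (dD θ) (hD θ)).congr_deriv ?_
    rw [hk₁]; ring
  have dk₁ : ∀ θ, HasDerivAt k₁ (k₂ θ) θ := fun θ => by
    refine (((hasDerivAt_sin θ).const_mul (b * e)).div ((dD θ).fun_pow 2)
      (pow_ne_zero 2 (hD θ))).congr_deriv ?_
    rw [hk₂]; push_cast; ring
  have ck₁ : Continuous k₁ := by
    exact Continuous.div (by fun_prop) (by fun_prop) fun θ => pow_ne_zero 2 (hD θ)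
  have ck₂ : Continuous k₂ := by
    exact Continuous.div (by fun_prop) (by fun_prop) fun θ => pow_ne_zero 2 (pow_ne_zero 2 (hD θ))
  have dw : ∀ θ, HasDerivAt (fun θ => -(k θ : ℂ) * f θ) (-(k₁ θ * f θ + k θ * g θ)) θ := fun θ =>
    ((dk θ).ofReal_comp.fun_neg.mul (h.1 θ)).congr_deriv (by ring)
  have dw₁ : ∀ θ, HasDerivAt (fun θ => -((k₁ θ : ℂ) * f θ + k θ * g θ))
      (-(k₂ θ * f θ + 2 * k₁ θ * g θ - k θ * (hillq b e θ * f θ))) θ := fun θ =>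
    (((dk₁ θ).ofReal_comp.mul (h.1 θ)).add ((dk θ).ofReal_comp.mul (h.2 θ))).fun_neg.congr_deriv
      (by ring)
  have c2 : Continuous fun θ => -((hillq b e θ : ℂ) * f θ) := by fun_prop
  have cw₁ : Continuous fun θ => -((k₁ θ : ℂ) * f θ + k θ * g θ) := by fun_prop
  have cw₂ : Continuous fun θ =>
      -(k₂ θ * f θ + 2 * k₁ θ * g θ - k θ * (hillq b e θ * f θ)) := by fun_prop
  obtain ⟨C₁, hC₁⟩ := exists_fcoeff_bound c2
  obtain ⟨C₂, hC₂⟩ := exists_fcoeff_bound cw₂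
  refine ⟨max C₁ C₂, fun n => ?_⟩
  have m1 := mult_add_int s n
  rw [← m1] at hf hg
  set t := s + n with ht
  have e1 := fcoeff_deriv h.1 cg hf
  have e2 := fcoeff_deriv h.2 c2 hg
  have e3 := fcoeff_add_neg_mul h he hf hg
  have kp : k (2 * π) = k 0 := by simp [hk]
  have kp₁ : k₁ (2 * π) = k₁ 0 := by simp [hk₁]
  have e4 := fcoeff_deriv dw cw₁ (s := t) (by
    simp only [kp, hf, mult]; ring)
  have e5 := fcoeff_deriv dw₁ cw₂ (s := t) (by
    simp only [kp, kp₁, hf, hg, mult]; ring)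
  constructor
  · refine le_trans (le_of_eq ?_) ((hC₁ t).trans (le_max_left _ _))
    rw [e2, e1, ← norm_neg]
    congr 1
    linear_combination (t ^ 2 * fcoeff t f) * -Complex.I_sq
  · refine le_trans (le_of_eq ?_) ((hC₂ t).trans (le_max_right _ _))
    rw [e5, e4, ← norm_neg]
    change ‖-((t : ℂ) ^ 2 * ((1 - (t : ℂ) ^ 2) * fcoeff t f))‖ = ‖Complex.I * t * (Complex.I * t *
      fcoeff t fun θ => -(b / (1 + e * cos θ) : ℝ) * f θ)‖
    rw [e3]
    congr 1
    linear_combination (t ^ 2 * ((1 - t ^ 2) * fcoeff t f)) * -Complex.I_sq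

end recurrence

/-! ### Coexistence of periodic solutions -/

theorem hillq_periodic (b e : ℝ) : Function.Periodic (hillq b e) (2 * π) := by
  intro θ; simp [hillq]

/-- The potential of the transverse equation. -/
noncomputable def hill (b e : ℝ) (he : |e| < 1) : Potential where
  q := hillq b e
  continuous := continuous_const.add (continuous_div_one_add_mul_cos b he)
  periodic := hillq_periodic b e

/-- The part with positive frequencies of a trigonometric series solves the transverse equation,
if its coefficients satisfy the recurrence. -/
theorem isComplexHillSol_tsum {b e : ℝ} (he : |e| < 1) {B : ℤ → ℂ} {C : ℝ}
    (hB : ∀ n : ℤ, ‖(n : ℂ) ^ 2 * B n‖ ≤ C / (n : ℝ) ^ 2) (hB0 : B 0 = 0)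
    (hrec : ∀ n : ℤ, (1 - (n : ℂ) ^ 2) * B n + e / 2 * ((1 - ((n - 1 : ℤ) : ℂ) ^ 2) * B (n - 1) +
      (1 - ((n + 1 : ℤ) : ℂ) ^ 2) * B (n + 1)) + b * B n = 0) :
    IsComplexHillSol (hillq b e) (fun θ => ∑' n : ℤ, B n * Complex.exp (Complex.I * n * θ))
      (fun θ => ∑' n : ℤ, Complex.I * n * B n * Complex.exp (Complex.I * n * θ)) := by
  have hu : Summable fun n : ℤ => C / (n : ℝ) ^ 2 := by
    simpa [div_eq_mul_inv] using
      (Real.summable_one_div_int_pow.2 one_lt_two).mul_left C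
  have hE : ∀ (n : ℤ) (θ : ℝ), ‖Complex.exp (Complex.I * n * θ)‖ = 1 := by
    intro n θ
    have := norm_cexp_neg_I_mul (-n) θ
    rw [← this]; congr 2; push_cast; ring
  have hnorm : ∀ n : ℤ, n ≠ 0 → (1 : ℝ) ≤ ‖(n : ℂ)‖ := by
    intro n hn
    rw [Complex.norm_intCast]
    exact_mod_cast Int.one_le_abs hn
  -- At `n = 0` the right-hand side is `C / 0 = 0`, so `B 0 = 0` is needed there.
  have b0 : ∀ n : ℤ, ‖B n‖ ≤ C / (n : ℝ) ^ 2 := by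
    intro n
    refine le_trans ?_ (hB n)
    rcases eq_or_ne n 0 with rfl | hn
    · simp [hB0]
    · rw [norm_mul, norm_pow]
      exact le_mul_of_one_le_left (norm_nonneg _) (one_le_pow₀ (hnorm n hn))
  have b1 : ∀ n : ℤ, ‖Complex.I * n * B n‖ ≤ C / (n : ℝ) ^ 2 := by
    intro n
    refine le_trans ?_ (hB n)
    rcases eq_or_ne n 0 with rfl | hn
    · simp [hB0]
    · rw [norm_mul, norm_mul, norm_mul, norm_pow, Complex.norm_I, one_mul, sq, mul_assoc]
      exact le_mul_of_one_le_left (by positivity) (hnorm n hn)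
  have b2 : ∀ n : ℤ, ‖Complex.I * n * (Complex.I * n * B n)‖ ≤ C / (n : ℝ) ^ 2 := by
    intro n
    refine le_of_eq_of_le ?_ (hB n)
    rw [← norm_neg]; congr 1
    linear_combination (-(n : ℂ) ^ 2 * B n) * Complex.I_sq
  have hsum : ∀ (A : ℤ → ℂ), (∀ n : ℤ, ‖A n‖ ≤ C / (n : ℝ) ^ 2) → ∀ θ : ℝ,
      Summable fun n : ℤ => A n * Complex.exp (Complex.I * n * θ) := by
    intro A hA θ
    exact Summable.of_norm_bounded hu fun n => by rw [norm_mul, hE, mul_one]; exact hA n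
  have hder : ∀ (A : ℤ → ℂ), (∀ n : ℤ, ‖A n‖ ≤ C / (n : ℝ) ^ 2) →
      (∀ n : ℤ, ‖Complex.I * n * A n‖ ≤ C / (n : ℝ) ^ 2) → ∀ θ : ℝ,
      HasDerivAt (fun θ : ℝ => ∑' n : ℤ, A n * Complex.exp (Complex.I * n * θ))
        (∑' n : ℤ, Complex.I * n * A n * Complex.exp (Complex.I * n * θ)) θ := by
    intro A hA hA' θ
    refine hasDerivAt_tsum (𝕜 := ℝ) (F := ℂ)
      (g := fun (n : ℤ) (θ : ℝ) => A n * Complex.exp (Complex.I * n * θ))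
      (g' := fun (n : ℤ) (θ : ℝ) => Complex.I * n * A n * Complex.exp (Complex.I * n * θ))
      (y₀ := (0 : ℝ)) hu (fun n y => ?_) (fun n y => ?_) (hsum A hA 0) θ
    · exact ((hasDerivAt_cexp_mul (Complex.I * n) y).const_mul (A n)).congr_deriv (by ring)
    · rw [norm_mul, hE, mul_one]; exact hA' n
  refine ⟨hder B b0 b1, fun θ => ?_⟩
  refine (hder _ b1 b2 θ).congr_deriv ?_
  have s0 := (hsum B b0 θ).hasSum
  have s2 := (hsum _ b2 θ).hasSum
  set h₀ := ∑' n : ℤ, B n * Complex.exp (Complex.I * n * θ)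
  set h₂ := ∑' n : ℤ, Complex.I * n * (Complex.I * n * B n) * Complex.exp (Complex.I * n * θ)
  -- This is the series of `w = f + f''`. Its products with `exp (±iθ)` are index shifts, so the sum
  -- of the recurrences is `(1 + e cos θ) w + b f = 0`.
  have sv : HasSum (fun n : ℤ => (1 - (n : ℂ) ^ 2) * B n * Complex.exp (Complex.I * n * θ))
      (h₀ + h₂) := by
    refine (s0.add s2).congr_fun ?_
    intro n
    linear_combination (-(n : ℂ) ^ 2 * B n * Complex.exp (Complex.I * n * θ)) * Complex.I_sq
  have sv1 : HasSum (fun n : ℤ => (1 - ((n - 1 : ℤ) : ℂ) ^ 2) * B (n - 1) *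
      Complex.exp (Complex.I * n * θ)) ((h₀ + h₂) * Complex.exp (θ * Complex.I)) := by
    have := (Equiv.subRight (1 : ℤ)).hasSum_iff.2 (sv.mul_right (Complex.exp (θ * Complex.I)))
    refine this.congr_fun fun n => ?_
    simp only [Function.comp, Equiv.subRight_apply]
    rw [mul_assoc _ (Complex.exp _), ← Complex.exp_add]
    congr 2; push_cast; ring
  have sv2 : HasSum (fun n : ℤ => (1 - ((n + 1 : ℤ) : ℂ) ^ 2) * B (n + 1) *
      Complex.exp (Complex.I * n * θ)) ((h₀ + h₂) * Complex.exp (-θ * Complex.I)) := by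
    have := (Equiv.addRight (1 : ℤ)).hasSum_iff.2 (sv.mul_right (Complex.exp (-θ * Complex.I)))
    refine this.congr_fun fun n => ?_
    simp only [Function.comp, Equiv.coe_addRight]
    rw [mul_assoc _ (Complex.exp _), ← Complex.exp_add]
    congr 2; push_cast; ring
  have tot := (sv.add (((sv1.add sv2).mul_left ((e : ℂ) / 2)).add (s0.mul_left (b : ℂ))))
  have hz := tot.unique (hasSum_zero.congr_fun fun n => by
    linear_combination Complex.exp (Complex.I * n * θ) * hrec n)
  have hD : ((1 + e * cos θ : ℝ) : ℂ) ≠ 0 := by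
    exact_mod_cast (one_add_mul_cos_pos he θ).ne'
  unfold hillq
  push_cast at hD ⊢
  have hc : Complex.exp (θ * Complex.I) + Complex.exp (-θ * Complex.I) = 2 * Complex.cos θ := by
    rw [Complex.two_cos]
  have hmain : (1 + e * Complex.cos θ) * (h₀ + h₂) + b * h₀ = 0 := by
    linear_combination hz - (e / 2 * (h₀ + h₂)) * hc
  field_simp
  linear_combination hmain

theorem fin_two_matrix_eq_one {A : Matrix (Fin 2) (Fin 2) ℝ} {p u p' u' : ℝ}
    (h : A.mulVec ![p, u] = ![p, u]) (h' : A.mulVec ![p', u'] = ![p', u'])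
    (hd : p * u' - u * p' ≠ 0) : A = 1 := by
  have h0 := congrFun h 0
  have h1 := congrFun h 1
  have h0' := congrFun h' 0
  have h1' := congrFun h' 1
  simp [Matrix.mulVec, dotProduct, Fin.sum_univ_two] at h0 h1 h0' h1'
  ext i j
  fin_cases i <;> fin_cases j <;> simp <;> refine mul_right_cancel₀ hd ?_
  · linear_combination u' * h0 - u * h0'
  · linear_combination p * h0' - p' * h0
  · linear_combination u' * h1 - u * h1'
  · linear_combination p * h1' - p' * h1

/-- If the transverse equation has a nonzero solution of period `2π`, then all its solutions have
period `2π`. -/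
theorem hill_mono_eq_one {b e : ℝ} (hb : 0 < b) (he : |e| < 1) {p₀ u₀ : ℝ}
    (hne : ¬ (p₀ = 0 ∧ u₀ = 0)) (hfix : (hill b e he).mono.mulVec ![p₀, u₀] = ![p₀, u₀]) :
    (hill b e he).mono = 1 := by
  -- If the monodromy matrix is not the identity, the periodic solutions form a line. The
  -- positive-frequency part of the given real solution will be a periodic solution off that line.
  by_contra hmono
  obtain ⟨u, v, huv, hu0, hv0⟩ := (hill b e he).exists_isHillSol p₀ u₀
  have hper := (hill b e he).mono_mulVec huv
  rw [hu0, hv0, hfix] at hper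
  have hvT : v (2 * π) = v 0 := by rw [hv0]; simpa using (congrFun hper 0).symm
  have huT : u (2 * π) = u 0 := by rw [hu0]; simpa using (congrFun hper 1).symm
  have hC : IsComplexHillSol (hillq b e) (fun θ => u θ) (fun θ => v θ) := huv.toComplex
  set a : ℤ → ℂ := fun n => fcoeff n (fun θ => (u θ : ℂ)) with ha
  have m0 : ∀ n : ℤ, mult n = 1 := fun n => by
    have := mult_add_int 0 n
    rw [zero_add] at this
    rw [this]; simp [mult]
  have hrec : ∀ n : ℤ, (1 - (n : ℂ) ^ 2) * a n + e / 2 * ((1 - ((n - 1 : ℤ) : ℂ) ^ 2) * a (n - 1) +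
      (1 - ((n + 1 : ℤ) : ℂ) ^ 2) * a (n + 1)) + b * a n = 0 := by
    intro n
    have := fcoeff_recurrence (s := n) hC he (by rw [m0, huT, one_mul]) (by rw [m0, hvT, one_mul])
    simp only [ha]
    push_cast at this ⊢
    exact this
  -- At `n = 0` both neighbours have frequency `±1`, where `1 - n² = 0`. What remains is `(1 + b) a
  -- 0 = 0`.
  have a0 : a 0 = 0 := by
    have h0 := hrec 0
    norm_num at h0
    have h1 : (1 + b : ℂ) * a 0 = 0 := by linear_combination h0
    refine (mul_eq_zero.1 h1).resolve_left ?_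
    have : (1 + b : ℝ) ≠ 0 := by positivity
    exact_mod_cast this
  have aconj : ∀ n, a (-n) = 0 → a n = 0 := by
    intro n hn
    have := fcoeff_neg_of_real (f := u) n
    simp only [ha] at hn ⊢
    push_cast at hn this
    rw [hn] at this
    simpa using this.symm
  have hall : ¬ ∀ n, a n = 0 := by
    intro hz
    have hu : ∀ θ ∈ Ico 0 (2 * π), (u θ : ℂ) = 0 := by
      refine eq_zero_of_fcoeff_eq_zero hC.continuous.1 (s := 0) (by simp [huT]) fun n => ?_
      simpa using hz n
    have hu' : u =ᶠ[𝓝[>] 0] fun _ => 0 := by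
      filter_upwards [Ioo_mem_nhdsGT two_pi_pos] with θ hθ
      exact_mod_cast hu θ ⟨hθ.1.le, hθ.2⟩
    have h1 : u 0 = 0 := by exact_mod_cast hu 0 ⟨le_rfl, two_pi_pos⟩
    have h2 : HasDerivWithinAt u 0 (Ioi 0) 0 :=
      (hasDerivWithinAt_const (0 : ℝ) (Ioi 0) (0 : ℝ)).congr_of_eventuallyEq hu' h1
    have h3 := (uniqueDiffWithinAt_Ioi (0 : ℝ)).eq_deriv _ (huv.1 0).hasDerivWithinAt h2
    exact hne ⟨by rw [← hv0, h3], by rw [← hu0, h1]⟩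
  -- The truncation still satisfies the recurrence: at `n = 1` the omitted term contains `a 0 = 0`,
  -- and at `n = 0` the term with `B 1` has the factor `1 - 1² = 0`.
  set B : ℤ → ℂ := fun n => if 1 ≤ n then a n else 0 with hB
  obtain ⟨C, hCb⟩ := exists_fcoeff_decay (s := 0) hC he (by simp [mult, huT]) (by simp [mult, hvT])
  have hCn : ∀ n : ℤ, ‖(n : ℂ) ^ 2 * B n‖ ≤ (C + C) / (n : ℝ) ^ 2 := by
    intro n
    by_cases hn : 1 ≤ n
    · have hn' : (0 : ℝ) < (n : ℝ) ^ 2 := by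
        have : (1 : ℝ) ≤ n := by exact_mod_cast hn
        positivity
      obtain ⟨h1, h2⟩ := hCb n
      rw [zero_add] at h1 h2
      have h3 : ‖((n : ℝ) : ℂ) ^ 2‖ = (n : ℝ) ^ 2 := by simp
      rw [le_div_iff₀ hn', ← h3, mul_comm, ← norm_mul]
      simp only [hB, hn, if_true]
      have h4 : ((n : ℝ) : ℂ) ^ 2 * ((n : ℂ) ^ 2 * a n) = ((n : ℝ) : ℂ) ^ 2 * a n -
          ((n : ℝ) : ℂ) ^ 2 * ((1 - ((n : ℝ) : ℂ) ^ 2) * a n) := by push_cast; ring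
      rw [h4]
      exact (norm_sub_le _ _).trans (add_le_add h1 h2)
    · simp only [hB, hn, if_false]
      have : 0 ≤ C := (norm_nonneg _).trans (hCb 0).1
      simp; positivity
  have hrecB : ∀ n : ℤ, (1 - (n : ℂ) ^ 2) * B n + e / 2 * ((1 - ((n - 1 : ℤ) : ℂ) ^ 2) * B (n - 1) +
      (1 - ((n + 1 : ℤ) : ℂ) ^ 2) * B (n + 1)) + b * B n = 0 := by
    intro n
    rcases lt_trichotomy n 0 with hn | rfl | hn
    · have h1 : ¬ 1 ≤ n := by omega
      have h2 : ¬ 1 ≤ n - 1 := by omega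
      have h3 : ¬ 1 ≤ n + 1 := by omega
      simp only [hB, h1, h2, h3, if_false]; ring
    · simp [hB]
    · have h1 : 1 ≤ n := by omega
      have h3 : 1 ≤ n + 1 := by omega
      have h := hrec n
      have h2 : (1 - ((n - 1 : ℤ) : ℂ) ^ 2) * B (n - 1) = (1 - ((n - 1 : ℤ) : ℂ) ^ 2) * a (n - 1) := by
        by_cases h2 : 1 ≤ n - 1
        · simp only [hB, h2, if_true]
        · have : n = 1 := by omega
          subst this
          simp [hB, a0]
      rw [h2]
      simp only [hB, h1, h3, if_true]
      exact h
  have hf := isComplexHillSol_tsum he hCn (by simp [hB]) hrecB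
  set f : ℝ → ℂ := fun θ => ∑' n : ℤ, B n * Complex.exp (Complex.I * n * θ) with hfdef
  set g : ℝ → ℂ := fun θ => ∑' n : ℤ, Complex.I * n * B n * Complex.exp (Complex.I * n * θ) with hgdef
  have hexp : ∀ n : ℤ, Complex.exp (Complex.I * n * ((2 * π : ℝ) : ℂ)) = 1 := fun n => by
    rw [Complex.exp_eq_one_iff]; exact ⟨n, by push_cast; ring⟩
  have fT : f (2 * π) = f 0 := by
    simp only [hfdef, hexp]; simp
  have gT : g (2 * π) = g 0 := by
    simp only [hgdef, hexp]; simp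
  -- A periodic solution independent of the given one would provide two independent fixed vectors of
  -- the monodromy matrix.
  have dep : ∀ {x y : ℝ → ℝ}, IsHillSol (hillq b e) x y → x (2 * π) = x 0 → y (2 * π) = y 0 →
      p₀ * x 0 - u₀ * y 0 = 0 := by
    intro x y hxy hx hy
    by_contra hd
    have := (hill b e he).mono_mulVec hxy
    rw [hx, hy] at this
    exact hmono (fin_two_matrix_eq_one hfix this hd)
  -- Both the real and the imaginary part of `f` are proportional to `u`, so `f` is a complex
  -- multiple of `u`.
  have hκ : ∃ κ : ℂ, ∀ θ, f θ = κ * u θ := by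
    have d1 := dep hf.re (by rw [fT]) (by rw [gT])
    have d2 := dep hf.im (by rw [fT]) (by rw [gT])
    have hd : (p₀ : ℂ) * f 0 - u₀ * g 0 = 0 := by
      apply Complex.ext <;> simp <;> assumption
    obtain ⟨κ, hκ1, hκ2⟩ : ∃ κ : ℂ, f 0 = κ * u₀ ∧ g 0 = κ * p₀ := by
      rcases eq_or_ne p₀ 0 with hp | hp
      · have hu : u₀ ≠ 0 := fun hu => hne ⟨hp, hu⟩
        have hu' : (u₀ : ℂ) ≠ 0 := by exact_mod_cast hu
        refine ⟨f 0 / u₀, by field_simp, ?_⟩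
        rw [hp] at hd ⊢
        simp at hd ⊢
        exact hd.resolve_left hu
      · have hp' : (p₀ : ℂ) ≠ 0 := by exact_mod_cast hp
        refine ⟨g 0 / p₀, ?_, by field_simp⟩
        field_simp
        linear_combination hd
    refine ⟨κ, fun θ => ?_⟩
    have hz := hf.combine hC 1 (-κ)
    have r1 := (IsHillSol.eq_zero (Q := hill b e he) hz.re (by simp [hκ1, hu0]) (by simp [hκ2, hv0])).1
    have r2 := (IsHillSol.eq_zero (Q := hill b e he) hz.im (by simp [hκ1, hu0]) (by simp [hκ2, hv0])).1
    have : 1 * f θ + -κ * u θ = 0 := Complex.ext (congrFun r1 θ) (congrFun r2 θ)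
    linear_combination this
  obtain ⟨κ, hκ⟩ := hκ
  have hBs : Summable fun n => ‖B n‖ := by
    have hu : Summable fun n : ℤ => (C + C) / (n : ℝ) ^ 2 := by
      simpa [div_eq_mul_inv] using
        (Real.summable_one_div_int_pow.2 one_lt_two).mul_left (C + C)
    refine Summable.of_nonneg_of_le (fun n => norm_nonneg _) (fun n => le_trans ?_ (hCn n)) hu
    by_cases hn : 1 ≤ n
    · rw [norm_mul, norm_pow, Complex.norm_intCast]
      have : (1 : ℝ) ≤ |(n : ℝ)| := by
        rw [abs_of_pos (by exact_mod_cast hn)]; exact_mod_cast hn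
      exact le_mul_of_one_le_left (norm_nonneg _) (one_le_pow₀ this)
    · simp [hB, hn]
  have hco : ∀ m : ℤ, 2 * π * B m = κ * a m := by
    intro m
    rw [← fcoeff_tsum hBs m, ha, ← fcoeff_const_mul]
    congr 1; funext θ; exact hκ θ
  apply hall
  -- If `κ = 0`, then `B = 0`. Otherwise `κ a (-n) = 2π B (-n) = 0` for `n ≥ 1`, and `a n` is the
  -- conjugate of `a (-n)` because `u` is real.
  have hpos : ∀ n : ℤ, 1 ≤ n → a n = 0 := by
    intro n hn
    rcases eq_or_ne κ 0 with hk | hk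
    · have := hco n
      simp only [hB, hn, if_true, hk, zero_mul] at this
      simpa [pi_ne_zero] using this
    · have h1 : ¬ 1 ≤ -n := by omega
      have := hco (-n)
      simp only [hB, h1, if_false, mul_zero] at this
      exact aconj n ((mul_eq_zero.1 this.symm).resolve_left hk)
  intro n
  rcases lt_trichotomy n 0 with hn | rfl | hn
  · have h1 := aconj (-n)
    rw [neg_neg] at h1
    have h2 := hpos (-n) (by omega)
    exact aconj n h2
  · exact a0
  · exact hpos n (by omega)

/-- If `e ≠ 0`, then the transverse equation has a solution that does not change its sign after
`2π`. -/
theorem hill_mono_ne_neg_one {b e : ℝ} (he : |e| < 1) (he0 : e ≠ 0) :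
    (hill b e he).mono ≠ -1 := by
  intro hmono
  obtain ⟨u₁, v₁, h₁, hu₁, hv₁⟩ := (hill b e he).exists_isHillSol 1 0
  obtain ⟨u₂, v₂, h₂, hu₂, hv₂⟩ := (hill b e he).exists_isHillSol 0 1
  have m0 : ∀ n : ℤ, mult (1 / 2 + n) = -1 := fun n => by
    rw [mult_add_int, mult]
    rw [show Complex.I * ((1 / 2 : ℝ) : ℂ) * (2 * π) = π * Complex.I by push_cast; ring]
    exact Complex.exp_pi_mul_I
  have hanti : ∀ {u v : ℝ → ℝ}, IsHillSol (hillq b e) u v →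
      (u (2 * π) : ℂ) = (-1) * u 0 ∧ (v (2 * π) : ℂ) = (-1) * v 0 := by
    intro u v h
    have := (hill b e he).mono_mulVec h
    rw [hmono] at this
    have e0 := congrFun this 0
    have e1 := congrFun this 1
    simp [Matrix.neg_mulVec] at e0 e1
    rw [← e0, ← e1]
    push_cast
    constructor <;> ring
  -- If the monodromy matrix is `-1`, all solutions are antiperiodic, with frequencies in `1/2 + ℤ`.
  -- `W u n` is the coefficient of `u + u''`.
  set W : (ℝ → ℝ) → ℤ → ℂ := fun u n =>
    (1 - ((1 / 2 + n : ℝ) : ℂ) ^ 2) * fcoeff (1 / 2 + n) (fun θ => (u θ : ℂ)) with hW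
  -- A half-integer frequency is never `±1`. Hence the recurrence can be written in terms of `W`
  -- alone, with constant nonzero outer coefficients `e / 2`.
  have hfac : ∀ n : ℤ, (1 - ((1 / 2 + n : ℝ) : ℂ) ^ 2) ≠ 0 := by
    intro n h
    have h1 : (1 - (1 / 2 + (n : ℝ)) ^ 2) = 0 := by exact_mod_cast h
    have h2 : (2 * n - 1 : ℤ) * (2 * n + 3) = 0 := by
      have : ((2 * n - 1 : ℤ) * (2 * n + 3) : ℝ) = 0 := by push_cast; linear_combination (-4) * h1
      exact_mod_cast this
    rcases mul_eq_zero.1 h2 with h3 | h3 <;> omega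
  have hrec : ∀ {u v : ℝ → ℝ}, IsHillSol (hillq b e) u v → ∀ n : ℤ,
      (1 + b / (1 - ((1 / 2 + n : ℝ) : ℂ) ^ 2)) * W u n + e / 2 * (W u (n - 1) + W u (n + 1)) = 0 := by
    intro u v h n
    have hC := h.toComplex
    have := fcoeff_recurrence (s := 1 / 2 + n) hC he (by rw [m0]; exact (hanti h).1)
      (by rw [m0]; exact (hanti h).2)
    have hf := hfac n
    have i1 : (1 / 2 + ((n - 1 : ℤ) : ℝ)) = 1 / 2 + n - 1 := by push_cast; ring
    have i2 : (1 / 2 + ((n + 1 : ℤ) : ℝ)) = 1 / 2 + n + 1 := by push_cast; ring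
    simp only [hW, i1, i2]
    rw [add_mul, one_mul]
    have e1 : (b : ℂ) / (1 - ((1 / 2 + n : ℝ) : ℂ) ^ 2) * ((1 - ((1 / 2 + n : ℝ) : ℂ) ^ 2) *
        fcoeff (1 / 2 + n) fun θ => (u θ : ℂ)) = b * fcoeff (1 / 2 + n) fun θ => (u θ : ℂ) := by
      rw [← mul_assoc, div_mul_cancel₀ _ hf]
    rw [e1]
    push_cast at this ⊢
    linear_combination this
  have hdecay : ∀ {u v : ℝ → ℝ}, IsHillSol (hillq b e) u v →
      Tendsto (fun n : ℕ => W u n) atTop (𝓝 0) := by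
    intro u v h
    obtain ⟨C, hC⟩ := exists_fcoeff_decay (s := 1 / 2) h.toComplex he
      (by have := m0 0; simp only [Int.cast_zero, add_zero] at this; rw [this]; exact (hanti h).1)
      (by have := m0 0; simp only [Int.cast_zero, add_zero] at this; rw [this]; exact (hanti h).2)
    have hC0 : 0 ≤ C := (norm_nonneg _).trans (hC 0).1
    refine squeeze_zero_norm' (a := fun n : ℕ => C * (1 / (n : ℝ))) ?_ ?_
    · filter_upwards [eventually_ge_atTop 1] with n hn
      have hn' : (1 : ℝ) ≤ n := by exact_mod_cast hn
      have h2 := (hC n).2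
      rw [norm_mul, norm_pow, Complex.norm_real, norm_eq_abs] at h2
      simp only [Int.cast_natCast] at h2
      rw [abs_of_nonneg (by positivity)] at h2
      simp only [hW, Int.cast_natCast]
      rw [mul_one_div, le_div_iff₀ (by positivity), mul_comm]
      refine le_trans (mul_le_mul_of_nonneg_right ?_ (norm_nonneg _)) h2
      nlinarith
    · simpa using tendsto_one_div_atTop_nhds_zero_nat.const_mul C
  -- The discrete Wronskian of two solutions of the recurrence is constant. By decay it tends to
  -- zero, so it is zero.
  have hcas : ∀ n : ℕ, W u₁ n * W u₂ (n + 1) - W u₁ (n + 1) * W u₂ n =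
      W u₁ 0 * W u₂ 1 - W u₁ 1 * W u₂ 0 := by
    intro n
    induction n with
    | zero => simp
    | succ n ih =>
      rw [← ih]
      have r1 := hrec h₁ (n + 1)
      have r2 := hrec h₂ (n + 1)
      rw [add_sub_cancel_right] at r1 r2
      have he' : (e : ℂ) / 2 ≠ 0 := by simpa using he0
      refine mul_left_cancel₀ he' ?_
      push_cast
      linear_combination W u₁ (n + 1) * r2 - W u₂ (n + 1) * r1
  have hcas0 : W u₁ 0 * W u₂ 1 - W u₁ 1 * W u₂ 0 = 0 := by
    have l1 := hdecay h₁
    have l2 := hdecay h₂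
    have l1' := l1.comp (tendsto_add_atTop_nat 1)
    have l2' := l2.comp (tendsto_add_atTop_nat 1)
    have := (l1.mul l2').sub (l1'.mul l2)
    simp only [Function.comp_def, Nat.cast_add, Nat.cast_one, hcas] at this
    simpa using tendsto_nhds_unique tendsto_const_nhds this
  -- A nontrivial combination vanishes at two consecutive indices, hence at all indices by the
  -- recurrence. Then the same combination of `u₁` and `u₂` vanishes on a period, against their
  -- Wronskian.
  obtain ⟨c, d, hcd, k0, k1⟩ : ∃ c d : ℂ, ¬ (c = 0 ∧ d = 0) ∧ c * W u₁ 0 + d * W u₂ 0 = 0 ∧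
      c * W u₁ 1 + d * W u₂ 1 = 0 := by
    by_cases h0 : W u₁ 0 = 0
    · by_cases h1 : W u₁ 1 = 0
      · exact ⟨1, 0, by simp, by simp [h0], by simp [h1]⟩
      · exact ⟨-W u₂ 1, W u₁ 1, fun h => h1 h.2, by linear_combination -hcas0, by ring⟩
    · exact ⟨-W u₂ 0, W u₁ 0, fun h => h0 h.2, by ring, by linear_combination hcas0⟩
  have he' : (e : ℂ) / 2 ≠ 0 := by simpa using he0
  set Z : ℤ → ℂ := fun n => c * W u₁ n + d * W u₂ n with hZ
  have hZrec : ∀ n : ℤ, (1 + b / (1 - ((1 / 2 + n : ℝ) : ℂ) ^ 2)) * Z n +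
      e / 2 * (Z (n - 1) + Z (n + 1)) = 0 := by
    intro n
    simp only [hZ]
    linear_combination c * hrec h₁ n + d * hrec h₂ n
  have hZ0 : ∀ n : ℤ, Z n = 0 ∧ Z (n + 1) = 0 := by
    intro n
    induction n using Int.induction_on with
    | zero => exact ⟨k0, k1⟩
    | succ n ih =>
      refine ⟨ih.2, ?_⟩
      have := hZrec (n + 1)
      rw [add_sub_cancel_right, ih.1, ih.2] at this
      simpa [he0] using this
    | pred n ih =>
      rw [sub_add_cancel]
      refine ⟨?_, ih.1⟩
      have := hZrec (-n)
      rw [ih.1, ih.2] at this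
      simpa [he0] using this
  have hcomb := h₁.toComplex.combine h₂.toComplex c d
  have hz : ∀ θ ∈ Ico 0 (2 * π), c * (u₁ θ : ℂ) + d * u₂ θ = 0 := by
    refine eq_zero_of_fcoeff_eq_zero hcomb.continuous.1 (s := 1 / 2) ?_ fun n => ?_
    · have := m0 0
      simp only [Int.cast_zero, add_zero] at this
      unfold mult at this
      rw [this, (hanti h₁).1, (hanti h₂).1]; ring
    · have c1 := h₁.toComplex.continuous.1
      have c2 := h₂.toComplex.continuous.1
      rw [fcoeff_add (by fun_prop) (by fun_prop), fcoeff_const_mul, fcoeff_const_mul]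
      have := (hZ0 n).1
      simp only [hZ, hW] at this
      rw [add_comm (n : ℝ)]
      refine (mul_eq_zero.1 (?_ : (1 - ((1 / 2 + n : ℝ) : ℂ) ^ 2) * _ = 0)).resolve_left (hfac n)
      linear_combination this
  have hpi : π ∈ Ico 0 (2 * π) := ⟨pi_pos.le, by linarith [pi_pos]⟩
  have z1 := hz π hpi
  have z2 : c * (v₁ π : ℂ) + d * v₂ π = 0 := by
    have hev : (fun θ => c * (u₁ θ : ℂ) + d * u₂ θ) =ᶠ[𝓝 π] fun _ => 0 := by
      filter_upwards [Ioo_mem_nhds pi_pos (by linarith [pi_pos] : π < 2 * π)] with θ hθ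
      exact hz θ ⟨hθ.1.le, hθ.2⟩
    exact (hcomb.1 π).unique ((hasDerivAt_const π (0 : ℂ)).congr_of_eventuallyEq hev)
  have hw := h₁.wronskian h₂ 0 π
  rw [hu₁, hv₁, hu₂, hv₂] at hw
  have hw' : (u₁ π : ℂ) * v₂ π - v₁ π * u₂ π = -1 := by
    have : u₁ π * v₂ π - v₁ π * u₂ π = -1 := by linarith
    exact_mod_cast this
  refine hcd ⟨?_, ?_⟩
  · linear_combination (-(v₂ π : ℂ)) * z1 + (u₂ π : ℂ) * z2 + c * hw'
  · linear_combination (v₁ π : ℂ) * z1 - (u₁ π : ℂ) * z2 + d * hw'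

/-! ### Dependence of the displacement on the parameters -/

theorem one_sub_abs_le {e : ℝ} (θ : ℝ) : 1 - |e| ≤ 1 + e * cos θ := by
  have h1 : |e * cos θ| ≤ |e| := by
    rw [abs_mul]
    exact mul_le_of_le_one_right (abs_nonneg e) (abs_cos_le_one θ)
  linarith [(abs_le.1 h1).1]

theorem abs_hillq_sub_le {b e b' e' : ℝ} (he : |e| < 1) (he' : |e'| < 1) (θ : ℝ) :
    |hillq b e θ - hillq b' e' θ| ≤ (|b - b'| + |b * e' - b' * e|) / ((1 - |e|) * (1 - |e'|)) := by
  have h1 := one_add_mul_cos_pos he θ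
  have h2 := one_add_mul_cos_pos he' θ
  have e1 : hillq b e θ - hillq b' e' θ =
      ((b - b') + (b * e' - b' * e) * cos θ) / ((1 + e * cos θ) * (1 + e' * cos θ)) := by
    have k1 : b / (1 + e * cos θ) * (1 + e * cos θ) = b := div_mul_cancel₀ _ h1.ne'
    have k2 : b' / (1 + e' * cos θ) * (1 + e' * cos θ) = b' := div_mul_cancel₀ _ h2.ne'
    unfold hillq
    rw [eq_div_iff (mul_pos h1 h2).ne']
    linear_combination (1 + e' * cos θ) * k1 - (1 + e * cos θ) * k2
  have h3 : |(b * e' - b' * e) * cos θ| ≤ |b * e' - b' * e| := by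
    rw [abs_mul]
    exact mul_le_of_le_one_right (abs_nonneg _) (abs_cos_le_one θ)
  have h4 : 0 < 1 - |e| := by linarith
  have h5 : 0 < 1 - |e'| := by linarith
  rw [e1, abs_div, abs_of_pos (mul_pos h1 h2)]
  refine div_le_div₀ (by positivity) ((abs_add_le _ _).trans (by gcongr)) (by positivity) ?_
  exact mul_le_mul (one_sub_abs_le θ) (one_sub_abs_le θ) h5.le h1.le

theorem continuous_gronwallBound (K x : ℝ) :
    Continuous fun p : ℝ × ℝ => gronwallBound p.1 K p.2 x := by
  rcases eq_or_ne K 0 with hK | hK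
  · simp only [hK, gronwallBound_K0]; fun_prop
  · simp only [gronwallBound_of_K_ne_0 hK]; fun_prop

/-- The displacement is jointly continuous in the parameters and the angle. -/
theorem continuous_hill_ret : Continuous fun p : {p : ℝ × ℝ // |p.2| < 1} × ℝ =>
    (hill p.1.1.1 p.1.1.2 p.1.2).ret p.2 := by
  refine continuous_iff_continuousAt.2 fun ⟨⟨⟨b, e⟩, he⟩, x⟩ => ?_
  obtain ⟨C, hC⟩ := (hill b e he).exists_bound
  simp only at he
  set ε : {p : ℝ × ℝ // |p.2| < 1} × ℝ → ℝ := fun p =>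
    (|b - p.1.1.1| + |b * p.1.1.2 - p.1.1.1 * e|) / ((1 - |e|) * (1 - |p.1.1.2|)) with hε
  have key : ∀ p : {p : ℝ × ℝ // |p.2| < 1} × ℝ,
      dist ((hill p.1.1.1 p.1.1.2 p.1.2).ret p.2) ((hill b e he).ret x) ≤
      gronwallBound |x - p.2| (C + 1) (ε p) (2 * π) := by
    intro p
    have := ((hill p.1.1.1 p.1.1.2 p.1.2).isPrufer_angle p.2).abs_sub_le
      ((hill b e he).isPrufer_angle x) hC (ε := ε p)
      (fun θ => abs_hillq_sub_le he p.1.2 θ) two_pi_pos.le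
    rw [dist_comm, Real.dist_eq]
    simpa [Potential.ret] using this
  refine tendsto_iff_dist_tendsto_zero.2 (squeeze_zero (fun _ => dist_nonneg) key ?_)
  have hεc : ContinuousAt ε ⟨⟨⟨b, e⟩, he⟩, x⟩ := by
    have h1 : (1 - |e|) * (1 - |e|) ≠ 0 := by
      have : 0 < 1 - |e| := by linarith
      positivity
    refine ContinuousAt.div ?_ ?_ h1 <;> refine Continuous.continuousAt ?_ <;> fun_prop
  have h1 : Tendsto (fun p : {p : ℝ × ℝ // |p.2| < 1} × ℝ => (|x - p.2|, ε p))
      (𝓝 ⟨⟨⟨b, e⟩, he⟩, x⟩) (𝓝 (|x - x|, ε ⟨⟨⟨b, e⟩, he⟩, x⟩)) := by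
    refine Tendsto.prodMk_nhds ?_ hεc
    exact Continuous.tendsto (f := fun p : {p : ℝ × ℝ // |p.2| < 1} × ℝ => |x - p.2|)
      (by fun_prop) ⟨⟨⟨b, e⟩, he⟩, x⟩
  have h2 := ((continuous_gronwallBound (C + 1) (2 * π)).tendsto _).comp h1
  have h3 : ε ⟨⟨⟨b, e⟩, he⟩, x⟩ = 0 := by simp [hε]
  rw [h3] at h2
  simpa [gronwallBound_ε0, Function.comp_def] using h2

theorem continuous_hill_ret_fst {e : ℝ} (he : |e| < 1) :
    Continuous fun p : ℝ × ℝ => (hill p.1 e he).ret p.2 :=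
  continuous_hill_ret.comp (f := fun p : ℝ × ℝ => ((⟨⟨p.1, e⟩, he⟩ : {p : ℝ × ℝ // |p.2| < 1}), p.2))
    (by fun_prop)

theorem continuous_hill_ret_iterate {e : ℝ} (he : |e| < 1) (n : ℕ) :
    Continuous fun p : ℝ × ℝ => (hill p.1 e he).ret^[n] p.2 := by
  induction n with
  | zero => exact continuous_snd
  | succ n ih =>
    simp only [Function.iterate_succ_apply']
    exact (continuous_hill_ret_fst he).comp (continuous_fst.prodMk ih)

theorem hill_ret_lt {e b b' : ℝ} (he : |e| < 1) (hb : b < b') (x : ℝ) :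
    (hill b e he).ret x < (hill b' e he).ret x := by
  refine ((hill b e he).isPrufer_angle x).lt_of_potential_lt (hill b' e he).continuous
    ((hill b' e he).isPrufer_angle x) (fun θ => ?_) two_pi_pos (by simp)
  have := one_add_mul_cos_pos he θ
  simp only [hill, hillq]
  gcongr

/-- For `b = 0` the equation is `u'' + u = 0` and the angle has unit speed. This is the starting
point of the deformation in `b`. -/
theorem hill_zero_ret {e : ℝ} (he : |e| < 1) (x : ℝ) : (hill 0 e he).ret x = x + π * 2 := by
  have h : IsPrufer (hill 0 e he).q fun θ => x + θ := by
    intro θ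
    simp only [hill, hillq, zero_div, add_zero, one_mul, cos_sq_add_sin_sq]
    exact (hasDerivAt_id θ).const_add x
  have := congrFun h.eq_angle (2 * π)
  simp only [add_zero] at this
  rw [Potential.ret, ← this]; ring

theorem lt_hill_ret {e b : ℝ} (he : |e| < 1) (hb : 0 < b) (x : ℝ) :
    x + π * 2 < (hill b e he).ret x := by
  rw [← hill_zero_ret he]; exact hill_ret_lt he hb x

/-- The first parameter at which a monotone family of degree one displacements reaches `c`. -/
theorem exists_first_touch {G : ℝ → ℝ → ℝ} (hG : Continuous fun p : ℝ × ℝ => G p.1 p.2)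
    (hper : ∀ b x, G b (x + π) = G b x + π) {a b c : ℝ} (hab : a ≤ b) (ha : ∀ x, G a x < x + c)
    (hb : ∃ x, x + c ≤ G b x) :
    ∃ b₁ ∈ Ioc a b, (∀ x, G b₁ x ≤ x + c) ∧ ∃ x, G b₁ x = x + c := by
  have hp : ∀ b, Function.Periodic (fun x => G b x - x) π := fun b x => by
    simp only [hper]; ring
  -- Periodicity in `x` confines the angles to `[0, π]`, so this set is compact and contains a
  -- smallest parameter. The inequality for all `x` at that parameter is a limit from the left.
  set S : Set (ℝ × ℝ) := (Icc a b ×ˢ Icc 0 π) ∩ {p | p.2 + c ≤ G p.1 p.2} with hS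
  have hScomp : IsCompact S := (isCompact_Icc.prod isCompact_Icc).inter_right
    (isClosed_le (by fun_prop) hG)
  have hred : ∀ b x, x + c ≤ G b x → ∃ y ∈ Icc 0 π, y + c ≤ G b y := by
    intro b x h
    obtain ⟨y, hy, hxy⟩ := (hp b).exists_mem_Ico₀ pi_pos x
    exact ⟨y, Ico_subset_Icc_self hy, by linarith⟩
  have hSne : S.Nonempty := by
    obtain ⟨x, hx⟩ := hb
    obtain ⟨y, hy, h⟩ := hred b x hx
    exact ⟨(b, y), ⟨⟨hab, le_rfl⟩, hy⟩, h⟩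
  obtain ⟨⟨b₁, x₁⟩, hmem, hmin⟩ := hScomp.exists_isMinOn hSne continuous_fst.continuousOn
  obtain ⟨⟨hb₁, hx₁⟩, hle⟩ := hmem
  simp only [mem_ofPred_eq] at hle hb₁
  have hab₁ : a < b₁ := by
    refine lt_of_le_of_ne hb₁.1 fun h => ?_
    subst h
    exact absurd (ha x₁) (not_lt.2 hle)
  have hlt : ∀ x, ∀ t ∈ Ioo a b₁, G t x < x + c := by
    intro x t ht
    by_contra hcon
    obtain ⟨y, hy, h⟩ := hred t x (not_lt.1 hcon)
    have := hmin (show (t, y) ∈ S from ⟨⟨⟨ht.1.le, ht.2.le.trans hb₁.2⟩, hy⟩, h⟩)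
    simp only [mem_ofPred_eq] at this
    exact absurd ht.2 (not_lt.2 this)
  have hle' : ∀ x, G b₁ x ≤ x + c := by
    intro x
    have hc : Continuous fun t => G t x := hG.comp (by fun_prop : Continuous fun t : ℝ => (t, x))
    refine le_of_tendsto ((hc.tendsto b₁).mono_left nhdsWithin_le_nhds : Tendsto _ (𝓝[<] b₁) _) ?_
    filter_upwards [Ioo_mem_nhdsLT hab₁] with t ht using (hlt x t ht).le
  exact ⟨b₁, ⟨hab₁, hb₁.2⟩, hle', x₁, le_antisymm (hle' x₁) hle⟩

/-- At the first touch of `πj` the matrix has the eigenvalue `1`, so by coexistence it is the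
identity and every angle is displaced by exactly `πj`. For larger parameters every displacement is
strictly larger, so `b` itself is the parameter of first touch. -/
theorem hill_mono_eq_one_of_even {e b : ℝ} (he : |e| < 1) (hb : 0 < b) {x : ℝ} {j : ℤ}
    (hj : Even j) (h : (hill b e he).ret x = x + π * j) : (hill b e he).mono = 1 := by
  -- For `b > 0` the displacement exceeds `2π`, so `πj` lies strictly above the displacement `2π` at
  -- parameter `0`.
  have h2 : (2 : ℝ) < j := by
    have := lt_hill_ret he hb x
    rw [h] at this
    have := pi_pos
    nlinarith
  obtain ⟨b₁, hb₁, hle, x₁, hx₁⟩ := exists_first_touch (continuous_hill_ret_fst he)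
    (fun b x => (hill b e he).ret_add_pi x) hb.le (c := π * j)
    (fun x => by rw [hill_zero_ret]; have := pi_pos; nlinarith) ⟨x, h.ge⟩
  have hfix := (hill b₁ e he).exists_mono_mulVec_eq hx₁ hle
  rw [hj.neg_one_zpow, one_smul] at hfix
  have hone : (hill b₁ e he).mono = 1 := by
    refine hill_mono_eq_one hb₁.1 he ?_ hfix
    rintro ⟨h1, h2⟩
    have := sin_sq_add_cos_sq x₁
    rw [h1, h2] at this; norm_num at this
  rcases hb₁.2.lt_or_eq with hlt | rfl
  · have h3 := (hill b₁ e he).ret_eq_of_mono_eq hx₁ (l := 1) (by rw [hone, one_smul]) x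
    have h4 := hill_ret_lt he hlt x
    linarith
  · exact hone

/-- The hyperbolic monodromy matrices have negative eigenvalues. -/
theorem hill_trace_of_four_lt {e b : ℝ} (he : |e| < 1) (hb : 0 < b)
    (h : 4 < (hill b e he).mono.trace ^ 2) :
    (∃ j : ℤ, Odd j ∧ (hill b e he).rot = j) ∧ (hill b e he).mono.trace < -2 := by
  obtain ⟨x, j, hx⟩ := (hill b e he).exists_ret_eq h.le
  rcases Int.even_or_odd j with hj | hj
  · rw [hill_mono_eq_one_of_even he hb hj hx] at h
    norm_num [Matrix.trace_fin_two] at h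
  · refine ⟨⟨j, hj, (hill b e he).rot_eq_of_ret_eq hx⟩, ?_⟩
    have ht := (hill b e he).trace_of_ret_eq hx
    rw [hj.neg_one_zpow] at ht
    have hp := (hill b e he).amp_pos x (2 * π)
    have : (hill b e he).mono.trace < 0 := by
      rw [ht]
      have := inv_pos.2 hp
      linarith
    nlinarith

/-- Between a parameter with rotation less than the odd integer `j` and one where the rotation
reaches `j`, there are hyperbolic parameters. -/
theorem exists_displacement_both_signs {e a b b' : ℝ} (he : |e| < 1) (he0 : e ≠ 0) {j : ℤ}
    (hj : Odd j) (hab : a ≤ b) (hbb' : b < b')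
    (ha : ∀ x, (hill a e he).ret x < x + π * j) (hb : ∃ x, x + π * j ≤ (hill b e he).ret x) :
    ∃ c ∈ Ioo a b', (∃ x, (hill c e he).ret x < x + π * j) ∧
      ∃ x, x + π * j < (hill c e he).ret x := by
  obtain ⟨b₁, hb₁, hle, x₁, hx₁⟩ := exists_first_touch (continuous_hill_ret_fst he)
    (fun b x => (hill b e he).ret_add_pi x) hab (c := π * j) ha hb
  -- A displacement constantly equal to `πj` with `j` odd would make the monodromy matrix `-1`.
  have hy : ∃ y, (hill b₁ e he).ret y < y + π * j := by
    by_contra hcon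
    push Not at hcon
    have heq : ∀ y, (hill b₁ e he).ret y = y + π * j := fun y => le_antisymm (hle y) (hcon y)
    refine hill_mono_ne_neg_one he he0 (b := b₁) ?_
    have e1 := (hill b₁ e he).exists_mono_mulVec_eq (heq 0) hle
    have e2 := (hill b₁ e he).exists_mono_mulVec_eq (heq (π / 2)) hle
    rw [hj.neg_one_zpow] at e1 e2
    have e10 := congrFun e1 0
    have e11 := congrFun e1 1
    have e20 := congrFun e2 0
    have e21 := congrFun e2 1
    simp [Matrix.mulVec, dotProduct, Fin.sum_univ_two] at e10 e11 e20 e21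
    ext i k
    fin_cases i <;> fin_cases k <;> simp [e10, e11, e20, e21]
  obtain ⟨y, hy⟩ := hy
  have hc : Continuous fun t => (hill t e he).ret y :=
    (continuous_hill_ret_fst he).comp (by fun_prop : Continuous fun t : ℝ => (t, y))
  have hev : ∀ᶠ t in 𝓝[>] b₁, (hill t e he).ret y < y + π * j :=
    (hc.tendsto b₁).eventually_lt_const hy |>.filter_mono nhdsWithin_le_nhds
  obtain ⟨t, ht, ht'⟩ := (hev.and (Ioo_mem_nhdsGT (hb₁.2.trans_lt hbb'))).exists
  -- Just after the first touch, `y` is still below by continuity, while `x₁` is above by strict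
  -- monotonicity in the parameter.
  refine ⟨t, ⟨hb₁.1.trans ht'.1, ht'.2⟩, ⟨y, ht⟩, x₁, ?_⟩
  rw [← hx₁]
  exact hill_ret_lt he ht'.1 x₁

/-! ### Action of triangular matrices on angles -/

theorem eq_of_forall_exists_int {f : ℝ → ℝ} (hf : Continuous f) {c : ℝ} (hc : c ≠ 0)
    (h : ∀ x, ∃ n : ℤ, f x = n * c) (x y : ℝ) : f x = f y := by
  choose n hn using h
  have hcont : Continuous n := by
    rw [Int.isClosedEmbedding_coe_real.isEmbedding.continuous_iff]
    have : ((↑) : ℤ → ℝ) ∘ n = fun x => f x / c := by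
      funext x; simp only [Function.comp, hn]; field_simp
    rw [this]; exact hf.div_const c
  rw [hn x, hn y, PreconnectedSpace.constant inferInstance hcont]

theorem eq_of_cexp_eq {f : ℝ → ℝ} (hf : Continuous f)
    (h : ∀ x y, Complex.exp (f x * Complex.I) = Complex.exp (f y * Complex.I)) (x y : ℝ) :
    f x = f y := by
  have := eq_of_forall_exists_int (f := fun x => f x - f 0) (by fun_prop) two_pi_pos.ne'
    (fun x => ?_) x y
  · linarith
  · obtain ⟨n, hn⟩ := Complex.exp_eq_exp_iff_exists_int.1 (h x 0)
    refine ⟨n, ?_⟩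
    have h2 : ((f x : ℂ) - f 0) * Complex.I = (n * (2 * π)) * Complex.I := by
      linear_combination hn
    have h3 := mul_right_cancel₀ Complex.I_ne_zero h2
    exact_mod_cast h3

/-- The vector `(a cos x + b sin x, d sin x)` as a complex number, rotated by `-x`. -/
noncomputable def triVec (a b d x : ℝ) : ℂ :=
  ((a * cos x + b * sin x : ℝ) + (d * sin x : ℝ) * Complex.I) * Complex.exp (-(x * Complex.I))

/-- An upper triangular matrix with positive diagonal preserves the rays of the first axis and both
open half planes. So it never sends a vector to a negative multiple of itself, and the angle by
which it turns vectors has a continuous branch in `(-π, π)`. -/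
theorem triVec_mem_slitPlane {a d : ℝ} (ha : 0 < a) (hd : 0 < d) (b x : ℝ) :
    triVec a b d x ∈ Complex.slitPlane := by
  have he : triVec a b d x = ((a * cos x + b * sin x) * cos x + d * sin x * sin x : ℝ) +
      (d * sin x * cos x - (a * cos x + b * sin x) * sin x : ℝ) * Complex.I := by
    have : -((x : ℂ) * Complex.I) = ((-x : ℝ) : ℂ) * Complex.I := by push_cast; ring
    rw [triVec, this, Complex.exp_mul_I, ← Complex.ofReal_cos, ← Complex.ofReal_sin, cos_neg,
      sin_neg]
    push_cast
    linear_combination (-(d * Complex.sin x * Complex.sin x)) * Complex.I_sq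
  rw [he, Complex.mem_slitPlane_iff]
  have hre : ∀ r s : ℝ, ((r : ℂ) + s * Complex.I).re = r := fun r s => by simp
  have him : ∀ r s : ℝ, ((r : ℂ) + s * Complex.I).im = s := fun r s => by simp
  rw [hre, him]
  have h1 := sin_sq_add_cos_sq x
  by_cases h : d * sin x * cos x - (a * cos x + b * sin x) * sin x = 0
  · left
    rcases eq_or_ne (sin x) 0 with hs | hs
    · rw [hs] at h1 ⊢
      nlinarith
    · have h2 : d * cos x - (a * cos x + b * sin x) = 0 := by
        refine (mul_eq_zero.1 (?_ : _ * sin x = 0)).resolve_right hs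
        linear_combination h
      have h3 : a * cos x + b * sin x = d * cos x := by linarith
      rw [h3]
      nlinarith
  · exact Or.inr h

/-- The continuous argument of `(a cos x + b sin x, d sin x)`, that is, the action of the matrix
`[[a, b], [0, d]]` on angles. -/
noncomputable def triAngle (a b d x : ℝ) : ℝ := x + (triVec a b d x).arg

theorem triAngle_continuous_comp {a b d x : ℝ → ℝ} (ha : Continuous a) (hb : Continuous b)
    (hd : Continuous d) (hx : Continuous x) (ha0 : ∀ t, 0 < a t) (hd0 : ∀ t, 0 < d t) :
    Continuous fun t => triAngle (a t) (b t) (d t) (x t) := by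
  unfold triAngle
  refine hx.add (continuous_iff_continuousAt.2 fun t => ?_)
  have h1 : Continuous fun t => triVec (a t) (b t) (d t) (x t) := by
    unfold triVec; fun_prop
  exact ContinuousAt.comp (g := Complex.arg) (x := t)
    (Complex.continuousAt_arg (triVec_mem_slitPlane (ha0 t) (hd0 t) _ _)) h1.continuousAt

theorem abs_triAngle_sub_le (a b d x : ℝ) : |triAngle a b d x - x| ≤ π := by
  rw [triAngle, add_sub_cancel_left]
  exact Complex.abs_arg_le_pi _

theorem norm_triVec_mul_cexp (a b d x : ℝ) :
    (‖triVec a b d x‖ : ℂ) * Complex.exp (triAngle a b d x * Complex.I) =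
      ((a * cos x + b * sin x : ℝ) : ℂ) + (d * sin x : ℝ) * Complex.I := by
  have h := Complex.norm_mul_exp_arg_mul_I (triVec a b d x)
  rw [triAngle]
  push_cast
  rw [add_mul, Complex.exp_add, mul_left_comm, h, triVec, mul_left_comm, ← Complex.exp_add]
  push_cast
  simp

theorem norm_triVec_mul_cos (a b d x : ℝ) :
    ‖triVec a b d x‖ * cos (triAngle a b d x) = a * cos x + b * sin x ∧
      ‖triVec a b d x‖ * sin (triAngle a b d x) = d * sin x := by
  have h := norm_triVec_mul_cexp a b d x
  rw [Complex.exp_mul_I, ← Complex.ofReal_cos, ← Complex.ofReal_sin] at h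
  have h1 := congrArg Complex.re h
  have h2 := congrArg Complex.im h
  simp only [Complex.mul_re, Complex.mul_im, Complex.add_re, Complex.add_im, Complex.ofReal_re,
    Complex.ofReal_im, Complex.I_re, Complex.I_im] at h1 h2
  constructor <;> linarith

theorem norm_triVec_pos {a d : ℝ} (ha : 0 < a) (hd : 0 < d) (b x : ℝ) : 0 < ‖triVec a b d x‖ :=
  norm_pos_iff.2 (Complex.slitPlane_ne_zero (triVec_mem_slitPlane ha hd b x))

theorem triVec_add_pi (a b d x : ℝ) : triVec a b d (x + π) = triVec a b d x := by
  unfold triVec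
  have : -(((x + π : ℝ) : ℂ) * Complex.I) = -(x * Complex.I) - π * Complex.I := by push_cast; ring
  rw [this, Complex.exp_sub, Complex.exp_pi_mul_I, cos_add_pi, sin_add_pi]
  push_cast; ring

theorem triAngle_add_pi (a b d x : ℝ) : triAngle a b d (x + π) = triAngle a b d x + π := by
  unfold triAngle
  rw [triVec_add_pi]; ring

/-- Invertibility of the matrix and equivariance under `x ↦ x + π` give injectivity. A continuous
injective map is strictly monotone, and equivariance excludes decrease. -/
theorem triAngle_strictMono {a d : ℝ} (ha : 0 < a) (hd : 0 < d) (b : ℝ) :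
    StrictMono (triAngle a b d) := by
  have hc : Continuous (triAngle a b d) :=
    triAngle_continuous_comp continuous_const continuous_const continuous_const continuous_id
      (fun _ => ha) fun _ => hd
  have hinj : Function.Injective (triAngle a b d) := by
    intro x y hxy
    obtain ⟨x1, x2⟩ := norm_triVec_mul_cos a b d x
    obtain ⟨y1, y2⟩ := norm_triVec_mul_cos a b d y
    rw [hxy] at x1 x2
    have px := norm_triVec_pos ha hd b x
    have py := norm_triVec_pos ha hd b y
    set r := ‖triVec a b d x‖
    set s := ‖triVec a b d y‖
    have hs : sin x * s = sin y * r := by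
      refine mul_left_cancel₀ hd.ne' ?_
      linear_combination r * y2 - s * x2
    have hco : cos x * s = cos y * r := by
      refine mul_left_cancel₀ ha.ne' ?_
      linear_combination r * y1 - s * x1 - b * hs
    have hrs : r = s := by
      have h1 := sin_sq_add_cos_sq x
      have h2 := sin_sq_add_cos_sq y
      have h3 : s ^ 2 = r ^ 2 := by
        calc s ^ 2 = (sin x * s) ^ 2 + (cos x * s) ^ 2 := by linear_combination (-s ^ 2) * h1
          _ = r ^ 2 := by rw [hs, hco]; linear_combination r ^ 2 * h2
      exact ((sq_eq_sq₀ py.le px.le).1 h3).symm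
    rw [hrs] at hs hco
    have hs' := mul_right_cancel₀ py.ne' hs
    have hc' := mul_right_cancel₀ py.ne' hco
    have h4 : Complex.exp (x * Complex.I) = Complex.exp (y * Complex.I) := by
      rw [Complex.exp_mul_I, Complex.exp_mul_I, ← Complex.ofReal_cos, ← Complex.ofReal_cos,
        ← Complex.ofReal_sin, ← Complex.ofReal_sin, hs', hc']
    obtain ⟨n, hn⟩ := Complex.exp_eq_exp_iff_exists_int.1 h4
    have h5 : x = y + (2 * n : ℤ) * π := by
      have h2 : (x : ℂ) * Complex.I = (y + (2 * n) * π) * Complex.I := by linear_combination hn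
      have h3 := mul_right_cancel₀ Complex.I_ne_zero h2
      have h6 : x = y + (2 * n) * π := by exact_mod_cast h3
      rw [h6]; push_cast; ring
    have hper : Function.Periodic (fun x => triAngle a b d x - x) π := fun x => by
      simp only [triAngle_add_pi]; ring
    have h6 : triAngle a b d (y + (2 * n : ℤ) * π) - (y + (2 * n : ℤ) * π) = triAngle a b d y - y :=
      hper.int_mul (2 * n) y
    rw [← h5, hxy] at h6
    linarith
  refine (hc.strictMono_of_inj hinj).resolve_right fun hanti => ?_
  have h1 := hanti pi_pos
  have h2 := triAngle_add_pi a b d 0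
  rw [zero_add] at h2
  have := pi_pos
  linarith

/-! ### Strict monotonicity of the rotation number -/

theorem Potential.tendsto_ret_iterate (Q : Potential) (x : ℝ) :
    Tendsto (fun n : ℕ => Q.ret^[n] x / n) atTop (𝓝 (π * Q.rot)) := by
  obtain ⟨B, hB⟩ := Q.abs_angle_sub_le x
  have h1 : ∀ n : ℕ, |Q.ret^[n] x - n * (π * Q.rot)| ≤ B := by
    intro n
    have := hB (n * (2 * π)) (by positivity)
    have h2 := Q.angle_nat_mul_period x n 0
    rw [zero_add, Potential.angle_zero] at h2
    rw [h2] at this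
    convert this using 2
    ring
  have h3 : Tendsto (fun n : ℕ => B * (1 / (n : ℝ))) atTop (𝓝 0) := by
    simpa using tendsto_one_div_atTop_nhds_zero_nat.const_mul B
  rw [tendsto_iff_dist_tendsto_zero]
  refine squeeze_zero' (Eventually.of_forall fun _ => dist_nonneg) ?_ h3
  filter_upwards [eventually_ge_atTop 1] with n hn
  have hn' : (0 : ℝ) < n := by exact_mod_cast hn
  rw [Real.dist_eq, mul_one_div, le_div_iff₀ hn']
  refine le_trans (le_of_eq ?_) (h1 n)
  rw [← abs_of_pos hn', ← abs_mul, abs_of_pos hn']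
  congr 1
  field_simp

/-- If the monodromy matrix is elliptic, then the displacement of angles is conjugate to a
translation. -/
theorem Potential.exists_conj_translation (Q : Potential) (h : Q.mono.trace ^ 2 < 4) :
    ∃ b d α : ℝ, 0 < d ∧ ∀ x, triAngle 1 b d (Q.ret x) = triAngle 1 b d x + α := by
  have hdet := Q.det_mono
  rw [Matrix.det_fin_two] at hdet
  rw [Matrix.trace_fin_two] at h
  set a₁ := Q.mono 0 0
  set a₂ := Q.mono 0 1
  set a₃ := Q.mono 1 0
  set a₄ := Q.mono 1 1
  -- If `a₃ = 0` the eigenvalues are real with product `1`, which forces `trace² ≥ 4`.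
  have h3 : a₃ ≠ 0 := by
    intro h0
    rw [h0] at hdet
    nlinarith [sq_nonneg (a₁ - a₄)]
  set D := √(4 - (a₁ + a₄) ^ 2) with hD
  have hD2 : D ^ 2 = 4 - (a₁ + a₄) ^ 2 := sq_sqrt (by linarith)
  have hD0 : 0 < D := sqrt_pos.2 (by linarith)
  set b := (a₄ - a₁) / (2 * a₃) with hb
  set d := D / (2 * |a₃|) with hd
  have hd0 : 0 < d := by positivity
  have hd2 : d ^ 2 = D ^ 2 / (4 * a₃ ^ 2) := by
    rw [hd, div_pow, mul_pow, sq_abs]; norm_num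
  -- The row `(1, m)` is a left eigenvector of the monodromy matrix, with eigenvalue `l = a₁ + m
  -- a₃`. The triangular matrix `[[1, b], [0, d]]` realizes `v ↦ v₀ + m v₁`, so it conjugates the
  -- monodromy to multiplication by `l`; the absolute value in `d` puts `m` in the upper half plane.
  set m : ℂ := b + d * Complex.I with hm
  have hroot : (a₃ : ℂ) * m ^ 2 + (a₁ - a₄) * m - a₂ = 0 := by
    have r1 : a₃ * (b ^ 2 - d ^ 2) + (a₁ - a₄) * b - a₂ = 0 := by
      rw [hd2, hD2, hb]
      field_simp
      linear_combination 16 * hdet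
    have r2 : 2 * a₃ * b + (a₁ - a₄) = 0 := by
      rw [hb]; field_simp; ring
    have r1' : (a₃ : ℂ) * (b ^ 2 - d ^ 2) + (a₁ - a₄) * b - a₂ = 0 := by exact_mod_cast r1
    have r2' : 2 * (a₃ : ℂ) * b + (a₁ - a₄) = 0 := by exact_mod_cast r2
    rw [hm]
    linear_combination r1' + d * Complex.I * r2' + (a₃ * d ^ 2) * Complex.I_sq
  set l : ℂ := a₁ + m * a₃ with hl
  have hl0 : l ≠ 0 := by
    intro h0
    have := congrArg Complex.im h0
    simp [hl, hm] at this
    rcases this with h | h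
    · exact hd0.ne' h
    · exact h3 h
  have hvec : ∀ x, ((1 * cos x + b * sin x : ℝ) : ℂ) + (d * sin x : ℝ) * Complex.I =
      cos x + m * sin x := by
    intro x; rw [hm]; push_cast; ring
  have key : ∀ x, Complex.exp ((triAngle 1 b d (Q.ret x) - triAngle 1 b d x : ℝ) * Complex.I) =
      l / ‖l‖ := by
    intro x
    have e1 := norm_triVec_mul_cexp 1 b d (Q.ret x)
    have e2 := norm_triVec_mul_cexp 1 b d x
    rw [hvec] at e1 e2
    have hA := Q.mono_mulVec_angle x
    have hA0 := congrFun hA 0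
    have hA1 := congrFun hA 1
    simp [Matrix.mulVec, dotProduct, Fin.sum_univ_two] at hA0 hA1
    change a₁ * cos x + a₂ * sin x = _ at hA0
    change a₃ * cos x + a₄ * sin x = _ at hA1
    have hA0' : (a₁ : ℂ) * cos x + a₂ * sin x = Q.amp x (2 * π) * cos (Q.ret x) := by
      exact_mod_cast hA0
    have hA1' : (a₃ : ℂ) * cos x + a₄ * sin x = Q.amp x (2 * π) * sin (Q.ret x) := by
      exact_mod_cast hA1
    have e3 : (Q.amp x (2 * π) : ℂ) * (‖triVec 1 b d (Q.ret x)‖ *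
        Complex.exp (triAngle 1 b d (Q.ret x) * Complex.I)) =
        l * (‖triVec 1 b d x‖ * Complex.exp (triAngle 1 b d x * Complex.I)) := by
      rw [e1, e2]
      linear_combination (-1) * hA0' - m * hA1' - (sin x : ℂ) * hroot
    have p1 : ‖triVec 1 b d (Q.ret x)‖ ≠ 0 := (norm_triVec_pos one_pos hd0 _ _).ne'
    have p2 : ‖triVec 1 b d x‖ ≠ 0 := (norm_triVec_pos one_pos hd0 _ _).ne'
    have hn := congrArg norm e3
    simp only [norm_mul, Complex.norm_real, norm_norm, Complex.norm_exp_ofReal_mul_I,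
      mul_one] at hn
    rw [norm_of_nonneg (Q.amp_pos _ _).le] at hn
    have hn' : (Q.amp x (2 * π) : ℂ) * ‖triVec 1 b d (Q.ret x)‖ = ‖l‖ * ‖triVec 1 b d x‖ := by
      exact_mod_cast hn
    have p2' : (‖triVec 1 b d x‖ : ℂ) ≠ 0 := by exact_mod_cast p2
    have pl : (‖l‖ : ℂ) ≠ 0 := by exact_mod_cast (norm_ne_zero_iff.2 hl0)
    push_cast
    rw [sub_mul, Complex.exp_sub, div_eq_div_iff (Complex.exp_ne_zero _) pl]
    refine mul_right_cancel₀ p2' ?_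
    linear_combination e3 - Complex.exp (triAngle 1 b d (Q.ret x) * Complex.I) * hn'
  have hcont : Continuous (triAngle 1 b d) :=
    triAngle_continuous_comp continuous_const continuous_const continuous_const continuous_id
      (fun _ => one_pos) fun _ => hd0
  refine ⟨b, d, triAngle 1 b d (Q.ret 0) - triAngle 1 b d 0, hd0, fun x => ?_⟩
  have := eq_of_cexp_eq (f := fun x => triAngle 1 b d (Q.ret x) - triAngle 1 b d x)
    ((hcont.comp Q.ret_continuous).sub hcont) (fun x y => by rw [key, key]) x 0
  linarith

/-- In the coordinate of `exists_conj_translation` the smaller map is a translation by `α`. By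
compactness modulo `π` the larger map moves every point by at least some `α' > α`, and this uniform
excess survives in the mean. -/
theorem Potential.rot_lt_of_elliptic {Q Q' : Potential} (h : Q.mono.trace ^ 2 < 4)
    (hlt : ∀ x, Q.ret x < Q'.ret x) : Q.rot < Q'.rot := by
  obtain ⟨b, d, α, hd, hα⟩ := Q.exists_conj_translation h
  set ψ := triAngle 1 b d with hψ
  have hcont : Continuous ψ :=
    triAngle_continuous_comp continuous_const continuous_const continuous_const continuous_id
      (fun _ => one_pos) fun _ => hd
  have hmono : StrictMono ψ := triAngle_strictMono one_pos hd b
  have hc' : Continuous fun x => ψ (Q'.ret x) - ψ x := (hcont.comp Q'.ret_continuous).sub hcont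
  have hper : Function.Periodic (fun x => ψ (Q'.ret x) - ψ x) π := fun x => by
    simp only [Potential.ret_add_pi, hψ, triAngle_add_pi]; ring
  obtain ⟨x₀, -, hx₀⟩ := isCompact_Icc.exists_isMinOn (nonempty_Icc.2 pi_pos.le) hc'.continuousOn
  set α' := ψ (Q'.ret x₀) - ψ x₀ with hα'
  have hlt' : α < α' := by
    have h1 := hmono (hlt x₀)
    have h2 := hα x₀
    rw [h2] at h1
    linarith
  have hge : ∀ x, ψ x + α' ≤ ψ (Q'.ret x) := by
    intro x
    obtain ⟨y, hy, hxy⟩ := hper.exists_mem_Ico₀ pi_pos x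
    have := hx₀ (Ico_subset_Icc_self hy)
    simp only [mem_ofPred_eq] at this
    linarith
  have it0 : ∀ n : ℕ, ψ (Q.ret^[n] 0) = ψ 0 + n * α := by
    intro n
    induction n with
    | zero => simp
    | succ n ih => rw [Function.iterate_succ_apply', hα, ih]; push_cast; ring
  have it1 : ∀ n : ℕ, ψ 0 + n * α' ≤ ψ (Q'.ret^[n] 0) := by
    intro n
    induction n with
    | zero => simp
    | succ n ih =>
      rw [Function.iterate_succ_apply']
      refine le_trans ?_ (hge _)
      push_cast; linarith
  have lim : ∀ P : Potential, Tendsto (fun n : ℕ => (ψ (P.ret^[n] 0) - ψ 0) / n) atTop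
      (𝓝 (π * P.rot)) := by
    intro P
    have h1 := P.tendsto_ret_iterate 0
    have h3 : Tendsto (fun n : ℕ => (π + |ψ 0|) * (1 / (n : ℝ))) atTop (𝓝 0) := by
      simpa using tendsto_one_div_atTop_nhds_zero_nat.const_mul (π + |ψ 0|)
    have h2 : Tendsto (fun n : ℕ => (ψ (P.ret^[n] 0) - ψ 0 - P.ret^[n] 0) / n) atTop (𝓝 0) := by
      refine squeeze_zero_norm (fun n => ?_) h3
      rw [norm_div, norm_eq_abs, norm_of_nonneg (Nat.cast_nonneg n), mul_one_div]
      gcongr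
      have := abs_triAngle_sub_le 1 b d (P.ret^[n] 0)
      calc |ψ (P.ret^[n] 0) - ψ 0 - P.ret^[n] 0| = |(ψ (P.ret^[n] 0) - P.ret^[n] 0) - ψ 0| := by
            congr 1; ring
        _ ≤ _ := (abs_sub _ _).trans (by gcongr)
    have h4 := h1.add h2
    rw [add_zero] at h4
    refine h4.congr fun n => ?_
    ring
  have r0 : α = π * Q.rot := by
    refine tendsto_nhds_unique ?_ (lim Q)
    refine tendsto_const_nhds.congr' ?_
    filter_upwards [eventually_ge_atTop 1] with n hn
    have : (0 : ℝ) < n := by exact_mod_cast hn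
    rw [it0]; field_simp; ring
  have r1 : α' ≤ π * Q'.rot := by
    refine ge_of_tendsto (lim Q') ?_
    filter_upwards [eventually_ge_atTop 1] with n hn
    have : (0 : ℝ) < n := by exact_mod_cast hn
    rw [le_div_iff₀ this]
    linarith [it1 n]
  have := pi_pos
  nlinarith

theorem Potential.lt_rot_of_forall_lt {Q : Potential} {j : ℝ} (h : ∀ x, x + π * j < Q.ret x) :
    j < Q.rot := by
  refine Q.lift.lt_translationNumber_of_forall_add_lt Q.lift_continuous fun x => ?_
  have := Q.lt_ret_iff.1 (h (π * x))
  rwa [mul_div_cancel_left₀ _ pi_ne_zero] at this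

/-- The rotation number is strictly increasing, except at odd integer values. -/
theorem exists_odd_of_rot_eq {e b b' : ℝ} (he : |e| < 1) (hb : 0 < b) (hbb' : b < b')
    (h : (hill b e he).rot = (hill b' e he).rot) :
    ∃ j : ℤ, Odd j ∧ (hill b e he).rot = j := by
  rcases lt_or_ge ((hill b e he).mono.trace ^ 2) 4 with ht | ht
  · exact absurd h (Potential.rot_lt_of_elliptic ht (hill_ret_lt he hbb')).ne
  · obtain ⟨x, j, hx⟩ := (hill b e he).exists_ret_eq ht
    refine ⟨j, ?_, (hill b e he).rot_eq_of_ret_eq hx⟩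
    by_contra hj
    rw [Int.not_odd_iff_even] at hj
    -- For even `j` every displacement at `b` equals `πj`, so every displacement at `b'` is larger
    -- and the rotation number increases strictly.
    have hone := hill_mono_eq_one_of_even he hb hj hx
    have heq := (hill b e he).ret_eq_of_mono_eq hx (l := 1) (by rw [hone, one_smul])
    have h1 : (j : ℝ) < (hill b' e he).rot := Potential.lt_rot_of_forall_lt fun y => by
      rw [← heq y]; exact hill_ret_lt he hbb' y
    rw [← h, (hill b e he).rot_eq_of_ret_eq hx] at h1
    exact lt_irrefl _ h1

/-! ### Lower bounds of the displacement -/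

/-- Lower bound of the growth of a Prüfer angle by comparison with the angle of `(u', ω u)`. -/
theorem IsPrufer.le_sub {q φ ω ω' Λ Λ' : ℝ → ℝ} {a b : ℝ} (hφ : IsPrufer q φ) (hab : a ≤ b)
    (hω : ∀ θ ∈ Icc a b, 0 < ω θ) (hω' : ∀ θ ∈ Icc a b, HasDerivAt ω (ω' θ) θ)
    (hq : ∀ θ ∈ Icc a b, ω θ ^ 2 ≤ q θ) (hΛ : ∀ θ ∈ Icc a b, HasDerivAt Λ (Λ' θ) θ)
    (hle : ∀ θ ∈ Icc a b, Λ' θ ≤ ω θ - |ω' θ| / (2 * ω θ)) :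
    Λ b - Λ a - π ≤ φ b - φ a := by
  -- From `tan ψ = ω tan φ` one gets `tan (ψ - φ) = N / D`. Thus `φ + arctan (N / D)` is the angle
  -- of `(u', ω u)`, and the two arctangents at the ends cost at most `π`.
  set N : ℝ → ℝ := fun θ => (ω θ - 1) * (sin (φ θ) * cos (φ θ)) with hN
  set D : ℝ → ℝ := fun θ => 1 + (ω θ - 1) * sin (φ θ) ^ 2 with hD
  have hDpos : ∀ θ ∈ Icc a b, 0 < D θ := by
    intro θ hθ
    have h1 := hω θ hθ
    have h2 := sin_sq_le_one (φ θ)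
    have h3 := sq_nonneg (sin (φ θ))
    simp only [hD]
    rcases eq_or_ne (sin (φ θ) ^ 2) 0 with h | h
    · rw [h]; norm_num
    · have : 0 < sin (φ θ) ^ 2 := lt_of_le_of_ne h3 (Ne.symm h)
      nlinarith
  set X : ℝ → ℝ := fun θ => (ω θ * (cos (φ θ) ^ 2 + q θ * sin (φ θ) ^ 2) +
    ω' θ * (sin (φ θ) * cos (φ θ))) / (1 + (ω θ ^ 2 - 1) * sin (φ θ) ^ 2) with hX
  have hder : ∀ θ ∈ Icc a b, HasDerivAt (fun θ => φ θ + arctan (N θ / D θ)) (X θ) θ := by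
    intro θ hθ
    have hd := hDpos θ hθ
    have h1 := sin_sq_add_cos_sq (φ θ)
    have hs := (hφ θ).sin
    have hc := (hφ θ).cos
    have dN : HasDerivAt N _ θ := ((hω' θ hθ).sub_const 1).mul (hs.mul hc)
    have dD : HasDerivAt D _ θ := (((hω' θ hθ).sub_const 1).mul (hs.fun_pow 2)).const_add 1
    refine ((hφ θ).add ((dN.div dD hd.ne').arctan)).congr_deriv ?_
    have e1 : N θ ^ 2 + D θ ^ 2 = 1 + (ω θ ^ 2 - 1) * sin (φ θ) ^ 2 := by
      simp only [hN, hD]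
      linear_combination ((ω θ - 1) ^ 2 * sin (φ θ) ^ 2) * h1
    have e2 : 0 < N θ ^ 2 + D θ ^ 2 := by positivity
    have e3 : ∀ y, 1 / (1 + (N θ / D θ) ^ 2) * (y / D θ ^ 2) = y / (N θ ^ 2 + D θ ^ 2) := by
      intro y
      have : 1 + (N θ / D θ) ^ 2 = (N θ ^ 2 + D θ ^ 2) / D θ ^ 2 := by field_simp; ring
      rw [this]; field_simp
    simp only [hX]
    simp only [Pi.div_apply]
    rw [e3, ← e1, eq_div_iff e2.ne', add_mul, div_mul_cancel₀ _ e2.ne']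
    simp only [hN, hD]
    push_cast
    linear_combination ((cos (φ θ) ^ 2 + q θ * sin (φ θ) ^ 2) *
      (ω θ - 1)) * h1
  have hXge : ∀ θ ∈ Icc a b, Λ' θ ≤ X θ := by
    intro θ hθ
    refine (hle θ hθ).trans ?_
    have hw := hω θ hθ
    have h1 := sin_sq_add_cos_sq (φ θ)
    have hM : 1 + (ω θ ^ 2 - 1) * sin (φ θ) ^ 2 = cos (φ θ) ^ 2 + ω θ ^ 2 * sin (φ θ) ^ 2 := by
      linear_combination -h1
    have hMpos : 0 < cos (φ θ) ^ 2 + ω θ ^ 2 * sin (φ θ) ^ 2 := by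
      rcases eq_or_ne (cos (φ θ)) 0 with h | h
      · rw [h] at h1 ⊢
        have : sin (φ θ) ^ 2 = 1 := by linarith
        rw [this]; positivity
      · positivity
    simp only [hX]
    rw [hM, le_div_iff₀ hMpos, sub_mul]
    set M := cos (φ θ) ^ 2 + ω θ ^ 2 * sin (φ θ) ^ 2
    have i1 : ω θ * M ≤ ω θ * (cos (φ θ) ^ 2 + q θ * sin (φ θ) ^ 2) := by
      have h6 := mul_le_mul_of_nonneg_right (hq θ hθ) (sq_nonneg (sin (φ θ)))
      exact mul_le_mul_of_nonneg_left (by simp only [M]; linarith) hw.le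
    have i2 : |sin (φ θ) * cos (φ θ)| ≤ M / (2 * ω θ) := by
      rw [le_div_iff₀ (by positivity), ← abs_of_pos (show 0 < 2 * ω θ by positivity), ← abs_mul,
        abs_le]
      simp only [M]
      constructor <;> nlinarith [sq_nonneg (cos (φ θ) - ω θ * sin (φ θ)),
        sq_nonneg (cos (φ θ) + ω θ * sin (φ θ))]
    -- The term with `ω'` is absorbed by `2ω |sin φ cos φ| ≤ cos² φ + ω² sin² φ`. This is the source
    -- of the loss `|ω'| / (2ω)`.
    have i3 : -(|ω' θ| * (M / (2 * ω θ))) ≤ ω' θ * (sin (φ θ) * cos (φ θ)) := by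
      have := neg_abs_le (ω' θ * (sin (φ θ) * cos (φ θ)))
      rw [abs_mul] at this
      have h5 : |ω' θ| * |sin (φ θ) * cos (φ θ)| ≤ |ω' θ| * (M / (2 * ω θ)) := by gcongr
      linarith
    have e4 : |ω' θ| / (2 * ω θ) * M = |ω' θ| * (M / (2 * ω θ)) := by ring
    rw [e4]; linarith
  have hmono : MonotoneOn (fun θ => φ θ + arctan (N θ / D θ) - Λ θ) (Icc a b) := by
    have hd : ∀ θ ∈ Icc a b, HasDerivAt (fun θ => φ θ + arctan (N θ / D θ) - Λ θ)
        (X θ - Λ' θ) θ := fun θ hθ => (hder θ hθ).sub (hΛ θ hθ)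
    refine monotoneOn_of_deriv_nonneg (convex_Icc a b)
      (fun θ hθ => (hd θ hθ).continuousAt.continuousWithinAt)
      (fun θ hθ => (hd θ (interior_subset hθ)).differentiableAt.differentiableWithinAt)
      fun θ hθ => ?_
    rw [(hd θ (interior_subset hθ)).deriv]
    linarith [hXge θ (interior_subset hθ)]
  have h1 := hmono (left_mem_Icc.2 hab) (right_mem_Icc.2 hab) hab
  simp only at h1
  have h2 := arctan_lt_pi_div_two (N b / D b)
  have h3 := neg_pi_div_two_lt_arctan (N a / D a)
  linarith

theorem Potential.le_rot {Q : Potential} {ω : ℝ} (hω : 0 < ω) (hq : ∀ θ, ω ^ 2 ≤ Q.q θ) :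
    2 * ω ≤ Q.rot := by
  have h1 : ∀ n : ℕ, 2 * π * ω * n - π ≤ Q.ret^[n] 0 := by
    intro n
    have := (Q.isPrufer_angle 0).le_sub (a := 0) (b := n * (2 * π)) (ω := fun _ => ω)
      (ω' := fun _ => 0) (Λ := fun θ => ω * θ) (Λ' := fun _ => ω) (by positivity) (fun _ _ => hω)
      (fun θ _ => hasDerivAt_const θ ω) (fun θ _ => hq θ)
      (fun θ _ => by simpa using (hasDerivAt_id θ).const_mul ω) (fun θ _ => by simp)
    have h2 := Q.angle_nat_mul_period 0 n 0
    rw [zero_add, Potential.angle_zero] at h2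
    rw [h2] at this
    simp only [angle_zero] at this
    linarith
  have h2 : Tendsto (fun n : ℕ => 2 * π * ω - π * (1 / (n : ℝ))) atTop (𝓝 (2 * π * ω)) := by
    simpa using (tendsto_one_div_atTop_nhds_zero_nat.const_mul π).const_sub (2 * π * ω)
  have h3 := le_of_tendsto_of_tendsto h2 (Q.tendsto_ret_iterate 0) (by
    filter_upwards [eventually_ge_atTop 1] with n hn
    have : (0 : ℝ) < n := by exact_mod_cast hn
    rw [le_div_iff₀ this, sub_mul, mul_assoc π, one_div, inv_mul_cancel₀ this.ne']
    linarith [h1 n])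
  have := pi_pos
  nlinarith

/-- The potential is at least `1 + 63/11 > (51/20)²`, so the rotation is at least `51/10`. The
parameter `63/10` is `7β` with `β = 9/10`, and `(9/10, 1/10)` lies in `𝒟`. -/
theorem five_lt_hill_rot : (5 : ℝ) < (hill (63 / 10) (1 / 10) (by norm_num [abs_of_pos])).rot := by
  have h : |(1 / 10 : ℝ)| < 1 := by norm_num [abs_of_pos]
  have := Potential.le_rot (Q := hill (63 / 10) (1 / 10) h) (ω := 51 / 20) (by norm_num)
    (fun θ => by
      simp only [hill, hillq]
      have h1 := one_add_mul_cos_pos h θ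
      have h2 : 1 + 1 / 10 * cos θ ≤ 11 / 10 := by linarith [cos_le_one θ]
      have h3 : (63 / 10 : ℝ) / (11 / 10) ≤ 63 / 10 / (1 + 1 / 10 * cos θ) := by gcongr
      norm_num at h3 ⊢
      linarith)
  linarith

theorem abs_one_sub_sq_lt {δ : ℝ} (h0 : 0 < δ) (h1 : δ < 1) : |1 - δ ^ 2| < 1 := by
  rw [abs_lt]; constructor <;> nlinarith

/-- As the eccentricity tends to one, the displacement tends to infinity. -/
theorem log_le_hill_ret_sub {δ : ℝ} (h0 : 0 < δ) (h1 : δ < 1) (x : ℝ) :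
    log (1 / δ) / 2 - π ≤ (hill 1 (1 - δ ^ 2) (abs_one_sub_sq_lt h0 h1)).ret x - x := by
  have he := abs_one_sub_sq_lt h0 h1
  set Q := hill 1 (1 - δ ^ 2) he with hQ
  have hqpos : ∀ θ, 0 ≤ Q.q θ := fun θ => by
    have := one_add_mul_cos_pos he θ
    simp only [hQ, hill, hillq]; positivity
  have hmono : Monotone (Q.angle x) := monotone_of_deriv_nonneg
    (fun θ => (Q.isPrufer_angle x θ).differentiableAt) fun θ => by
      rw [(Q.isPrufer_angle x θ).deriv]
      have := hqpos θ
      positivity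
  -- On `[0, π]` only the monotonicity of the angle is used. The growth comes from the right of `θ =
  -- π`, where the potential is nearly singular.
  have a1 : x ≤ Q.angle x π := by simpa using hmono pi_pos.le
  have hpos : ∀ θ ∈ Icc π (2 * π), 0 < δ + (θ - π) := fun θ hθ => by linarith [hθ.1]
  have hdin : ∀ θ, HasDerivAt (fun θ => δ + (θ - π)) 1 θ := fun θ =>
    ((hasDerivAt_id θ).sub_const π).const_add δ
  -- Since `1 + (1 - δ²) cos θ ≤ (δ + (θ - π))²`, the comparison frequency is `ω = 1 / (δ + (θ -
  -- π))`. Then `ω - |ω'| / (2ω) = ω / 2`, whose integral is half a logarithm.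
  have := (Q.isPrufer_angle x).le_sub (a := π) (b := 2 * π) (ω := fun θ => (δ + (θ - π))⁻¹)
    (ω' := fun θ => -1 / (δ + (θ - π)) ^ 2) (Λ := fun θ => log (δ + (θ - π)) / 2)
    (Λ' := fun θ => 1 / (δ + (θ - π)) / 2) (by linarith [pi_pos])
    (fun θ hθ => inv_pos.2 (hpos θ hθ)) (fun θ hθ => (hdin θ).fun_inv (hpos θ hθ).ne')
    (fun θ hθ => ?_) (fun θ hθ => ((hdin θ).log (hpos θ hθ).ne').div_const 2) (fun θ hθ => ?_)
  · have e1 : δ + (2 * π - π) = δ + π := by ring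
    have e2 : δ + (π - π) = δ := by ring
    simp only [e1, e2] at this
    have h3 : log 1 ≤ log (δ + π) := log_le_log one_pos (by linarith [pi_gt_three])
    rw [log_one] at h3
    rw [log_div one_ne_zero h0.ne', log_one]
    rw [Potential.ret]
    linarith
  · have hp := hpos θ hθ
    have h2 := one_add_mul_cos_pos he θ
    have h3 : 1 + (1 - δ ^ 2) * cos θ ≤ (δ + (θ - π)) ^ 2 := by
      have h4 := one_sub_sq_div_two_le_cos (x := θ - π)
      rw [cos_sub_pi] at h4
      nlinarith [hθ.1, neg_one_le_cos θ]
    simp only [hQ, hill, hillq]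
    rw [inv_pow, ← one_div]
    have : 1 / (δ + (θ - π)) ^ 2 ≤ 1 / (1 + (1 - δ ^ 2) * cos θ) := by gcongr
    linarith
  · have hp := hpos θ hθ
    rw [abs_div, abs_neg, abs_one, abs_of_pos (by positivity)]
    refine le_of_eq ?_
    field_simp
    ring

/-! ### Parameters of hyperbolicity and of rational rotation number -/

/-- The parameters for which the displacement of angles takes values on both sides of `πj`. -/
def bothSigns (j : ℤ) : Set (ℝ × ℝ) :=
  {p | ∃ he : |p.2| < 1, (∃ x, (hill (7 * p.1) p.2 he).ret x < x + π * j) ∧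
    ∃ x, x + π * j < (hill (7 * p.1) p.2 he).ret x}

theorem isOpen_bothSigns (j : ℤ) : IsOpen (bothSigns j) := by
  have hR : ∀ x, Continuous fun p : {p : ℝ × ℝ // |p.2| < 1} =>
      (hill (7 * p.1.1) p.1.2 p.2).ret x := fun x =>
    continuous_hill_ret.comp (f := fun p : {p : ℝ × ℝ // |p.2| < 1} =>
      ((⟨⟨7 * p.1.1, p.1.2⟩, p.2⟩ : {p : ℝ × ℝ // |p.2| < 1}), x)) (by fun_prop)
  have hopen : IsOpen {p : ℝ × ℝ | |p.2| < 1} := isOpen_lt (by fun_prop) continuous_const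
  have h1 : IsOpen {p : {p : ℝ × ℝ // |p.2| < 1} |
      (∃ x, (hill (7 * p.1.1) p.1.2 p.2).ret x < x + π * j) ∧
        ∃ x, x + π * j < (hill (7 * p.1.1) p.1.2 p.2).ret x} := by
    refine IsOpen.and ?_ ?_
    · rw [ofPred_exists]
      exact isOpen_iUnion fun x => isOpen_lt (hR x) continuous_const
    · rw [ofPred_exists]
      exact isOpen_iUnion fun x => isOpen_lt continuous_const (hR x)
  have h2 := hopen.isOpenMap_subtype_val _ h1
  convert h2 using 1
  ext p
  constructor
  · rintro ⟨he, h⟩; exact ⟨⟨p, he⟩, h, rfl⟩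
  · rintro ⟨⟨p, he⟩, h, rfl⟩; exact ⟨he, h⟩

theorem bothSigns_inter_nonempty {j : ℤ} (hj : Odd j) (h3 : 3 ≤ j) :
    (bothSigns j ∩ Ioo 0 1 ×ˢ Ioo 0 1).Nonempty := by
  have hj3 : (3 : ℝ) ≤ j := by exact_mod_cast h3
  -- With this `δ` the lower bound `log (1 / δ) / 2 - π` is exactly `πj`.
  set δ := exp (-(2 * (π * (j + 1)))) with hδ
  have h0 : 0 < δ := exp_pos _
  have hp := pi_pos
  have h1 : δ < 1 := by rw [hδ, exp_lt_one_iff]; nlinarith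
  have he := abs_one_sub_sq_lt h0 h1
  have he0 : 0 < 1 - δ ^ 2 := by nlinarith
  have hb : ∃ x, x + π * j ≤ (hill 1 (1 - δ ^ 2) he).ret x := by
    refine ⟨0, ?_⟩
    have := log_le_hill_ret_sub h0 h1 0
    have hlog : log δ = -(2 * (π * (j + 1))) := by rw [hδ, log_exp]
    rw [one_div, log_inv, hlog] at this
    linarith
  -- The parameter is `b = 7β`; the bound `b' = 7` keeps `β = c / 7` below `1`.
  obtain ⟨c, hc, hx, hy⟩ := exists_displacement_both_signs he he0.ne' hj (a := 0) (b := 1) (b' := 7)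
    (by norm_num) (by norm_num) (fun x => by rw [hill_zero_ret]; nlinarith) hb
  have e7 : 7 * (c / 7) = c := by ring
  refine ⟨(c / 7, 1 - δ ^ 2), ⟨he, ?_⟩, ⟨by linarith [hc.1], by linarith [hc.2]⟩, he0, by nlinarith⟩
  simp only [e7]
  exact ⟨hx, hy⟩

theorem bothSigns_inter_domain_nonempty {j : ℤ} (hj : Odd j) (h3 : 3 ≤ j) (h5 : j ≤ 5) :
    (bothSigns j ∩ (𝒟 ∩ Ioo 0 1 ×ˢ Ioo 0 1)).Nonempty := by
  have hj3 : (3 : ℝ) ≤ j := by exact_mod_cast h3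
  have hj5 : (j : ℝ) ≤ 5 := by exact_mod_cast h5
  have hp := pi_pos
  have he : |(1 / 10 : ℝ)| < 1 := by norm_num [abs_of_pos]
  have hb : ∃ x, x + π * j ≤ (hill (63 / 10) (1 / 10) he).ret x :=
    ⟨0, ((hill (63 / 10) (1 / 10) he).lt_ret_of_lt_rot (hj5.trans_lt five_lt_hill_rot) 0).le⟩
  -- The bound `64/10` gives `β < 64/70`, and `(64/70)² + (1/10)² < 1` keeps the point in `𝒟`.
  obtain ⟨c, hc, hx, hy⟩ := exists_displacement_both_signs he (by norm_num) hj (a := 0)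
    (b := 63 / 10) (b' := 64 / 10)
    (by norm_num) (by norm_num) (fun x => by rw [hill_zero_ret]; nlinarith) hb
  have e7 : 7 * (c / 7) = c := by ring
  have c1 := hc.1
  have c2 := hc.2
  refine ⟨(c / 7, 1 / 10), ⟨he, ?_⟩, ⟨by simp; linarith, by norm_num, ?_⟩, ⟨by simp; linarith, ?_⟩,
    by norm_num, by norm_num⟩
  · simp only [e7]
    exact ⟨hx, hy⟩
  · simp only
    nlinarith
  · simp only
    linarith

theorem four_lt_of_mem_bothSigns {j : ℤ} {p : ℝ × ℝ} (h : p ∈ bothSigns j) (he : |p.2| < 1) :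
    4 < (hill (7 * p.1) p.2 he).mono.trace ^ 2 ∧ (hill (7 * p.1) p.2 he).rot = j := by
  obtain ⟨he, ⟨x, hx⟩, y, hy⟩ := h
  refine ⟨Potential.four_lt_trace_sq _ hx hy, ?_⟩
  have hcont : Continuous fun x => (hill (7 * p.1) p.2 he).ret x - x :=
    (Potential.ret_continuous _).sub continuous_id
  obtain ⟨x₀, hx₀⟩ := mem_range_of_exists_le_of_exists_ge hcont (c := π * j) ⟨x, by linarith⟩
    ⟨y, by linarith⟩
  exact Potential.rot_eq_of_ret_eq _ (x := x₀) (by simp only at hx₀; linarith)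

theorem two_lt_hill_rot {e b : ℝ} (he : |e| < 1) (hb : 0 < b) : 2 < (hill b e he).rot :=
  Potential.lt_rot_of_forall_lt (lt_hill_ret he hb)

theorem hill_rot_le {e b b' : ℝ} (he : |e| < 1) (hb : b < b') :
    (hill b e he).rot ≤ (hill b' e he).rot := by
  refine CircleDeg1Lift.translationNumber_mono fun x => ?_
  exact div_le_div_of_nonneg_right (hill_ret_lt he hb _).le pi_pos.le

/-- The first touch is applied to the `n`-th iterate of the displacement map. An angle moved by
exactly `πm` in `n` periods forces `rot = m / n`, so continuity of `rot` is not needed. -/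
theorem exists_hill_rot_eq_div {e b b' : ℝ} (he : |e| < 1) (hbb' : b ≤ b') {m : ℤ} {n : ℕ}
    (hn : 0 < n) (h0 : (hill b e he).rot < m / n) (h1 : m / n < (hill b' e he).rot) :
    ∃ c ∈ Ioc b b', (hill c e he).rot = m / n := by
  have hn' : (0 : ℝ) < n := by exact_mod_cast hn
  have hper : ∀ c x, (hill c e he).ret^[n] (x + π) = (hill c e he).ret^[n] x + π := by
    intro c x
    rw [Potential.ret_iterate, Potential.ret_iterate, add_div, div_self pi_ne_zero,
      CircleDeg1Lift.map_add_one]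
    ring
  have hlt : ∀ x, (hill b e he).ret^[n] x < x + π * m := by
    intro x
    rw [lt_div_iff₀ hn', mul_comm] at h0
    have h2 : ((hill b e he).lift ^ n).translationNumber < m := by
      rwa [CircleDeg1Lift.translationNumber_pow]
    have := CircleDeg1Lift.map_lt_of_translationNumber_lt_int _ h2 (x / π)
    rw [Potential.ret_iterate]
    calc _ < π * (x / π + m) := by gcongr
      _ = x + π * m := by rw [mul_add, mul_div_cancel₀ _ pi_ne_zero]
  have hgt : ∃ x, x + π * m ≤ (hill b' e he).ret^[n] x := by
    refine ⟨0, ?_⟩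
    rw [div_lt_iff₀ hn', mul_comm] at h1
    have h2 : (m : ℝ) < ((hill b' e he).lift ^ n).translationNumber := by
      rwa [CircleDeg1Lift.translationNumber_pow]
    have := CircleDeg1Lift.lt_map_of_int_lt_translationNumber _ h2 (0 / π)
    rw [Potential.ret_iterate]
    calc 0 + π * m = π * (0 / π + m) := by ring
      _ ≤ _ := by gcongr
  obtain ⟨c, hc, -, x, hx⟩ := exists_first_touch (continuous_hill_ret_iterate he n)
    hper hbb' hlt hgt
  refine ⟨c, hc, ?_⟩
  refine CircleDeg1Lift.translationNumber_of_map_pow_eq_add_int _ (x := x / π) ?_ hn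
  rw [Potential.ret_iterate] at hx
  refine mul_left_cancel₀ pi_ne_zero ?_
  rw [hx, mul_add, mul_div_cancel₀ _ pi_ne_zero]

/-- If `rot` is constant on the interval, its value is an odd integer `j` and `1 + j / 2 = (j + 2) /
2`. Otherwise `1 + rot / 2` passes through some odd multiple of `1 / 2^(k+1)`. -/
theorem exists_odd_div_even {b₀ b₁ e : ℝ} (he : |e| < 1) (hb₀ : 0 < b₀) (hb : b₀ < b₁) :
    ∃ c ∈ Icc b₀ b₁, ∃ p q : ℕ, 0 < p ∧ 0 < q ∧ Odd p ∧ Even q ∧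
      1 + (hill c e he).rot / 2 = (p : ℝ) / q := by
  have h2 := two_lt_hill_rot he hb₀
  rcases (hill_rot_le he hb).eq_or_lt with heq | hlt
  · obtain ⟨j, hj, hjr⟩ := exists_odd_of_rot_eq he hb₀ hb heq
    rw [hjr] at h2
    have h2' : (2 : ℤ) < j := by exact_mod_cast h2
    refine ⟨b₀, ⟨le_rfl, hb.le⟩, (j + 2).toNat, 2, by omega, by norm_num, ?_, even_two, ?_⟩
    · have : Odd (j + 2) := hj.add_even even_two
      rw [← Int.odd_coe_nat, Int.toNat_of_nonneg (by omega)]; exact this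
    · have : (((j + 2).toNat : ℕ) : ℝ) = ((j + 2 : ℤ) : ℝ) := by
        rw [← Int.cast_natCast, Int.toNat_of_nonneg (by omega)]
      rw [this, hjr]; push_cast; ring
  · set r₀ := (hill b₀ e he).rot
    set r₁ := (hill b₁ e he).rot
    -- After multiplication by `n = 2^(k+1)` the interval of values of `1 + rot / 2` has length
    -- greater than `4`, so it contains an odd integer in its interior.
    obtain ⟨k, hk⟩ := pow_unbounded_of_one_lt (4 / (r₁ - r₀)) (one_lt_two (α := ℝ))
    set n : ℕ := 2 ^ (k + 1) with hn
    have hnR : (n : ℝ) = 2 ^ k * 2 := by rw [hn]; push_cast; ring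
    have hk' : 4 < 2 ^ k * (r₁ - r₀) := (div_lt_iff₀ (by linarith)).1 hk
    have hn0 : (0 : ℝ) < n := by rw [hnR]; positivity
    set y := n * (1 + r₀ / 2) with hy
    set z : ℤ := ⌊(y + 1) / 2⌋ with hz
    have z1 : (z : ℝ) ≤ (y + 1) / 2 := Int.floor_le _
    have z2 : (y + 1) / 2 < z + 1 := Int.lt_floor_add_one _
    set p : ℤ := 2 * z + 1 with hp
    have p1 : y < p := by rw [hp]; push_cast; linarith
    have p2 : (p : ℝ) < n * (1 + r₁ / 2) := by
      have : n * (1 + r₁ / 2) = y + 2 ^ k * (r₁ - r₀) := by rw [hy, hnR]; ring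
      rw [this, hp]; push_cast; linarith
    have ppos : 0 < p := by
      have : (0 : ℝ) < y := by positivity
      exact_mod_cast this.trans p1
    have em : ((2 * p - 2 * n : ℤ) : ℝ) / n = 2 * (p / n) - 2 := by
      push_cast; field_simp
    have q1 : 1 + r₀ / 2 < p / n := by rw [lt_div_iff₀ hn0]; linarith
    have q2 : p / n < 1 + r₁ / 2 := by rw [div_lt_iff₀ hn0]; linarith
    obtain ⟨c, hc, hcr⟩ := exists_hill_rot_eq_div he hb.le (m := 2 * p - 2 * n) (n := n)
      (by positivity) (by rw [em]; linarith) (by rw [em]; linarith)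
    refine ⟨c, Ioc_subset_Icc_self hc, p.toNat, n, by omega, by positivity, ?_, ?_, ?_⟩
    · rw [← Int.odd_coe_nat, Int.toNat_of_nonneg ppos.le]
      exact ⟨z, hp⟩
    · rw [hn, pow_succ]; exact even_two.mul_left _
    · have : ((p.toNat : ℕ) : ℝ) = (p : ℝ) := by
        rw [← Int.cast_natCast, Int.toNat_of_nonneg ppos.le]
      rw [this, hcr, em]; ring

/-! ### The fundamental matrix of Hill's equation -/

namespace Potential

variable (Q : Potential)

/-- The fundamental matrix of Hill's equation, acting on vectors `(u', u)`. -/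
noncomputable def fund (θ : ℝ) : Matrix (Fin 2) (Fin 2) ℝ :=
  !![Q.amp 0 θ * cos (Q.angle 0 θ), Q.amp (π / 2) θ * cos (Q.angle (π / 2) θ);
     Q.amp 0 θ * sin (Q.angle 0 θ), Q.amp (π / 2) θ * sin (Q.angle (π / 2) θ)]

theorem fund_zero : Q.fund 0 = 1 := by
  ext i j; fin_cases i <;> fin_cases j <;> simp [fund]

theorem fund_two_pi : Q.fund (2 * π) = Q.mono := rfl

theorem det_fund (θ : ℝ) : (Q.fund θ).det = 1 := by
  have := (Q.isHillSol (π / 2)).wronskian (Q.isHillSol 0) 0 θ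
  simp only [angle_zero, amp_zero, sin_pi_div_two, cos_pi_div_two, sin_zero, cos_zero] at this
  rw [Matrix.det_fin_two]
  simp only [fund, Matrix.of_apply, Matrix.cons_val', Matrix.cons_val_zero, Matrix.cons_val_one,
    Matrix.cons_val_fin_one]
  linarith

theorem isHillSol_fund (k : Fin 2 → ℝ) : IsHillSol Q.q (fun θ => (Q.fund θ).mulVec k 1)
    (fun θ => (Q.fund θ).mulVec k 0) := by
  have h1 := Q.isHillSol 0
  have h2 := Q.isHillSol (π / 2)
  simp only [Matrix.mulVec, dotProduct, Fin.sum_univ_two, fund, Matrix.of_apply, Matrix.cons_val',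
    Matrix.cons_val_zero, Matrix.cons_val_one, Matrix.cons_val_fin_one]
  refine ⟨fun θ => ((h1.1 θ).mul_const (k 0)).add ((h2.1 θ).mul_const (k 1)), fun θ =>
    (((h1.2 θ).mul_const (k 0)).add ((h2.2 θ).mul_const (k 1))).congr_deriv ?_⟩
  ring

theorem fund_mulVec {u v : ℝ → ℝ} (h : IsHillSol Q.q u v) (θ : ℝ) :
    (Q.fund θ).mulVec ![v 0, u 0] = ![v θ, u θ] := by
  have h1 := Q.isHillSol_fund ![v 0, u 0]
  have h2 : IsHillSol Q.q (fun θ => (Q.fund θ).mulVec ![v 0, u 0] 1 - u θ)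
      (fun θ => (Q.fund θ).mulVec ![v 0, u 0] 0 - v θ) :=
    ⟨fun θ => (h1.1 θ).sub (h.1 θ), fun θ => ((h1.2 θ).sub (h.2 θ)).congr_deriv (by ring)⟩
  obtain ⟨e1, e2⟩ := h2.eq_zero (by simp [fund_zero]) (by simp [fund_zero])
  ext i
  fin_cases i
  · exact sub_eq_zero.1 (congrFun e2 θ)
  · exact sub_eq_zero.1 (congrFun e1 θ)

theorem fund_add_period (θ : ℝ) : Q.fund (θ + 2 * π) = Q.fund θ * Q.mono := by
  have key : ∀ k : Fin 2 → ℝ, (Q.fund (θ + 2 * π)).mulVec k = (Q.fund θ * Q.mono).mulVec k := by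
    intro k
    have h := Q.fund_mulVec ((Q.isHillSol_fund k).shift Q.periodic) θ
    simp only [zero_add, fund_two_pi] at h
    have e : ![Q.mono.mulVec k 0, Q.mono.mulVec k 1] = Q.mono.mulVec k := by
      ext i; fin_cases i <;> rfl
    rw [e, Matrix.mulVec_mulVec] at h
    rw [h]
    ext i; fin_cases i <;> rfl
  exact Matrix.mulVec_injective (funext key)

theorem fund_mulVec_angle (x θ : ℝ) : (Q.fund θ).mulVec ![cos x, sin x] =
    ![Q.amp x θ * cos (Q.angle x θ), Q.amp x θ * sin (Q.angle x θ)] := by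
  have := Q.fund_mulVec (Q.isHillSol x) θ
  simpa using this

end Potential

/-! ### Positive vector fields on the circle -/

/-- Separation of variables: `F x = ∫ 1 / h` is the travel time. It is a bijection with `F (x + 2π)
= F x + F (2π)`, its inverse is a solution, and `F (θ t) - t` is constant along every solution, so
`T = F (2π)`. -/
theorem exists_period_of_pos {h : ℝ → ℝ} (hc : Continuous h) (hpos : ∀ x, 0 < h x)
    (hper : Function.Periodic h (2 * π)) :
    ∃ T, 0 < T ∧ (∃ θ : ℝ → ℝ, ∀ t, HasDerivAt θ (h (θ t)) t) ∧
      ∀ θ : ℝ → ℝ, (∀ t, HasDerivAt θ (h (θ t)) t) → ∀ t, θ (t + T) = θ t + 2 * π := by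
  have hi : Continuous fun x => (h x)⁻¹ := hc.inv₀ fun x => (hpos x).ne'
  set F : ℝ → ℝ := fun x => ∫ y in (0 : ℝ)..x, (h y)⁻¹ with hF
  have hFd : ∀ x, HasDerivAt F (h x)⁻¹ x := fun x =>
    intervalIntegral.integral_hasDerivAt_right (hi.intervalIntegrable _ _)
      (hi.stronglyMeasurableAtFilter _ _) hi.continuousAt
  have hFc : Continuous F := continuous_iff_continuousAt.2 fun x => (hFd x).continuousAt
  have hmono : StrictMono F := strictMono_of_deriv_pos fun x => by
    rw [(hFd x).deriv]; exact inv_pos.2 (hpos x)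
  have hF0 : F 0 = 0 := by simp [hF]
  have hadd : ∀ x, F (x + 2 * π) = F x + F (2 * π) := by
    intro x
    have hp : Function.Periodic (fun x => (h x)⁻¹) (2 * π) := fun x => by simp only [hper x]
    have := hp.intervalIntegral_add_eq x 0
    rw [zero_add] at this
    simp only [hF]
    rw [← this, intervalIntegral.integral_add_adjacent_intervals (hi.intervalIntegrable _ _)
      (hi.intervalIntegrable _ _)]
  have hT : 0 < F (2 * π) := by rw [← hF0]; exact hmono two_pi_pos
  have hnat : ∀ n : ℕ, F (n * (2 * π)) = n * F (2 * π) := by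
    intro n
    induction n with
    | zero => simp [hF0]
    | succ n ih => push_cast; rw [add_mul, one_mul, hadd, ih]; ring
  have hneg : ∀ n : ℕ, F (-(n * (2 * π))) = -(n * F (2 * π)) := by
    intro n
    induction n with
    | zero => simp [hF0]
    | succ n ih =>
      have := hadd (-((n + 1 : ℕ) * (2 * π)))
      have e : -(((n + 1 : ℕ) : ℝ) * (2 * π)) + 2 * π = -(n * (2 * π)) := by push_cast; ring
      rw [e, ih] at this
      push_cast at this ⊢
      linarith
  have hsurj : Function.Surjective F := by
    intro y
    obtain ⟨n, hn⟩ := exists_nat_ge (|y| / F (2 * π))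
    rw [div_le_iff₀ hT] at hn
    have hy := abs_le.1 hn
    have := intermediate_value_Icc (a := -((n : ℝ) * (2 * π))) (b := n * (2 * π))
      (by have := two_pi_pos; have : 0 ≤ (n : ℝ) * (2 * π) := by positivity
          linarith) hFc.continuousOn
    rw [hnat, hneg] at this
    obtain ⟨x, -, hx⟩ := this hy
    exact ⟨x, hx⟩
  refine ⟨F (2 * π), hT, ?_, ?_⟩
  · set G := hmono.orderIsoOfSurjective F hsurj
    refine ⟨G.symm, fun t => ?_⟩
    have := HasDerivAt.of_local_left_inverse (f := F) (g := G.symm) (a := t)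
      G.symm.continuous.continuousAt (hFd _) (inv_ne_zero (hpos _).ne')
      (Eventually.of_forall fun y => G.apply_symm_apply y)
    rwa [inv_inv] at this
  · intro θ hθ t
    have hcst : ∀ s, HasDerivAt (fun s => F (θ s) - s) 0 s := fun s => by
      refine (((hFd (θ s)).comp s (hθ s)).sub (hasDerivAt_id s)).congr_deriv ?_
      rw [inv_mul_cancel₀ (hpos _).ne', sub_self]
    have := is_const_of_deriv_eq_zero (fun s => (hcst s).differentiableAt)
      (fun s => (hcst s).deriv) (t + F (2 * π)) t
    refine hmono.injective ?_
    rw [hadd]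
    linarith

theorem exists_abs_sub_le_of_add_period {θ : ℝ → ℝ} (hc : Continuous θ) {T : ℝ} (hT : 0 < T)
    (h : ∀ t, θ (t + T) = θ t + 2 * π) : ∃ B, ∀ t, |θ t - 2 * π / T * t| ≤ B := by
  have hp : Function.Periodic (fun t => θ t - 2 * π / T * t) T := fun t => by
    simp only [h]; field_simp; ring
  obtain ⟨C, hC⟩ := isCompact_Icc.exists_bound_of_continuousOn (s := Icc 0 T)
    (f := fun t => θ t - 2 * π / T * t) (by fun_prop)
  refine ⟨C, fun t => ?_⟩
  obtain ⟨y, hy, h⟩ := hp.exists_mem_Ico₀ hT t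
  rw [h]
  exact hC y (Ico_subset_Icc_self hy)

/-! ### Rotation numbers and eigenvalues of paths of matrices -/

theorem tendsto_of_abs_sub_le {η : ℝ → ℝ} {T c B : ℝ} (hT : 0 < T)
    (h : ∀ᶠ t in atTop, |η t - c * (2 * π / T) * t| ≤ B) :
    Tendsto (fun t => T * (η t / (2 * π * t))) atTop (𝓝 c) := by
  rw [tendsto_iff_norm_sub_tendsto_zero]
  have hp := pi_pos
  refine squeeze_zero' (Eventually.of_forall fun _ => norm_nonneg _)
    (g := fun t => T * B / (2 * π) * t⁻¹) ?_ ?_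
  · filter_upwards [h, eventually_gt_atTop 0] with t ht h0
    have e : T * (η t / (2 * π * t)) - c =
        T / (2 * π * t) * (η t - c * (2 * π / T) * t) := by field_simp
    rw [e, Real.norm_eq_abs, abs_mul, abs_of_pos (by positivity)]
    calc _ ≤ T / (2 * π * t) * B := by gcongr
      _ = _ := by field_simp
  · simpa using tendsto_inv_atTop_zero.const_mul (T * B / (2 * π))

/-- Two continuous arguments of the same nonvanishing vector differ by a constant, which disappears
in the mean. -/
theorem HasRotationNumber.eq {Ψ : ℝ → Matrix (Fin 2) (Fin 2) ℝ} {T ρ ρ' : ℝ}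
    (h : HasRotationNumber Ψ T ρ) (h' : HasRotationNumber Ψ T ρ') : ρ = ρ' := by
  have hv : (![1, 0] : Fin 2 → ℝ) ≠ 0 := fun h => one_ne_zero (congrFun h 0)
  obtain ⟨η, hc, hη, hl⟩ := h _ hv
  obtain ⟨η', hc', hη', hl'⟩ := h' _ hv
  have key : ∀ t, Complex.exp (((η t - η' t : ℝ) : ℂ) * Complex.I) = 1 := by
    intro t
    obtain ⟨R, hR, e⟩ := hη t
    obtain ⟨R', hR', e'⟩ := hη' t
    rw [e] at e'
    have e0 : R * cos (η t) = R' * cos (η' t) := congrFun e' 0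
    have e1 : R * sin (η t) = R' * sin (η' t) := congrFun e' 1
    have s1 := sin_sq_add_cos_sq (η t)
    have s2 := sin_sq_add_cos_sq (η' t)
    have hRR : R = R' := by
      have : R ^ 2 = R' ^ 2 := by
        calc R ^ 2 = (R * sin (η t)) ^ 2 + (R * cos (η t)) ^ 2 := by linear_combination (-R ^ 2) * s1
          _ = R' ^ 2 := by rw [e0, e1]; linear_combination R' ^ 2 * s2
      exact (pow_left_inj₀ hR.le hR'.le two_ne_zero).1 this
    subst hRR
    have c0 := mul_left_cancel₀ hR.ne' e0
    have c1 := mul_left_cancel₀ hR.ne' e1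
    rw [Complex.exp_mul_I, ← Complex.ofReal_cos, ← Complex.ofReal_sin, cos_sub, sin_sub, c0, c1]
    have : cos (η' t) * cos (η' t) + sin (η' t) * sin (η' t) = 1 := by linarith
    rw [this]
    push_cast; ring
  have hconst := fun t => eq_of_cexp_eq (f := fun t => η t - η' t) (by fun_prop)
    (fun x y => (key x).trans (key y).symm) t 0
  have hlim := hl.sub hl'
  have h0 : Tendsto (fun t => T * (η t / (2 * π * t)) - T * (η' t / (2 * π * t))) atTop (𝓝 0) := by
    have : (fun t => T * (η t / (2 * π * t)) - T * (η' t / (2 * π * t))) =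
        fun t => T * (η 0 - η' 0) / (2 * π) * t⁻¹ := by
      funext t
      have := hconst t
      rw [← this, mul_comm (2 * π) t, ← div_div, ← div_div]
      simp only [div_eq_mul_inv]; ring
    rw [this]
    simpa using tendsto_inv_atTop_zero.const_mul (T * (η 0 - η' 0) / (2 * π))
  linarith [tendsto_nhds_unique hlim h0]

theorem hasEigenvaluePair_iff {M : Matrix (Fin 2) (Fin 2) ℝ} {l : ℝ} :
    HasEigenvaluePair M l ↔ l ≠ 0 ∧ M.det = 1 ∧ M.trace = l + l⁻¹ := by
  refine and_congr_right fun hl => ?_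
  rw [Matrix.charpoly_fin_two]
  have e : (Polynomial.X - Polynomial.C l) * (Polynomial.X - Polynomial.C l⁻¹) =
      Polynomial.X ^ 2 - Polynomial.C (l + l⁻¹) * Polynomial.X + Polynomial.C 1 := by
    rw [← mul_inv_cancel₀ hl]
    simp only [Polynomial.C_add, Polynomial.C_mul]
    ring
  rw [e]
  constructor
  · intro h
    have h0 := congrArg (Polynomial.eval 0) h
    have h1 := congrArg (Polynomial.eval 1) h
    simp only [Polynomial.eval_add, Polynomial.eval_sub, Polynomial.eval_mul, Polynomial.eval_pow,
      Polynomial.eval_X, Polynomial.eval_C] at h0 h1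
    constructor <;> linarith
  · rintro ⟨h1, h2⟩
    rw [h1, h2]

theorem IsHyperbolic.four_lt {M : Matrix (Fin 2) (Fin 2) ℝ} (h : IsHyperbolic M) :
    4 < M.trace ^ 2 := by
  obtain ⟨l, hl, h⟩ := h
  obtain ⟨h0, -, ht⟩ := hasEigenvaluePair_iff.1 h
  have h1 : l - l⁻¹ ≠ 0 := by
    intro h
    have : l * l = 1 := by
      have := mul_inv_cancel₀ h0
      rwa [← sub_eq_zero.1 h] at this
    exact hl ((pow_eq_one_iff_of_nonneg (abs_nonneg l) two_ne_zero).1 (by rw [sq_abs, sq, this]))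
  have h2 : 0 < (l - l⁻¹) ^ 2 := by positivity
  have h3 := mul_inv_cancel₀ h0
  rw [ht]
  nlinarith

theorem IsPositiveHyperbolic.two_lt {M : Matrix (Fin 2) (Fin 2) ℝ} (h : IsPositiveHyperbolic M) :
    2 < M.trace := by
  have h4 : 4 < M.trace ^ 2 := by
    obtain ⟨l, -, h⟩ := h
    exact IsHyperbolic.four_lt ⟨l, h⟩
  obtain ⟨l, hl, -, h⟩ := h
  have h5 : 0 < M.trace := by
    rw [(hasEigenvaluePair_iff.1 h).2.2]; positivity
  nlinarith

theorem isNegativeHyperbolic_of_trace_lt {M : Matrix (Fin 2) (Fin 2) ℝ} (hdet : M.det = 1)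
    (h : M.trace < -2) : IsNegativeHyperbolic M := by
  set s := √(M.trace ^ 2 - 4)
  have hs0 : 0 < M.trace ^ 2 - 4 := by nlinarith
  have hs : s ^ 2 = M.trace ^ 2 - 4 := sq_sqrt hs0.le
  have hs1 : 0 < s := sqrt_pos.2 hs0
  have hl : (M.trace - s) / 2 < 0 := by linarith
  refine ⟨(M.trace - s) / 2, hl, ?_, hasEigenvaluePair_iff.2 ⟨hl.ne, hdet, ?_⟩⟩
  · rw [abs_of_neg hl]
    intro h
    linarith
  · have : ((M.trace - s) / 2)⁻¹ = (M.trace + s) / 2 := by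
      refine inv_eq_of_mul_eq_one_right ?_
      linear_combination (-1 / 4) * hs
    rw [this]; ring

theorem IsNegativeHyperbolic.isHyperbolic {M : Matrix (Fin 2) (Fin 2) ℝ}
    (h : IsNegativeHyperbolic M) : IsHyperbolic M := by
  obtain ⟨l, -, h⟩ := h
  exact ⟨l, h⟩

/-! ### The Euler orbit as a Kepler orbit -/

/-- The relations between the parameters `(a, w)` and `(β, e)`. -/
structure IsAdmissible (w a β e : ℝ) : Prop where
  a_pos : 0 < a
  w_pos : 0 < w
  β_pos : 0 < β
  e_nonneg : 0 ≤ e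
  abs_e_lt : |e| < 1
  mass : β * (4 * a⁻¹ + 1) = 1
  mom : 2 * w ^ 2 * β ^ 2 = 1 - e ^ 2

theorem isAdmissible {β e : ℝ} (hβ : β ∈ Ioo (0 : ℝ) 1) (he : e ∈ Ico (0 : ℝ) 1) :
    IsAdmissible (angMom β e) (massRatio β) β e := by
  obtain ⟨h1, h2, h3, h4, h5⟩ := (param_iff hβ he).1 ⟨rfl, rfl⟩
  refine ⟨h1, h2, hβ.1, he.1, by rw [abs_of_nonneg he.1]; exact he.2, ?_, ?_⟩
  · have h6 : 4 * (massRatio β)⁻¹ + 1 ≠ 0 := by positivity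
    calc β * (4 * (massRatio β)⁻¹ + 1)
        = (1 + 4 * (massRatio β)⁻¹)⁻¹ * (4 * (massRatio β)⁻¹ + 1) := by rw [← h3]
      _ = 1 := by rw [add_comm, inv_mul_cancel₀ h6]
  · have : e ^ 2 = 1 - 2 * angMom β e ^ 2 * β ^ 2 := by
      nth_rewrite 1 [h5]
      exact sq_sqrt (by linarith)
    linarith

/-- The point of the Euler orbit with true anomaly `θ`. -/
noncomputable def keplerPoint (w β e θ : ℝ) : Phase :=
  ![e * sin θ / (w * β), 0, w ^ 2 * β / (1 + e * cos θ), 0]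

/-- The derivative of the true anomaly with respect to time. -/
noncomputable def keplerSpeed (w β e θ : ℝ) : ℝ := (1 + e * cos θ) ^ 2 / (w ^ 3 * β ^ 2)

theorem Vz_zero (a r : ℝ) : Vz a r 0 = 0 := by simp [Vz]

namespace IsAdmissible

variable {w a β e : ℝ} (hA : IsAdmissible w a β e)
include hA

theorem inv_mass : 4 * a⁻¹ = 1 / β - 1 := by
  linarith [eq_one_div_of_mul_eq_one_right hA.mass]

theorem Vr_zero {r : ℝ} (hr : 0 < r) : Vr w a r 0 = -(w ^ 2 / r ^ 3) + 1 / (β * r ^ 2) := by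
  have h2 := hA.β_pos
  have e1 : √(r ^ 2 + (1 + 2 * a) * 0 ^ 2) = r := by
    rw [show r ^ 2 + (1 + 2 * a) * 0 ^ 2 = r ^ 2 by ring, sqrt_sq hr.le]
  rw [Vr, e1, hA.inv_mass]
  field_simp
  ring

theorem V_zero {r : ℝ} (hr : 0 < r) : V w a r 0 = w ^ 2 / (2 * r ^ 2) - 1 / (β * r) := by
  have h2 := hA.β_pos
  have e1 : √(r ^ 2 + (1 + 2 * a) * 0 ^ 2) = r := by
    rw [show r ^ 2 + (1 + 2 * a) * 0 ^ 2 = r ^ 2 by ring, sqrt_sq hr.le]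
  rw [V, e1, hA.inv_mass]
  field_simp
  ring

theorem one_add_pos (θ : ℝ) : 0 < 1 + e * cos θ := one_add_mul_cos_pos hA.abs_e_lt θ

theorem keplerPoint_r_pos (θ : ℝ) : 0 < keplerPoint w β e θ 2 :=
  div_pos (mul_pos (pow_pos hA.w_pos 2) hA.β_pos) (hA.one_add_pos θ)

theorem keplerSpeed_pos (θ : ℝ) : 0 < keplerSpeed w β e θ :=
  div_pos (pow_pos (hA.one_add_pos θ) 2) (mul_pos (pow_pos hA.w_pos 3) (pow_pos hA.β_pos 2))

theorem Vr_keplerPoint (θ : ℝ) : Vr w a (keplerPoint w β e θ 2) (keplerPoint w β e θ 3) =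
    -(keplerSpeed w β e θ * (e * cos θ / (w * β))) := by
  have h1 := hA.one_add_pos θ
  have h2 := hA.β_pos
  have h3 := hA.w_pos
  have e3 : keplerPoint w β e θ 3 = 0 := rfl
  rw [e3, hA.Vr_zero (hA.keplerPoint_r_pos θ)]
  have e2 : keplerPoint w β e θ 2 = w ^ 2 * β / (1 + e * cos θ) := rfl
  rw [e2, keplerSpeed]
  field_simp
  ring

theorem XH_keplerPoint (θ : ℝ) : XH w a (keplerPoint w β e θ) =
    ![keplerSpeed w β e θ * (e * cos θ / (w * β)), 0, e * sin θ / (w * β), 0] := by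
  rw [XH, hA.Vr_keplerPoint, neg_neg]
  have e3 : keplerPoint w β e θ 3 = 0 := rfl
  rw [e3, Vz_zero, neg_zero]
  rfl

theorem isEulerOrbit {θ : ℝ → ℝ} (hθ : ∀ t, HasDerivAt θ (keplerSpeed w β e (θ t)) t) :
    IsEulerOrbit w a fun t => keplerPoint w β e (θ t) := by
  have h2 := hA.β_pos
  have h3 := hA.w_pos
  refine ⟨fun t => ?_, fun t => hA.keplerPoint_r_pos _, fun t => ?_, fun t => rfl⟩
  · rw [hA.XH_keplerPoint, hasDerivAt_pi]
    have h1 := hA.one_add_pos (θ t)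
    intro i
    fin_cases i
    · refine ((((hasDerivAt_sin (θ t)).comp t (hθ t)).const_mul e).div_const (w * β)).congr_deriv ?_
      show _ = keplerSpeed w β e (θ t) * (e * cos (θ t) / (w * β))
      ring
    · exact hasDerivAt_const t (0 : ℝ)
    · have := (((hasDerivAt_cos (θ t)).comp t (hθ t)).const_mul e).const_add 1
      refine ((hasDerivAt_const t (w ^ 2 * β)).div this h1.ne').congr_deriv ?_
      show _ = e * sin (θ t) / (w * β)
      simp only [keplerSpeed, Function.comp]
      field_simp
      ring
    · exact hasDerivAt_const t (0 : ℝ)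
  · have h1 := hA.one_add_pos (θ t)
    have e3 : keplerPoint w β e (θ t) 3 = 0 := rfl
    rw [H, e3, hA.V_zero (hA.keplerPoint_r_pos _)]
    have e0 : keplerPoint w β e (θ t) 0 = e * sin (θ t) / (w * β) := rfl
    have e1 : keplerPoint w β e (θ t) 1 = 0 := rfl
    have e2 : keplerPoint w β e (θ t) 2 = w ^ 2 * β / (1 + e * cos (θ t)) := rfl
    rw [e0, e1, e2]
    have hm := hA.mom
    have hs := sin_sq_add_cos_sq (θ t)
    field_simp
    linear_combination e ^ 2 * hs + hm

/-- The pair `C = w²β / r - 1`, `S = wβ p_r` is the eccentricity vector in the rotating frame. The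
energy fixes its length `e`, and the equations of motion turn it with angular speed `w / r²`; its
angle is the true anomaly. If `e = 0` the vector is zero and any initial angle serves. -/
theorem exists_anomaly {γ : ℝ → Phase} (h : IsEulerOrbit w a γ) :
    ∃ θ : ℝ → ℝ, (∀ t, HasDerivAt θ (keplerSpeed w β e (θ t)) t) ∧
      ∀ t, γ t = keplerPoint w β e (θ t) := by
  have hb := hA.β_pos
  have hw := hA.w_pos
  have hr := h.r_pos
  have d0 : ∀ t, HasDerivAt (fun t => γ t 0) (w ^ 2 / γ t 2 ^ 3 - 1 / (β * γ t 2 ^ 2)) t := by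
    intro t
    refine (hasDerivAt_pi.1 (h.solution t) 0).congr_deriv ?_
    show -Vr w a (γ t 2) (γ t 3) = _
    rw [h.planar, hA.Vr_zero (hr t)]
    ring
  have d2 : ∀ t, HasDerivAt (fun t => γ t 2) (γ t 0) t := fun t =>
    hasDerivAt_pi.1 (h.solution t) 2
  have d3 : ∀ t, HasDerivAt (fun t => γ t 3) (γ t 1) t := fun t =>
    hasDerivAt_pi.1 (h.solution t) 3
  have h1 : ∀ t, γ t 1 = 0 := fun t => by
    have h3 : (fun t => γ t 3) = fun _ => 0 := funext h.planar
    have := d3 t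
    rw [h3] at this
    exact this.unique (hasDerivAt_const t 0)
  set C : ℝ → ℝ := fun t => w ^ 2 * β / γ t 2 - 1 with hC
  set S : ℝ → ℝ := fun t => w * β * γ t 0 with hS
  have hCS : ∀ t, C t ^ 2 + S t ^ 2 = e ^ 2 := by
    intro t
    have hE := h.energy t
    rw [H, h.planar, h1, hA.V_zero (hr t)] at hE
    have hrt := hr t
    have hm := hA.mom
    have hE' : w ^ 2 * β ^ 2 * (γ t 0) ^ 2 + (w ^ 2 * β / γ t 2) ^ 2 - 2 * (w ^ 2 * β / γ t 2) =
        -(2 * w ^ 2 * β ^ 2) := by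
      have : w ^ 2 * β ^ 2 * (γ t 0) ^ 2 + (w ^ 2 * β / γ t 2) ^ 2 - 2 * (w ^ 2 * β / γ t 2) =
        2 * w ^ 2 * β ^ 2 * ((γ t 0 ^ 2 + 0 ^ 2) / 2 +
          (w ^ 2 / (2 * γ t 2 ^ 2) - 1 / (β * γ t 2))) := by
        field_simp
        ring
      rw [this, hE]; ring
    simp only [hC, hS]
    linear_combination hE' - hm
  have dC : ∀ t, HasDerivAt C (-(w / γ t 2 ^ 2 * S t)) t := by
    intro t
    have hrt := hr t
    refine (((hasDerivAt_const t (w ^ 2 * β)).div (d2 t) hrt.ne').sub_const 1).congr_deriv ?_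
    simp only [hS]
    field_simp
    ring
  have dS : ∀ t, HasDerivAt S (w / γ t 2 ^ 2 * C t) t := by
    intro t
    have hrt := hr t
    refine ((d0 t).const_mul (w * β)).congr_deriv ?_
    simp only [hC]
    field_simp
  have hcr : Continuous fun t => γ t 2 := continuous_iff_continuousAt.2 fun t => (d2 t).continuousAt
  have hcf : Continuous fun t => w / γ t 2 ^ 2 :=
    continuous_const.div (hcr.pow 2) fun t => (pow_pos (hr t) 2).ne'
  set τ : ℝ → ℝ := fun t => ∫ s in (0 : ℝ)..t, w / γ s 2 ^ 2 with hτ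
  have dτ : ∀ t, HasDerivAt τ (w / γ t 2 ^ 2) t := fun t =>
    intervalIntegral.integral_hasDerivAt_right (hcf.intervalIntegrable _ _)
      (hcf.stronglyMeasurableAtFilter _ _) hcf.continuousAt
  have τ0 : τ 0 = 0 := by simp [hτ]
  -- Rotated back by `τ`, the vector `(C, S)` is constant.
  have kA : ∀ t, C t * cos (τ t) + S t * sin (τ t) = C 0 := by
    intro t
    have hd : ∀ t, HasDerivAt (fun t => C t * cos (τ t) + S t * sin (τ t)) 0 t := fun t => by
      refine (((dC t).mul (dτ t).cos).add ((dS t).mul (dτ t).sin)).congr_deriv ?_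
      ring
    have := is_const_of_deriv_eq_zero (fun s => (hd s).differentiableAt) (fun s => (hd s).deriv) t 0
    simpa [τ0] using this
  have kB : ∀ t, S t * cos (τ t) - C t * sin (τ t) = S 0 := by
    intro t
    have hd : ∀ t, HasDerivAt (fun t => S t * cos (τ t) - C t * sin (τ t)) 0 t := fun t => by
      refine (((dS t).mul (dτ t).cos).sub ((dC t).mul (dτ t).sin)).congr_deriv ?_
      ring
    have := is_const_of_deriv_eq_zero (fun s => (hd s).differentiableAt) (fun s => (hd s).deriv) t 0
    simpa [τ0] using this
  obtain ⟨α, hα0, hα1⟩ : ∃ α, C 0 = e * cos α ∧ S 0 = e * sin α := by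
    have hn : ‖(⟨C 0, S 0⟩ : ℂ)‖ = e := by
      rw [Complex.norm_def, Complex.normSq_mk, ← sq, ← sq, hCS, sqrt_sq hA.e_nonneg]
    refine ⟨Complex.arg ⟨C 0, S 0⟩, ?_, ?_⟩
    · have := Complex.norm_mul_cos_arg ⟨C 0, S 0⟩
      rw [hn] at this; exact this.symm
    · have := Complex.norm_mul_sin_arg ⟨C 0, S 0⟩
      rw [hn] at this; exact this.symm
  have hCt : ∀ t, C t = e * cos (α + τ t) := by
    intro t
    rw [cos_add]
    have := sin_sq_add_cos_sq (τ t)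
    linear_combination cos (τ t) * kA t - sin (τ t) * kB t + cos (τ t) * hα0 - sin (τ t) * hα1 -
      C t * this
  have hSt : ∀ t, S t = e * sin (α + τ t) := by
    intro t
    rw [sin_add]
    have := sin_sq_add_cos_sq (τ t)
    linear_combination sin (τ t) * kA t + cos (τ t) * kB t + sin (τ t) * hα0 + cos (τ t) * hα1 -
      S t * this
  have hrt : ∀ t, γ t 2 = w ^ 2 * β / (1 + e * cos (α + τ t)) := by
    intro t
    have h2 := hr t
    rw [← hCt]
    simp only [hC]
    field_simp
    ring
  refine ⟨fun t => α + τ t, fun t => ?_, fun t => ?_⟩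
  · refine ((dτ t).const_add α).congr_deriv ?_
    have := hA.one_add_pos (α + τ t)
    rw [hrt, keplerSpeed]
    field_simp
  · have h0 : γ t 0 = e * sin (α + τ t) / (w * β) := by
      rw [← hSt]; simp only [hS]; field_simp
    ext i
    fin_cases i
    · exact h0
    · exact h1 t
    · exact hrt t
    · exact h.planar t

end IsAdmissible

theorem continuous_keplerSpeed (w β e : ℝ) : Continuous (keplerSpeed w β e) := by
  unfold keplerSpeed; fun_prop

theorem keplerSpeed_periodic (w β e : ℝ) : Function.Periodic (keplerSpeed w β e) (2 * π) :=
  fun θ => by simp only [keplerSpeed, cos_add_two_pi]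

theorem keplerPoint_add_two_pi (w β e θ : ℝ) :
    keplerPoint w β e (θ + 2 * π) = keplerPoint w β e θ := by
  simp only [keplerPoint, cos_add_two_pi, sin_add_two_pi]

/-- For `e > 0` the phase point determines the cosine and sine of the anomaly, so a period advances
the anomaly by a positive multiple of `2π`. For `e = 0` the orbit is a rest point and there is no
least period. -/
theorem IsAdmissible.isLeastPeriod {w a β e : ℝ} (hA : IsAdmissible w a β e) (he : 0 < e)
    {θ : ℝ → ℝ} (hθ : ∀ t, HasDerivAt θ (keplerSpeed w β e (θ t)) t) {T : ℝ} (hT : 0 < T)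
    (hadd : ∀ t, θ (t + T) = θ t + 2 * π) :
    IsLeastPeriod (fun t => keplerPoint w β e (θ t)) T := by
  have hmono : StrictMono θ := strictMono_of_deriv_pos fun t => by
    rw [(hθ t).deriv]; exact hA.keplerSpeed_pos _
  refine ⟨⟨hT, fun t => by simp only [hadd, keplerPoint_add_two_pi]⟩, ?_⟩
  rintro S ⟨hS, hper⟩
  have h0 := hper 0
  have hw := hA.w_pos
  have hb := hA.β_pos
  have e0 : e * sin (θ (0 + S)) / (w * β) = e * sin (θ 0) / (w * β) := congrFun h0 0
  have e2 : w ^ 2 * β / (1 + e * cos (θ (0 + S))) = w ^ 2 * β / (1 + e * cos (θ 0)) :=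
    congrFun h0 2
  have p1 := hA.one_add_pos (θ (0 + S))
  have p2 := hA.one_add_pos (θ 0)
  rw [zero_add] at e0 e2 p1
  have hs : sin (θ S) = sin (θ 0) := by field_simp at e0; exact e0
  have hc : cos (θ S) = cos (θ 0) := by
    field_simp at e2
    exact mul_left_cancel₀ he.ne' (by linarith)
  have h1 : cos (θ S - θ 0) = 1 := by
    rw [cos_sub, hs, hc]
    linarith [sin_sq_add_cos_sq (θ 0)]
  obtain ⟨n, hn⟩ := (cos_eq_one_iff _).1 h1
  have hpos : 0 < θ S - θ 0 := sub_pos.2 (hmono hS)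
  have hn0 : 0 < n := by
    rw [← hn] at hpos
    exact_mod_cast (pos_iff_pos_of_mul_pos hpos).2 two_pi_pos
  have hn1 : (1 : ℝ) ≤ n := by exact_mod_cast hn0
  have := two_pi_pos
  have hT0 := hadd 0
  rw [zero_add] at hT0
  exact hmono.le_iff_le.1 (by nlinarith)

/-! ### The variational equation along the Euler orbit -/

/-- The potential is even in `z`, so its mixed second derivative vanishes on `z = 0` and the
variational equation splits. Only the `(p_z, z)` block matters, so the coefficient `c` of the other
block stays unspecified. The transverse coefficient comes from `4 a⁻¹ (1 + 2a) = 4 a⁻¹ + 8 = 1 / β +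
7`. -/
theorem IsAdmissible.exists_fderiv_XH {w a β e : ℝ} (hA : IsAdmissible w a β e) {x : Phase}
    (hr : 0 < x 2) (hz : x 3 = 0) : ∃ c : ℝ, ∀ ξ : Phase, fderiv ℝ (XH w a) x ξ =
      ![c * ξ 2, -((1 + 7 * β) / β / x 2 ^ 3 * ξ 3), ξ 0, ξ 1] := by
  have ha := hA.a_pos
  have hb := hA.β_pos
  have hpos : 0 < x 2 ^ 2 + (1 + 2 * a) * x 3 ^ 2 := by positivity
  have hs : √(x 2 ^ 2 + (1 + 2 * a) * x 3 ^ 2) ^ 3 ≠ 0 := by positivity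
  have hcoord : ∀ i : Fin 4, DifferentiableAt ℝ (fun x : Phase => x i) x := fun i =>
    differentiableAt_apply i x
  have hroot : DifferentiableAt ℝ (fun x : Phase => √(x 2 ^ 2 + (1 + 2 * a) * x 3 ^ 2) ^ 3) x :=
    ((((hcoord 2).pow 2).add (((hcoord 3).pow 2).const_mul _)).sqrt hpos.ne').pow 3
  have hd : DifferentiableAt ℝ (XH w a) x := by
    rw [differentiableAt_pi]
    intro i
    fin_cases i
    · have g1 := (((hcoord 2).pow 3).inv (pow_pos hr 3).ne').const_mul (w ^ 2)
      have g2 := (((hcoord 2).pow 2).inv (pow_pos hr 2).ne').const_mul 1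
      have g3 := ((hcoord 2).const_mul (4 * a⁻¹)).mul (hroot.inv hs)
      show DifferentiableAt ℝ (fun x : Phase => -Vr w a (x 2) (x 3)) x
      simp only [Vr, div_eq_mul_inv]
      exact ((g1.neg.add g2).add g3).neg
    · have g3 := ((hcoord 3).const_mul (4 * a⁻¹ * (1 + 2 * a))).mul (hroot.inv hs)
      show DifferentiableAt ℝ (fun x : Phase => -Vz a (x 2) (x 3)) x
      simp only [Vz, div_eq_mul_inv]
      exact g3.neg
    · exact hcoord 0
    · exact hcoord 1
  refine ⟨-(3 * w ^ 2 / x 2 ^ 4 - 2 / x 2 ^ 3 + 4 * a⁻¹ * (-2 / x 2 ^ 3)), fun ξ => ?_⟩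
  have hline : HasDerivAt (fun t : ℝ => x + t • ξ) ξ 0 := by
    simpa using ((hasDerivAt_id (0 : ℝ)).smul_const ξ).const_add x
  have hx0 : x + (0 : ℝ) • ξ = x := by simp
  have h1 := HasFDerivAt.comp_hasDerivAt (0 : ℝ) (by rw [hx0]; exact hd.hasFDerivAt) hline
  have h2 := hasDerivAt_pi.1 h1
  have hi : ∀ i, HasDerivAt (fun t : ℝ => x i + t * ξ i) (ξ i) 0 := fun i => hasDerivAt_pi.1 hline i
  have hR := hi 2
  have hZ := hi 3
  set S : ℝ → ℝ := fun t => √((x 2 + t * ξ 2) ^ 2 + (1 + 2 * a) * (x 3 + t * ξ 3) ^ 2) with hS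
  have hroot0 : √(x 2 ^ 2 + (1 + 2 * a) * 0 ^ 2) = x 2 := by
    rw [show x 2 ^ 2 + (1 + 2 * a) * 0 ^ 2 = x 2 ^ 2 by ring, sqrt_sq hr.le]
  have hsq : HasDerivAt S (ξ 2) 0 := by
    refine (((hR.pow 2).add ((hZ.pow 2).const_mul (1 + 2 * a))).sqrt ?_).congr_deriv ?_
    · simpa using hpos.ne'
    · simp only [Pi.pow_apply, Pi.add_apply, zero_mul, add_zero, hz]
      rw [hroot0]
      field_simp
      ring
  have hsx : S 0 = x 2 := by
    simp only [hS]
    rw [zero_mul, zero_mul, add_zero, add_zero, hz, hroot0]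
  have hr2 : x 2 + 0 * ξ 2 = x 2 := by ring
  have hz2 : x 3 + 0 * ξ 3 = 0 := by rw [hz]; ring
  have hK : 4 * a⁻¹ * (1 + 2 * a) = (1 + 7 * β) / β := by
    have := hA.inv_mass
    have e1 : 4 * a⁻¹ * (1 + 2 * a) = 4 * a⁻¹ + 8 := by field_simp; ring
    rw [e1, this]; field_simp; ring
  ext i
  fin_cases i
  · refine (h2 0).unique ?_
    have g1 := (hasDerivAt_const (0 : ℝ) (w ^ 2)).div (hR.pow 3) (by rw [Pi.pow_apply, hr2]; positivity)
    have g2 := (hasDerivAt_const (0 : ℝ) (1 : ℝ)).div (hR.pow 2)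
      (by rw [Pi.pow_apply, hr2]; positivity)
    have g3 := (hR.const_mul (4 * a⁻¹)).div (hsq.pow 3) (by rw [Pi.pow_apply, hsx]; positivity)
    refine ((g1.neg.add g2).add g3).neg.congr_deriv ?_
    simp only [Pi.pow_apply, hsx, hr2]
    show _ = -(3 * w ^ 2 / x 2 ^ 4 - 2 / x 2 ^ 3 + 4 * a⁻¹ * (-2 / x 2 ^ 3)) * ξ 2
    field_simp
    ring
  · refine (h2 1).unique ?_
    have g3 := (hZ.const_mul (4 * a⁻¹ * (1 + 2 * a))).div (hsq.pow 3)
      (by rw [Pi.pow_apply, hsx]; positivity)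
    refine g3.neg.congr_deriv ?_
    simp only [Pi.pow_apply, hsx, hz2]
    show _ = -((1 + 7 * β) / β / x 2 ^ 3 * ξ 3)
    rw [hK]
    field_simp
    ring
  · exact (h2 2).unique (hi 0)
  · exact (h2 3).unique (hi 1)

/-! ### Solutions of the variational equation -/

/-- The change of variables from solutions `(u', u)` of Hill's equation, with the true anomaly as
independent variable, to the components `(ξ 1, ξ 3)` of solutions of the variational equation. -/
noncomputable def keplerFrame (w β e θ : ℝ) : Matrix (Fin 2) (Fin 2) ℝ :=
  !![w / keplerPoint w β e θ 2, keplerPoint w β e θ 0; 0, keplerPoint w β e θ 2]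

namespace IsAdmissible

variable {w a β e : ℝ} (hA : IsAdmissible w a β e)

/-- The potential of the transverse variational equation of the Euler orbit. -/
noncomputable def potential (hA : IsAdmissible w a β e) : Potential := hill (7 * β) e hA.abs_e_lt

/-- The fundamental matrix of the transverse variational equation at true anomaly `θ`. -/
noncomputable def trans (hA : IsAdmissible w a β e) (θ : ℝ) : Matrix (Fin 2) (Fin 2) ℝ :=
  keplerFrame w β e θ * hA.potential.fund θ

theorem det_trans (θ : ℝ) : (hA.trans θ).det = w := by
  have := hA.keplerPoint_r_pos θ
  rw [trans, Matrix.det_mul, Potential.det_fund, keplerFrame, Matrix.det_fin_two_of]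
  field_simp
  ring

theorem trans_add_two_pi (θ : ℝ) : hA.trans (θ + 2 * π) = hA.trans θ * hA.potential.mono := by
  rw [trans, Potential.fund_add_period, keplerFrame, keplerPoint_add_two_pi, ← mul_assoc]
  rfl

theorem isUnit_det_trans (θ : ℝ) : IsUnit (hA.trans θ).det := by
  rw [det_trans]; exact hA.w_pos.ne'.isUnit

theorem trans_mulVec_apply (θ : ℝ) (k : Fin 2 → ℝ) : (hA.trans θ).mulVec k =
    ![w / keplerPoint w β e θ 2 * (hA.potential.fund θ).mulVec k 0 +
        keplerPoint w β e θ 0 * (hA.potential.fund θ).mulVec k 1,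
      keplerPoint w β e θ 2 * (hA.potential.fund θ).mulVec k 1] := by
  rw [trans, ← Matrix.mulVec_mulVec]
  generalize (hA.potential.fund θ).mulVec k = y
  ext i
  fin_cases i <;> simp [keplerFrame, Matrix.mulVec, dotProduct, Fin.sum_univ_two]

include hA in
-- Put `z = r u` with `dθ/dt = w / r²`; then `p_z = (w / r) u' + p_r u`, which is the first row of
-- `keplerFrame`. The radial equation contributes `1 - r / (β w²)` to the coefficient of `u`, the
-- transverse force `(1 + 7β) r / (β w²)`, and the sum is `1 + 7β / (1 + e cos θ)`.
theorem hasDerivAt_trans {θ : ℝ → ℝ} (hθ : ∀ t, HasDerivAt θ (keplerSpeed w β e (θ t)) t)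
    (k : Fin 2 → ℝ) (t : ℝ) :
    HasDerivAt (fun t => (hA.trans (θ t)).mulVec k 1) ((hA.trans (θ t)).mulVec k 0) t ∧
    HasDerivAt (fun t => (hA.trans (θ t)).mulVec k 0)
      (-((1 + 7 * β) / β / keplerPoint w β e (θ t) 2 ^ 3 * (hA.trans (θ t)).mulVec k 1)) t := by
  have hb := hA.β_pos
  have hw := hA.w_pos
  have hC := hA.one_add_pos (θ t)
  have hsol := (hA.isEulerOrbit hθ).solution t
  rw [hA.XH_keplerPoint, hasDerivAt_pi] at hsol
  have d0 : HasDerivAt (fun t => keplerPoint w β e (θ t) 0)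
    (keplerSpeed w β e (θ t) * (e * cos (θ t) / (w * β))) t := hsol 0
  have d2 : HasDerivAt (fun t => keplerPoint w β e (θ t) 2) (e * sin (θ t) / (w * β)) t := hsol 2
  have hrpos := hA.keplerPoint_r_pos (θ t)
  obtain ⟨hu, hv⟩ := hA.potential.isHillSol_fund k
  have du := (hu (θ t)).comp t (hθ t)
  have dv := (hv (θ t)).comp t (hθ t)
  have hq : hA.potential.q (θ t) = 1 + 7 * β / (1 + e * cos (θ t)) := rfl
  have e0 : keplerPoint w β e (θ t) 0 = e * sin (θ t) / (w * β) := rfl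
  have e2 : keplerPoint w β e (θ t) 2 = w ^ 2 * β / (1 + e * cos (θ t)) := rfl
  simp only [trans_mulVec_apply, Matrix.cons_val_zero, Matrix.cons_val_one]
  constructor
  · refine (d2.mul du).congr_deriv ?_
    simp only [Function.comp]
    rw [e0, e2, keplerSpeed]
    field_simp
    ring
  · refine ((((hasDerivAt_const t w).div d2 hrpos.ne').mul dv).add (d0.mul du)).congr_deriv ?_
    simp only [Function.comp, Pi.div_apply]
    rw [hq, e0, e2, keplerSpeed]
    field_simp
    ring

include hA in
-- The difference of the two sides starts at zero, so its Wronskians with the columns of an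
-- invertible fundamental matrix vanish for all time.
theorem exists_eq_trans {θ : ℝ → ℝ} (hθ : ∀ t, HasDerivAt θ (keplerSpeed w β e (θ t)) t)
    {y z : ℝ → ℝ} (hz : ∀ t, HasDerivAt z (y t) t)
    (hy : ∀ t, HasDerivAt y (-((1 + 7 * β) / β / keplerPoint w β e (θ t) 2 ^ 3 * z t)) t) (t : ℝ) :
    ![y t, z t] = (hA.trans (θ t)).mulVec ((hA.trans (θ 0))⁻¹.mulVec ![y 0, z 0]) := by
  set k := (hA.trans (θ 0))⁻¹.mulVec ![y 0, z 0] with hk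
  have hinv : ∀ x b, (hA.trans x).mulVec ((hA.trans x)⁻¹.mulVec b) = b := fun x b => by
    rw [Matrix.mulVec_mulVec, Matrix.mul_nonsing_inv _ (hA.isUnit_det_trans x), Matrix.one_mulVec]
  have h0 : (hA.trans (θ 0)).mulVec k = ![y 0, z 0] := hinv _ _
  have hd := hA.hasDerivAt_trans hθ
  have hW : ∀ k' t, (z t - (hA.trans (θ t)).mulVec k 1) * (hA.trans (θ t)).mulVec k' 0 -
      (y t - (hA.trans (θ t)).mulVec k 0) * (hA.trans (θ t)).mulVec k' 1 = 0 := by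
    intro k' t
    have hder : ∀ t, HasDerivAt (fun t =>
        (z t - (hA.trans (θ t)).mulVec k 1) * (hA.trans (θ t)).mulVec k' 0 -
        (y t - (hA.trans (θ t)).mulVec k 0) * (hA.trans (θ t)).mulVec k' 1) 0 t := by
      intro t
      refine ((((hz t).sub (hd k t).1).mul (hd k' t).2).sub
        (((hy t).sub (hd k t).2).mul (hd k' t).1)).congr_deriv ?_
      simp only [Pi.sub_apply]
      ring
    have := is_const_of_deriv_eq_zero (fun s => (hder s).differentiableAt)
      (fun s => (hder s).deriv) t 0
    rw [this, h0]
    simp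
  have h1 := hW ((hA.trans (θ t))⁻¹.mulVec ![1, 0]) t
  have h2 := hW ((hA.trans (θ t))⁻¹.mulVec ![0, 1]) t
  rw [hinv] at h1 h2
  simp only [Matrix.cons_val_zero, Matrix.cons_val_one] at h1 h2
  ext i
  fin_cases i
  · show y t = (hA.trans (θ t)).mulVec k 0
    linarith
  · show z t = (hA.trans (θ t)).mulVec k 1
    linarith

end IsAdmissible

/-! ### Transverse frames -/

/-- The frame `(E₁, E₂)` spans the `(p_z, z)`-plane and is obtained from the standard basis of this
plane by a rotation by `α t` and a dilation by `σ t`. -/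
structure IsTransverseFrame (E₁ E₂ : ℝ → Phase) (σ α : ℝ → ℝ) : Prop where
  pos : ∀ t, 0 < σ t
  cont : Continuous α
  fst : ∀ t, E₁ t = ![0, σ t * cos (α t), 0, σ t * sin (α t)]
  snd : ∀ t, E₂ t = ![0, -(σ t * sin (α t)), 0, σ t * cos (α t)]

/-- The matrix of the transverse frame. -/
noncomputable def frameMatrix (σ α : ℝ) : Matrix (Fin 2) (Fin 2) ℝ :=
  !![σ * cos α, -(σ * sin α); σ * sin α, σ * cos α]

theorem det_frameMatrix (σ α : ℝ) : (frameMatrix σ α).det = σ ^ 2 := by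
  rw [frameMatrix, Matrix.det_fin_two_of]
  linear_combination σ ^ 2 * sin_sq_add_cos_sq α

theorem isUnit_det_frameMatrix {σ : ℝ} (hσ : 0 < σ) (α : ℝ) : IsUnit (frameMatrix σ α).det := by
  rw [det_frameMatrix]; exact (pow_pos hσ 2).ne'.isUnit

theorem frameMatrix_mulVec_apply (σ α : ℝ) (v : Fin 2 → ℝ) : (frameMatrix σ α).mulVec v =
    ![v 0 * (σ * cos α) + v 1 * -(σ * sin α), v 0 * (σ * sin α) + v 1 * (σ * cos α)] := by
  ext i
  fin_cases i <;> simp [frameMatrix, Matrix.mulVec, dotProduct, Fin.sum_univ_two] <;> ring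

namespace IsAdmissible

variable {w a β e : ℝ} (hA : IsAdmissible w a β e) {θ : ℝ → ℝ}
  (hθ : ∀ t, HasDerivAt θ (keplerSpeed w β e (θ t)) t) {E₁ E₂ : ℝ → Phase} {σ α : ℝ → ℝ}
  (hE : IsTransverseFrame E₁ E₂ σ α)
include hA hθ hE

/-- Along the orbit `X_H` has no `p_z` and `z` components, so reading off these coordinates removes
the unknown multiple of `X_H`. This determines the path `Ψ` completely. -/
theorem frameMatrix_mul_eq {Ψ : ℝ → Matrix (Fin 2) (Fin 2) ℝ}
    (hΨ : IsLinearizedPath w a (fun t => keplerPoint w β e (θ t)) E₁ E₂ Ψ) (t : ℝ) :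
    frameMatrix (σ t) (α t) * Ψ t =
      hA.trans (θ t) * ((hA.trans (θ 0))⁻¹ * frameMatrix (σ 0) (α 0)) := by
  obtain ⟨h0, h⟩ := hΨ
  refine Matrix.mulVec_injective (funext fun v => ?_)
  obtain ⟨ξ, c, hξ, he⟩ := h v
  have hcomp : ∀ t, ![ξ t 1, ξ t 3] = (frameMatrix (σ t) (α t)).mulVec ((Ψ t).mulVec v) := by
    intro t
    rw [frameMatrix_mulVec_apply, he t, hE.fst, hE.snd, hA.XH_keplerPoint]
    simp
  have d := fun t => hasDerivAt_pi.1 (hξ t)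
  have hz : ∀ t, HasDerivAt (fun t => ξ t 3) (ξ t 1) t := by
    intro t
    obtain ⟨c, hc⟩ := hA.exists_fderiv_XH (hA.keplerPoint_r_pos (θ t)) rfl
    have := d t 3
    rw [hc] at this
    exact this
  have hy : ∀ t, HasDerivAt (fun t => ξ t 1)
      (-((1 + 7 * β) / β / keplerPoint w β e (θ t) 2 ^ 3 * ξ t 3)) t := by
    intro t
    obtain ⟨c, hc⟩ := hA.exists_fderiv_XH (hA.keplerPoint_r_pos (θ t)) rfl
    have := d t 1
    rw [hc] at this
    exact this
  have := hA.exists_eq_trans hθ hz hy t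
  rw [hcomp, hcomp, h0, Matrix.one_mulVec, Matrix.mulVec_mulVec, Matrix.mulVec_mulVec,
    Matrix.mulVec_mulVec] at this
  rw [this, mul_assoc]

theorem exists_isLinearizedPath :
    ∃ Ψ, IsLinearizedPath w a (fun t => keplerPoint w β e (θ t)) E₁ E₂ Ψ := by
  set k : Matrix (Fin 2) (Fin 2) ℝ := (hA.trans (θ 0))⁻¹ * frameMatrix (σ 0) (α 0) with hk
  have hG := fun t => isUnit_det_frameMatrix (hE.pos t) (α t)
  refine ⟨fun t => (frameMatrix (σ t) (α t))⁻¹ * (hA.trans (θ t) * k), ?_, fun v =>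
    ⟨fun t => ![0, (hA.trans (θ t)).mulVec (k.mulVec v) 0, 0,
      (hA.trans (θ t)).mulVec (k.mulVec v) 1], fun _ => 0, fun t => ?_, fun t => ?_⟩⟩
  · show (frameMatrix (σ 0) (α 0))⁻¹ * (hA.trans (θ 0) * k) = 1
    rw [hk, Matrix.mul_nonsing_inv_cancel_left _ _ (hA.isUnit_det_trans _),
      Matrix.nonsing_inv_mul _ (hG 0)]
  · obtain ⟨c, hc⟩ := hA.exists_fderiv_XH (hA.keplerPoint_r_pos (θ t)) rfl
    have hd := hA.hasDerivAt_trans hθ (k.mulVec v) t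
    rw [hc, hasDerivAt_pi]
    intro i
    fin_cases i
    · simpa using hasDerivAt_const t (0 : ℝ)
    · simpa using hd.2
    · simpa using hasDerivAt_const t (0 : ℝ)
    · simpa using hd.1
  · have key : (frameMatrix (σ t) (α t)).mulVec
        (((frameMatrix (σ t) (α t))⁻¹ * (hA.trans (θ t) * k)).mulVec v) =
        (hA.trans (θ t)).mulVec (k.mulVec v) := by
      rw [Matrix.mulVec_mulVec, Matrix.mul_nonsing_inv_cancel_left _ _ (hG t), Matrix.mulVec_mulVec]
    rw [frameMatrix_mulVec_apply] at key
    beta_reduce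
    rw [← key, hE.fst, hE.snd]
    ext i
    fin_cases i <;> simp

/-- After one period the frame returns to itself, so `Ψ T` is conjugate to the monodromy matrix. -/
theorem det_trace_eq {Ψ : ℝ → Matrix (Fin 2) (Fin 2) ℝ}
    (hΨ : IsLinearizedPath w a (fun t => keplerPoint w β e (θ t)) E₁ E₂ Ψ) {T : ℝ}
    (hadd : θ (0 + T) = θ 0 + 2 * π)
    (hGT : frameMatrix (σ T) (α T) = frameMatrix (σ 0) (α 0)) :
    (Ψ T).det = 1 ∧ (Ψ T).trace = hA.potential.mono.trace := by
  have h := hA.frameMatrix_mul_eq hθ hE hΨ T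
  rw [zero_add] at hadd
  rw [hGT, hadd, trans_add_two_pi] at h
  have hG := isUnit_det_frameMatrix (hE.pos 0) (α 0)
  set G := frameMatrix (σ 0) (α 0)
  set N := hA.trans (θ 0)
  have hN := hA.isUnit_det_trans (θ 0)
  have h1 : Ψ T = (N⁻¹ * G)⁻¹ * (hA.potential.mono * (N⁻¹ * G)) := by
    rw [Matrix.mul_inv_rev, Matrix.nonsing_inv_nonsing_inv _ hN, mul_assoc G⁻¹, ← mul_assoc N, ← h,
      Matrix.nonsing_inv_mul_cancel_left _ _ hG]
  have hP : IsUnit (N⁻¹ * G).det := by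
    rw [Matrix.det_mul]
    exact (Matrix.isUnit_nonsing_inv_det _ hN).mul hG
  constructor
  · rw [h1, Matrix.det_mul, Matrix.det_mul, Potential.det_mono, one_mul, ← Matrix.det_mul,
      Matrix.nonsing_inv_mul _ hP, Matrix.det_one]
  · rw [h1, Matrix.trace_mul_comm, mul_assoc, Matrix.mul_nonsing_inv _ hP, mul_one]

/-- The argument of `Ψ t v` is the angle of the solution in the `(p_z, z)`-plane minus the angle `α`
of the frame. The first differs by at most `π` from a Prüfer angle, hence by a bounded amount from
`rot / 2 · θ`; the second is `-(1 - m) θ` up to a bounded error; and `θ` is `2πt / T` up to a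
bounded error. -/
theorem hasRotationNumber {Ψ : ℝ → Matrix (Fin 2) (Fin 2) ℝ}
    (hΨ : IsLinearizedPath w a (fun t => keplerPoint w β e (θ t)) E₁ E₂ Ψ) {T : ℝ} (hT : 0 < T)
    (hadd : ∀ t, θ (t + T) = θ t + 2 * π) {m B : ℝ} (hαB : ∀ t, |α t + (1 - m) * θ t| ≤ B) :
    HasRotationNumber Ψ T (1 + hA.potential.rot / 2 - m) := by
  intro v hv
  set Q := hA.potential with hQ
  have hθc : Continuous θ := continuous_iff_continuousAt.2 fun t => (hθ t).continuousAt
  have hG := fun t => isUnit_det_frameMatrix (hE.pos t) (α t)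
  have hN := hA.isUnit_det_trans (θ 0)
  set P : Matrix (Fin 2) (Fin 2) ℝ := (hA.trans (θ 0))⁻¹ * frameMatrix (σ 0) (α 0) with hP
  have hPv : P.mulVec v ≠ 0 := by
    intro h
    have h1 : (frameMatrix (σ 0) (α 0)).mulVec v = 0 := by
      rw [← Matrix.mul_nonsing_inv_cancel_left (hA.trans (θ 0)) (frameMatrix (σ 0) (α 0)) hN,
        ← Matrix.mulVec_mulVec, ← hP, h, Matrix.mulVec_zero]
    refine hv ?_
    rw [← Matrix.one_mulVec v, ← Matrix.nonsing_inv_mul _ (hG 0), ← Matrix.mulVec_mulVec, h1,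
      Matrix.mulVec_zero]
  obtain ⟨ρ, x, hρ, hx⟩ : ∃ ρ x : ℝ, 0 < ρ ∧ P.mulVec v = ρ • ![cos x, sin x] := by
    set z : ℂ := ⟨P.mulVec v 0, P.mulVec v 1⟩ with hz
    have hz0 : z ≠ 0 := by
      intro h
      refine hPv (funext fun i => ?_)
      fin_cases i
      · exact congrArg Complex.re h
      · exact congrArg Complex.im h
    refine ⟨‖z‖, z.arg, norm_pos_iff.2 hz0, ?_⟩
    ext i
    fin_cases i
    · exact (Complex.norm_mul_cos_arg z).symm
    · exact (Complex.norm_mul_sin_arg z).symm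
  have hw := hA.w_pos
  have hr := fun t => hA.keplerPoint_r_pos (θ t)
  set χ : ℝ → ℝ := fun t => triAngle (w / keplerPoint w β e (θ t) 2) (keplerPoint w β e (θ t) 0)
    (keplerPoint w β e (θ t) 2) (Q.angle x (θ t)) with hχ
  have hkc : ∀ i, Continuous fun t => keplerPoint w β e (θ t) i := fun i =>
    continuous_iff_continuousAt.2 fun t =>
      (hasDerivAt_pi.1 ((hA.isEulerOrbit hθ).solution t) i).continuousAt
  have hχc : Continuous χ :=
    triAngle_continuous_comp (continuous_const.div (hkc 2) fun t => (hr t).ne') (hkc 0) (hkc 2)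
      ((Q.isPrufer_angle x).continuous.comp hθc) (fun t => div_pos hw (hr t)) hr
  refine ⟨fun t => χ t - α t, hχc.sub hE.cont, fun t => ?_, ?_⟩
  · set τ := ‖triVec (w / keplerPoint w β e (θ t) 2) (keplerPoint w β e (θ t) 0)
      (keplerPoint w β e (θ t) 2) (Q.angle x (θ t))‖ with hτ
    have hτ0 : 0 < τ := norm_triVec_pos (div_pos hw (hr t)) (hr t) _ _
    obtain ⟨c1, c2⟩ := norm_triVec_mul_cos (w / keplerPoint w β e (θ t) 2)
      (keplerPoint w β e (θ t) 0) (keplerPoint w β e (θ t) 2) (Q.angle x (θ t))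
    have hσ := hE.pos t
    have hamp := Q.amp_pos x (θ t)
    have h1 : (hA.trans (θ t)).mulVec (P.mulVec v) =
        (ρ * Q.amp x (θ t) * τ) • ![cos (χ t), sin (χ t)] := by
      rw [hx, Matrix.mulVec_smul, trans_mulVec_apply, Q.fund_mulVec_angle]
      ext i
      fin_cases i
      · simp
        linear_combination (-(ρ * Q.amp x (θ t))) * c1
      · simp
        linear_combination (-(ρ * Q.amp x (θ t))) * c2
    refine ⟨ρ * Q.amp x (θ t) * τ / σ t, by positivity, ?_⟩
    refine Matrix.mulVec_injective_of_isUnit (Matrix.isUnit_iff_isUnit_det _ |>.2 (hG t)) ?_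
    show (frameMatrix (σ t) (α t)).mulVec _ = (frameMatrix (σ t) (α t)).mulVec _
    rw [Matrix.mulVec_mulVec, hA.frameMatrix_mul_eq hθ hE hΨ, ← Matrix.mulVec_mulVec, h1,
      frameMatrix_mulVec_apply]
    have hs := sin_sq_add_cos_sq (α t)
    ext i
    fin_cases i
    · simp only [Fin.zero_eta, Pi.smul_apply, Matrix.cons_val_zero, Matrix.cons_val_one, smul_eq_mul,
        cos_sub, sin_sub]
      field_simp
      linear_combination (-cos (χ t)) * hs
    · simp only [Fin.mk_one, Pi.smul_apply, Matrix.cons_val_zero, Matrix.cons_val_one, smul_eq_mul,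
        cos_sub, sin_sub]
      field_simp
      linear_combination (-sin (χ t)) * hs
  · obtain ⟨B₁, hB₁⟩ := Q.abs_angle_sub_le x
    obtain ⟨B₂, hB₂⟩ := exists_abs_sub_le_of_add_period hθc hT hadd
    have hp := pi_pos
    have hlim : Tendsto θ atTop atTop := by
      have h1 : Tendsto (fun t => 2 * π / T * t - B₂) atTop atTop :=
        tendsto_atTop_add_const_right _ _ (tendsto_id.const_mul_atTop (by positivity))
      exact tendsto_atTop_mono (fun t => by linarith [(abs_le.1 (hB₂ t)).1]) h1
    refine tendsto_of_abs_sub_le (B := π + B₁ + |Q.rot / 2 + (1 - m)| * B₂ + B) hT ?_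
    filter_upwards [hlim.eventually_ge_atTop 0] with t ht
    have b1 := hB₁ _ ht
    have b2 := abs_triAngle_sub_le (w / keplerPoint w β e (θ t) 2) (keplerPoint w β e (θ t) 0)
      (keplerPoint w β e (θ t) 2) (Q.angle x (θ t))
    have b3 := hαB t
    have b4 : |(Q.rot / 2 + (1 - m)) * (θ t - 2 * π / T * t)| ≤ |Q.rot / 2 + (1 - m)| * B₂ := by
      rw [abs_mul]; gcongr; exact hB₂ t
    have e1 : χ t - α t - (1 + Q.rot / 2 - m) * (2 * π / T) * t =
      (χ t - Q.angle x (θ t)) + (Q.angle x (θ t) - Q.rot / 2 * θ t) +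
        (Q.rot / 2 + (1 - m)) * (θ t - 2 * π / T * t) - (α t + (1 - m) * θ t) := by ring
    rw [e1, abs_le]
    rw [abs_le] at b1 b2 b3 b4
    constructor <;> linarith

end IsAdmissible

/-! ### The rotation number of the Euler orbit -/

namespace IsAdmissible

variable {w a β e : ℝ} (hA : IsAdmissible w a β e)
include hA

/-- As a complex number in the `(p_z, z)`-plane, `X₁` is `g = -∂V/∂r - i p_r`, and `g exp (iθ)` has
positive real part when `e > 0`. So the frame turns by `-θ` up to a bounded error, which is the
origin of the summand `1` in `ρ_e = 1 + rot / 2`. -/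
theorem exists_isTransverseFrame (he : 0 < e) {θ : ℝ → ℝ} (hθ : Continuous θ) :
    ∃ σ α : ℝ → ℝ, IsTransverseFrame (fun t => X₁ w a (keplerPoint w β e (θ t)))
        (fun t => X₂ w a (keplerPoint w β e (θ t))) σ α ∧
      (∀ t, |α t + (1 - 0) * θ t| ≤ π) ∧
      ∀ s t, θ s = θ t + 2 * π → frameMatrix (σ s) (α s) = frameMatrix (σ t) (α t) := by
  have hw := hA.w_pos
  have hb := hA.β_pos
  set g : ℝ → ℂ := fun x => ((keplerSpeed w β e x * (e * cos x / (w * β)) : ℝ) : ℂ) -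
    ((e * sin x / (w * β) : ℝ) : ℂ) * Complex.I with hg
  set f : ℝ → ℂ := fun x => g x * Complex.exp (x * Complex.I) with hf
  have gre : ∀ x, (g x).re = keplerSpeed w β e x * (e * cos x / (w * β)) := fun x => by
    simp only [hg, Complex.sub_re, Complex.ofReal_re, Complex.re_ofReal_mul, Complex.I_re]
    ring
  have gim : ∀ x, (g x).im = -(e * sin x / (w * β)) := fun x => by
    simp only [hg, Complex.sub_im, Complex.ofReal_im, Complex.im_ofReal_mul, Complex.I_im]
    ring
  have hgc : Continuous g := by
    have := continuous_keplerSpeed w β e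
    simp only [hg]; fun_prop
  have hfc : Continuous f := by simp only [hf]; fun_prop
  have hslit : ∀ x, f x ∈ Complex.slitPlane := by
    intro x
    left
    have e1 : (f x).re = e / (w * β) * (keplerSpeed w β e x * cos x ^ 2 + sin x ^ 2) := by
      simp only [hf]
      rw [Complex.mul_re, Complex.exp_ofReal_mul_I_re, Complex.exp_ofReal_mul_I_im, gre, gim]
      ring
    rw [e1]
    have hs := hA.keplerSpeed_pos x
    have h1 := sin_sq_add_cos_sq x
    refine mul_pos (by positivity) ?_
    rcases eq_or_ne (cos x) 0 with h | h
    · rw [h] at h1 ⊢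
      linarith
    · positivity
  have hper : ∀ x, g (x + 2 * π) = g x := fun x => by
    simp only [hg, cos_add_two_pi, sin_add_two_pi, keplerSpeed_periodic w β e x]
  have key : ∀ x, (‖f x‖ : ℂ) * Complex.exp (((f x).arg - x : ℝ) * Complex.I) = g x := by
    intro x
    have := Complex.norm_mul_exp_arg_mul_I (f x)
    push_cast
    rw [sub_mul, Complex.exp_sub, ← mul_div_assoc, this]
    exact mul_div_cancel_right₀ _ (Complex.exp_ne_zero _)
  have keyre : ∀ x, ‖f x‖ * cos ((f x).arg - x) = keplerSpeed w β e x * (e * cos x / (w * β)) := by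
    intro x
    have h := congrArg Complex.re (key x)
    rw [Complex.re_ofReal_mul, Complex.exp_ofReal_mul_I_re] at h
    rw [h, gre]
  have keyim : ∀ x, ‖f x‖ * sin ((f x).arg - x) = -(e * sin x / (w * β)) := by
    intro x
    have h := congrArg Complex.im (key x)
    rw [Complex.im_ofReal_mul, Complex.exp_ofReal_mul_I_im] at h
    rw [h, gim]
  have e0 : ∀ t, keplerPoint w β e (θ t) 0 = e * sin (θ t) / (w * β) := fun t => rfl
  have e1 : ∀ t, keplerPoint w β e (θ t) 1 = 0 := fun t => rfl
  have e3 : ∀ t, keplerPoint w β e (θ t) 3 = 0 := fun t => rfl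
  refine ⟨fun t => ‖f (θ t)‖, fun t => (f (θ t)).arg - θ t, ⟨fun t =>
    norm_pos_iff.2 (Complex.slitPlane_ne_zero (hslit _)), ?_, fun t => ?_, fun t => ?_⟩,
    fun t => ?_, fun s t hst => ?_⟩
  · refine Continuous.sub (continuous_iff_continuousAt.2 fun t => ?_) hθ
    exact ContinuousAt.comp (g := Complex.arg) (Complex.continuousAt_arg (hslit _))
      (hfc.comp hθ).continuousAt
  · rw [X₁, keyre, keyim, hA.Vr_keplerPoint, e0, e1, e3, Vz_zero, neg_neg]
  · rw [X₂, keyre, keyim, hA.Vr_keplerPoint, e0, e1, e3, Vz_zero, neg_neg, neg_neg, neg_zero]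
  · have : (f (θ t)).arg - θ t + (1 - 0) * θ t = (f (θ t)).arg := by ring
    rw [this]
    exact Complex.abs_arg_le_pi _
  · simp only [frameMatrix, keyre, keyim, hst, cos_add_two_pi, sin_add_two_pi,
      keplerSpeed_periodic w β e (θ t)]

end IsAdmissible

theorem isTransverseFrame_const :
    IsTransverseFrame (fun _ => ![0, 1, 0, 0]) (fun _ => ![0, 0, 0, 1]) (fun _ => 1) fun _ => 0 :=
  ⟨fun _ => one_pos, continuous_const, fun _ => by simp, fun _ => by simp⟩

theorem keplerSpeed_zero (w β θ : ℝ) : keplerSpeed w β 0 θ = 1 / (w ^ 3 * β ^ 2) := by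
  simp [keplerSpeed]

theorem keplerPoint_zero (w β θ : ℝ) : keplerPoint w β 0 θ 2 = w ^ 2 * β := by
  show w ^ 2 * β / (1 + 0 * cos θ) = _
  simp

theorem IsAdmissible.add_period_zero {w a β : ℝ} (hA : IsAdmissible w a β 0) {θ : ℝ → ℝ}
    (hθ : ∀ t, HasDerivAt θ (keplerSpeed w β 0 (θ t)) t) (t : ℝ) :
    θ (t + 2 * π * (w ^ 2 * β) ^ 2 / w) = θ t + 2 * π := by
  have hw := hA.w_pos
  have hb := hA.β_pos
  have hd : ∀ t, HasDerivAt (fun t => θ t - 1 / (w ^ 3 * β ^ 2) * t) 0 t := fun t => by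
    refine ((hθ t).sub ((hasDerivAt_id t).const_mul _)).congr_deriv ?_
    rw [keplerSpeed_zero]; ring
  have := is_const_of_deriv_eq_zero (fun s => (hd s).differentiableAt) (fun s => (hd s).deriv)
    (t + 2 * π * (w ^ 2 * β) ^ 2 / w) t
  have e1 : 1 / (w ^ 3 * β ^ 2) * (t + 2 * π * (w ^ 2 * β) ^ 2 / w) =
      1 / (w ^ 3 * β ^ 2) * t + 2 * π := by field_simp
  rw [e1] at this
  linarith

/-! ### Rotation number and hyperbolicity of the Euler orbit, read off from Hill's equation. -/

section

variable {β e : ℝ} (hβ : β ∈ Ioo (0 : ℝ) 1) (he : e ∈ Ico (0 : ℝ) 1)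
include hβ he

/-- Every admissible choice of `γ`, `T`, `Ψ` and `m` gives the same invariants, since any Euler
orbit is a reparametrized Kepler orbit. This makes the existential definitions unambiguous and
treats `e > 0` and `e = 0` alike. -/
theorem IsEulerTransverseFlow.properties (h1 : |e| < 1) {T m : ℝ}
    {Ψ : ℝ → Matrix (Fin 2) (Fin 2) ℝ} (h : IsEulerTransverseFlow β e T Ψ m) :
    HasRotationNumber Ψ T (1 + (hill (7 * β) e h1).rot / 2 - m) ∧ (Ψ T).det = 1 ∧
      (Ψ T).trace = (hill (7 * β) e h1).mono.trace := by
  have hA := isAdmissible hβ he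
  obtain ⟨γ, hγ, h⟩ := h
  obtain ⟨θ, hθ, hγθ⟩ := hA.exists_anomaly hγ
  obtain rfl : γ = fun t => keplerPoint (angMom β e) β e (θ t) := funext hγθ
  rcases h with ⟨he0, hT, rfl, hΨ⟩ | ⟨rfl, hT, rfl, hΨ⟩
  · obtain ⟨S, hS, -, hadd⟩ := exists_period_of_pos (continuous_keplerSpeed _ _ _)
      hA.keplerSpeed_pos (keplerSpeed_periodic _ _ _)
    obtain rfl : T = S := hT.unique (hA.isLeastPeriod he0 hθ hS (hadd θ hθ))
    obtain ⟨σ, α, hE, hB, hG⟩ := hA.exists_isTransverseFrame he0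
      (continuous_iff_continuousAt.2 fun t => (hθ t).continuousAt)
    exact ⟨hA.hasRotationNumber hθ hE hΨ hS (hadd θ hθ) hB,
      hA.det_trace_eq hθ hE hΨ (hadd θ hθ 0) (hG _ _ (by simpa using hadd θ hθ 0))⟩
  · beta_reduce at hT
    rw [keplerPoint_zero] at hT
    subst hT
    have hw := hA.w_pos
    have hb := hA.β_pos
    have hp := pi_pos
    exact ⟨hA.hasRotationNumber hθ isTransverseFrame_const hΨ (by positivity)
      (hA.add_period_zero hθ) (B := 0) (fun t => by simp),
      hA.det_trace_eq hθ isTransverseFrame_const hΨ (hA.add_period_zero hθ 0) rfl⟩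

theorem exists_isEulerTransverseFlow : ∃ T Ψ m, IsEulerTransverseFlow β e T Ψ m := by
  have hA := isAdmissible hβ he
  obtain ⟨T, hT, ⟨θ, hθ⟩, hadd⟩ := exists_period_of_pos (continuous_keplerSpeed _ _ _)
    hA.keplerSpeed_pos (keplerSpeed_periodic _ _ _)
  rcases he.1.eq_or_lt with rfl | he0
  · obtain ⟨Ψ, hΨ⟩ := hA.exists_isLinearizedPath hθ isTransverseFrame_const
    exact ⟨_, Ψ, 1, _, hA.isEulerOrbit hθ, Or.inr ⟨rfl, rfl, rfl, hΨ⟩⟩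
  · obtain ⟨σ, α, hE, -, -⟩ := hA.exists_isTransverseFrame he0
      (continuous_iff_continuousAt.2 fun t => (hθ t).continuousAt)
    obtain ⟨Ψ, hΨ⟩ := hA.exists_isLinearizedPath hθ hE
    exact ⟨T, Ψ, 0, _, hA.isEulerOrbit hθ,
      Or.inl ⟨he0, hA.isLeastPeriod he0 hθ hT (hadd θ hθ), rfl, hΨ⟩⟩

theorem hasEulerRotationNumber_iff (h1 : |e| < 1) {ρ : ℝ} :
    HasEulerRotationNumber β e ρ ↔ ρ = 1 + (hill (7 * β) e h1).rot / 2 := by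
  constructor
  · rintro ⟨T, Ψ, m, hF, hρ⟩
    linarith [hρ.eq (hF.properties hβ he h1).1]
  · rintro rfl
    obtain ⟨T, Ψ, m, hF⟩ := exists_isEulerTransverseFlow hβ he
    exact ⟨T, Ψ, m, hF, (hF.properties hβ he h1).1⟩

theorem EulerHyperbolic.four_lt (h1 : |e| < 1) (h : EulerHyperbolic β e) :
    4 < (hill (7 * β) e h1).mono.trace ^ 2 := by
  obtain ⟨T, Ψ, m, hF, h⟩ := h
  rw [← (hF.properties hβ he h1).2.2]
  exact h.four_lt

theorem EulerPositiveHyperbolic.two_lt (h1 : |e| < 1) (h : EulerPositiveHyperbolic β e) :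
    2 < (hill (7 * β) e h1).mono.trace := by
  obtain ⟨T, Ψ, m, hF, h⟩ := h
  rw [← (hF.properties hβ he h1).2.2]
  exact h.two_lt

theorem eulerNegativeHyperbolic (h1 : |e| < 1) (h : 4 < (hill (7 * β) e h1).mono.trace ^ 2) :
    EulerNegativeHyperbolic β e := by
  obtain ⟨T, Ψ, m, hF⟩ := exists_isEulerTransverseFlow hβ he
  obtain ⟨-, hd, ht⟩ := hF.properties hβ he h1
  refine ⟨T, Ψ, m, hF, isNegativeHyperbolic_of_trace_lt hd ?_⟩
  rw [ht]
  exact (hill_trace_of_four_lt h1 (by linarith [hβ.1]) h).2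

end

theorem EulerNegativeHyperbolic.eulerHyperbolic {β e : ℝ} (h : EulerNegativeHyperbolic β e) :
    EulerHyperbolic β e := by
  obtain ⟨T, Ψ, m, hF, h⟩ := h
  exact ⟨T, Ψ, m, hF, h.isHyperbolic⟩

/-! ### The sets of parameters -/

theorem abs_lt_one_of_mem_params {x : ℝ × ℝ} (hx : x ∈ params) : |x.2| < 1 := by
  rw [abs_of_nonneg hx.2.1]; exact hx.2.2

theorem mem_params_of_mem_domain {x : ℝ × ℝ} (hx : x ∈ 𝒟) : x ∈ params := by
  obtain ⟨h1, h2, h3⟩ := hx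
  exact ⟨⟨h1, by nlinarith⟩, h2.le, by nlinarith⟩

theorem isOpen_domain : IsOpen 𝒟 := by
  have h1 : IsOpen {x : ℝ × ℝ | 0 < x.1} := isOpen_lt continuous_const continuous_fst
  have h2 : IsOpen {x : ℝ × ℝ | 0 < x.2} := isOpen_lt continuous_const continuous_snd
  have h3 : IsOpen {x : ℝ × ℝ | x.1 ^ 2 + x.2 ^ 2 < 1} :=
    isOpen_lt (by fun_prop) continuous_const
  exact h1.inter (h2.inter h3)

theorem mem_hyperbolicSet_of_mem_bothSigns {j : ℤ} {x : ℝ × ℝ} (h : x ∈ bothSigns j)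
    (hx : x ∈ Ioo (0 : ℝ) 1 ×ˢ Ioo (0 : ℝ) 1) : x ∈ hyperbolicSet (1 + j / 2) := by
  have hp : x ∈ params := ⟨hx.1, hx.2.1.le, hx.2.2⟩
  have h1 := abs_lt_one_of_mem_params hp
  obtain ⟨h4, hr⟩ := four_lt_of_mem_bothSigns h h1
  exact ⟨hp, (hasEulerRotationNumber_iff hp.1 hp.2 h1).2 (by rw [hr]),
    (eulerNegativeHyperbolic hp.1 hp.2 h1 h4).eulerHyperbolic⟩

theorem exists_odd_of_mem_hyperbolicSet {s : ℝ} {x : ℝ × ℝ} (h : x ∈ hyperbolicSet s) :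
    ∃ j : ℤ, Odd j ∧ s = 1 + j / 2 := by
  obtain ⟨hp, hρ, hh⟩ := h
  have h1 := abs_lt_one_of_mem_params hp
  obtain ⟨⟨j, hj, hr⟩, -⟩ := hill_trace_of_four_lt h1 (by linarith [hp.1.1])
    (hh.four_lt hp.1 hp.2 h1)
  exact ⟨j, hj, by rw [(hasEulerRotationNumber_iff hp.1 hp.2 h1).1 hρ, hr]⟩

theorem hyperbolicSet_natCast (k : ℕ) : hyperbolicSet k = ∅ := by
  refine eq_empty_of_forall_notMem fun x hx => ?_
  obtain ⟨j, ⟨i, hj⟩, hk⟩ := exists_odd_of_mem_hyperbolicSet hx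
  have h2 : (2 * k : ℝ) = 2 + j := by linarith
  have h3 : (2 * k : ℤ) = 2 + j := by exact_mod_cast h2
  omega

theorem isOpen_bothSigns_inter (j : ℤ) :
    IsOpen (bothSigns j ∩ Ioo (0 : ℝ) 1 ×ˢ Ioo (0 : ℝ) 1) :=
  (isOpen_bothSigns j).inter (isOpen_Ioo.prod isOpen_Ioo)

theorem containsNonemptyOpen_hyperbolicSet {j : ℤ} (hj : Odd j) (h3 : 3 ≤ j) :
    ContainsNonemptyOpen (hyperbolicSet (1 + j / 2)) :=
  ⟨_, isOpen_bothSigns_inter j, bothSigns_inter_nonempty hj h3, fun _ hx =>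
    mem_hyperbolicSet_of_mem_bothSigns hx.1 hx.2⟩

theorem containsNonemptyOpen_hyperbolicSet_inter {j : ℤ} (hj : Odd j) (h3 : 3 ≤ j) (h5 : j ≤ 5) :
    ContainsNonemptyOpen (hyperbolicSet (1 + j / 2) ∩ 𝒟) :=
  ⟨_, (isOpen_bothSigns j).inter (isOpen_domain.inter (isOpen_Ioo.prod isOpen_Ioo)),
    bothSigns_inter_domain_nonempty hj h3 h5, fun _ hx =>
    ⟨mem_hyperbolicSet_of_mem_bothSigns hx.1 hx.2.2, hx.2.1⟩⟩

theorem oddEvenSet_subset_rationalSet : oddEvenSet ⊆ rationalSet := by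
  rintro x ⟨hx, p, q, -, -, -, -, h⟩
  refine ⟨hx, (p : ℚ) / q, ?_⟩
  push_cast
  exact h

/-- It suffices to move `β` with `e` fixed: every interval of `b = 7β` contains a parameter with the
required rotation number. -/
theorem domain_subset_closure_oddEvenSet : 𝒟 ⊆ closure oddEvenSet := by
  intro x hx
  rw [_root_.mem_closure_iff]
  intro U hU hxU
  have hopen : IsOpen {b : ℝ | (b, x.2) ∈ U ∩ 𝒟} :=
    (hU.inter isOpen_domain).preimage (by fun_prop : Continuous fun b : ℝ => (b, x.2))
  obtain ⟨δ, hδ, hball⟩ := Metric.isOpen_iff.1 hopen x.1 ⟨hxU, hx⟩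
  have h1 := abs_lt_one_of_mem_params (mem_params_of_mem_domain hx)
  have hx1 := hx.1
  obtain ⟨c, hc, p, q, hp, hq, hpo, hqe, h⟩ := exists_odd_div_even (b₀ := 7 * x.1)
    (b₁ := 7 * (x.1 + δ / 2)) h1 (by linarith) (by linarith)
  have hmem : (c / 7, x.2) ∈ U ∩ 𝒟 := by
    refine hball ?_
    rw [Metric.mem_ball, Real.dist_eq, abs_lt]
    constructor <;> linarith [hc.1, hc.2]
  have hpar := mem_params_of_mem_domain hmem.2
  refine ⟨_, hmem.1, hmem.2, p, q, hp, hq, hpo, hqe, ?_⟩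
  refine (hasEulerRotationNumber_iff hpar.1 hpar.2 h1).2 ?_
  have e7 : 7 * (c / 7) = c := by ring
  simp only [e7]
  exact h.symm

theorem containsNonemptyOpen_oddEvenSet : ContainsNonemptyOpen oddEvenSet := by
  obtain ⟨U, hU, hne, hsub⟩ := containsNonemptyOpen_hyperbolicSet_inter (j := 3) (by decide) le_rfl
    (by norm_num)
  refine ⟨U, hU, hne, fun x hx => ?_⟩
  obtain ⟨⟨-, h, -⟩, hD⟩ := hsub hx
  refine ⟨hD, 5, 2, by norm_num, by norm_num, by decide, by decide, ?_⟩
  have : ((5 : ℕ) : ℝ) / (2 : ℕ) = 1 + (3 : ℤ) / 2 := by norm_num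
  rw [this]
  exact h

theorem ContainsNonemptyOpen.mono {S S' : Set (ℝ × ℝ)} (h : ContainsNonemptyOpen S)
    (hS : S ⊆ S') : ContainsNonemptyOpen S' := by
  obtain ⟨U, hU, hne, hsub⟩ := h
  exact ⟨U, hU, hne, hsub.trans hS⟩

end Isosceles

theorem theorem2p9 :
    -- the rotation number is well defined
    (∀ x ∈ Isosceles.params, ∃! ρ : ℝ, Isosceles.HasEulerRotationNumber x.1 x.2 ρ) ∧
    -- (i)
    ((∀ k : ℕ, 1 ≤ k → Isosceles.hyperbolicSet (k : ℝ) = ∅) ∧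
      ∀ x ∈ Isosceles.params, ¬ Isosceles.EulerPositiveHyperbolic x.1 x.2) ∧
    -- (ii)
    ((∀ k : ℕ, 2 ≤ k →
        Isosceles.ContainsNonemptyOpen (Isosceles.hyperbolicSet ((k : ℝ) + 1 / 2)) ∧
        ∀ x ∈ Isosceles.hyperbolicSet ((k : ℝ) + 1 / 2),
          Isosceles.EulerNegativeHyperbolic x.1 x.2) ∧
      Isosceles.ContainsNonemptyOpen (Isosceles.hyperbolicSet (5 / 2) ∩ Isosceles.𝒟) ∧
      Isosceles.ContainsNonemptyOpen (Isosceles.hyperbolicSet (7 / 2) ∩ Isosceles.𝒟)) ∧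
    -- (iii)
    ((Isosceles.𝒟 ⊆ closure Isosceles.rationalSet ∧
        Isosceles.ContainsNonemptyOpen Isosceles.rationalSet) ∧
      Isosceles.𝒟 ⊆ closure Isosceles.oddEvenSet ∧
        Isosceles.ContainsNonemptyOpen Isosceles.oddEvenSet) := by
  open Isosceles in
  refine ⟨fun x hx => ?_, ⟨fun k _ => hyperbolicSet_natCast k, fun x hx h => ?_⟩,
    ⟨fun k hk => ⟨?_, fun x hx => ?_⟩, ?_, ?_⟩,
    ⟨domain_subset_closure_oddEvenSet.trans (closure_mono oddEvenSet_subset_rationalSet),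
      containsNonemptyOpen_oddEvenSet.mono oddEvenSet_subset_rationalSet⟩,
    domain_subset_closure_oddEvenSet, containsNonemptyOpen_oddEvenSet⟩
  · have h1 := abs_lt_one_of_mem_params hx
    exact ⟨_, (hasEulerRotationNumber_iff hx.1 hx.2 h1).2 rfl, fun ρ hρ =>
      (hasEulerRotationNumber_iff hx.1 hx.2 h1).1 hρ⟩
  · have h1 := abs_lt_one_of_mem_params hx
    have h2 := h.two_lt hx.1 hx.2 h1
    have := (hill_trace_of_four_lt (b := 7 * x.1) h1 (by linarith [hx.1.1]) (by nlinarith)).2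
    linarith
  · have := containsNonemptyOpen_hyperbolicSet (j := 2 * k - 1) ⟨k - 1, by ring⟩ (by omega)
    have e1 : (1 : ℝ) + ((2 * k - 1 : ℤ) : ℝ) / 2 = k + 1 / 2 := by push_cast; ring
    rwa [e1] at this
  · obtain ⟨hp, -, hh⟩ := hx
    have h1 := abs_lt_one_of_mem_params hp
    exact eulerNegativeHyperbolic hp.1 hp.2 h1 (hh.four_lt hp.1 hp.2 h1)
  · have := containsNonemptyOpen_hyperbolicSet_inter (j := 3) (by decide) le_rfl (by norm_num)
    have e1 : (1 : ℝ) + ((3 : ℤ) : ℝ) / 2 = 5 / 2 := by norm_num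
    rwa [e1] at this
  · have := containsNonemptyOpen_hyperbolicSet_inter (j := 5) (by decide) (by norm_num) le_rfl
    have e1 : (1 : ℝ) + ((5 : ℤ) : ℝ) / 2 = 7 / 2 := by norm_num
    rwa [e1] at this
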